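/- **Expected latency versus $r$ in the $(n,r,1)$ partial fork-join system.** *Model.* There are $n\ge 1$ servers with first-come first-served queues, initially empty. Jobs arrive as a Poisson process of rate $\lambda>0$. Each arriving job is forked to $r$ of the $n$ servers ($1\le r\le n$); as soon as one of its $r$ tasks is served, its other tasks are cancelled and leave their queues or servers, and the job departs. Task service times are i.i.d. over jobs and servers, independent of the arrivals, with the law of a random variable $X>0$ with tail $\bar F_X(x)=\Pr(X>x)$. A *policy* with parameter $r$ selects the $r$ servers of each job from the information available at its arrival (arrivals up to then, service times of earlier jobs, independent randomisation); in particular this covers every symmetric policy, such as uniform random, group-based random, round-robin, shortest queue or least work left. For $r=n$ there is only one policy, forking to all servers; for $r=1$, the *uniform random* policy sends each job to one server chosen uniformly and independently of everything else. Let $T_j$ be the time from the arrival of job $j$ until one of its tasks is complete. The expected latency $E[T]\in[0,\infty]$ is the long-run average $\lim_k \frac1{k+1}\sum_{j=0}^{k}E[T_j]$. If this limit is not known to exist, write $\overline{E}[T]$ and $\underline{E}[T]$ for the corresponding $\limsup$ and $\liminf$. The service capacity $\lambda_{\max}$ of a policy is the supremum of the rates $\lambda>0$ with $\overline{E}[T]<\infty$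 (and $0$ if there is none). $\bar F_X$ is log-concave (log-convex) if $\log\bar F_X$ is concave (convex) on $[0,\infty)$, with $\log 0=-\infty$. *Claim.* 1. (Low traffic, any service distribution.) For every $\varepsilon>0$ there is $\lambda_0>0$, depending only on $n$, $F_X$ and $\varepsilon$, such that for all $0<\lambda<\lambda_0$, all $1\le r<n$ and all policies with parameter $r$, $\overline{E}[T]$ under forking to all servers is at most $\underline{E}[T]+\varepsilon$ under that policy. If $X$ is not almost surely constant, there is $\lambda_0>0$, depending only on $n$ and $F_X$, for which this holds with $\varepsilon=0$. 2. (High traffic, log-concave.) Suppose that $\bar F_X$ is log-concave and $X$ is not exponentially distributed. Let $\lambda_{\max}$ be the service capacity of the uniform random policy with $r=1$. There is $\lambda_0<\lambda_{\max}$ such that for all $\lambda>\lambda_0$, all $2\le r\le n$ and all policies with parameter $r$: every policy with $r=1$ has $\overline{E}[T]$ at most $\underline{E}[T]$ of the given policy; and if moreover $\lambda<\lambda_{\max}$, then $\overline{E}[T]$ of the uniform random policy with $r=1$ is strictly smaller than $\underline{E}[T]$ of the given policy. 3. (High traffic, log-convex.) Suppose that $\bar F_X$ is log-convex and let $\lambda_{\max}$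 be the service capacity of forking to all servers. There is $\lambda_0\ge0$ with $\lambda_0<\lambda_{\max}$ (or $\lambda_0=0$ if $\lambda_{\max}=0$) such that for all $\lambda>\lambda_0$, all $1\le r<n$ and all policies with parameter $r$, $\overline{E}[T]$ under forking to all servers is at most $\underline{E}[T]$ under that policy. -/

import Mathlib

open MeasureTheory ProbabilityTheory Filter
open scoped ENNReal

namespace ForkJoin

/-! ### Sample-path dynamics of a partial fork-join system

Jobs are numbered `0, 1, 2, …` in order of arrival. Job `j` arrives at time `A j`, is forked to the
servers in `R j`, and the copy at server `i` needs the service time `X j i`. Queues are first-come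
first-served, and all copies of a job leave at the instant the first of them completes service. -/

section Dynamics

variable {n : ℕ}

/-- Completion time of a job that arrives at time `a`, is forked to the servers in `R`, has service
times `x`, and finds that the earlier jobs leave the queue of server `i` empty from time `free i`
on: the copy at `i` starts (unless it is cancelled before) at `max a (free i)`, and the job is
complete as soon as one copy is. For nonempty `R` this is a minimum over a finite nonempty set. -/
noncomputable def finish (a : ℝ) (R : Finset (Fin n)) (x free : Fin n → ℝ) : ℝ :=
  ⨅ i : {i // i ∈ R}, (max a (free i) + x i)

/-- `serverFree A R X j i` is the time from which server `i` holds no copy of any of the jobs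
`0, …, j - 1`: the largest completion time among those of these jobs that were forked to `i`
(the system starts empty at time `0`). -/
noncomputable def serverFree (A : ℕ → ℝ) (R : ℕ → Finset (Fin n)) (X : ℕ → Fin n → ℝ) :
    ℕ → Fin n → ℝ
  | 0 => fun _ => 0
  | j + 1 => fun i =>
      if i ∈ R j then
        max (serverFree A R X j i) (finish (A j) (R j) (X j) (serverFree A R X j))
      else serverFree A R X j i

/-- Response time of job `j`: from its arrival until one of its copies is complete. -/
noncomputable def responseTime (A : ℕ → ℝ) (R : ℕ → Finset (Fin n)) (X : ℕ → Fin n → ℝ)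
    (j : ℕ) : ℝ :=
  finish (A j) (R j) (X j) (serverFree A R X j) - A j

end Dynamics

/-! ### Randomness -/

/-- Sample space: for every job, the time since the previous arrival, the service times of its
(potential) copies at the `n` servers, and a uniform variable available to a randomised policy. -/
abbrev Path (n : ℕ) : Type := ℕ → ℝ × (Fin n → ℝ) × unitInterval

section Randomness

variable {n : ℕ}

/-- Interarrival time before job `k`. -/
def gap (k : ℕ) (w : Path n) : ℝ := (w k).1

/-- Service times of job `k` at the servers. -/
def service (k : ℕ) (w : Path n) : Fin n → ℝ := (w k).2.1

/-- Randomisation variable of job `k`. -/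
def seed (k : ℕ) (w : Path n) : unitInterval := (w k).2.2

/-- Arrival time of job `j`. -/
noncomputable def arrival (j : ℕ) (w : Path n) : ℝ := ∑ k ∈ Finset.range (j + 1), gap k w

/-- Law of the primitives: Poisson arrivals of rate `l > 0`, service times with law `μ`,
i.i.d. over jobs and servers, and uniform seeds, all independent. -/
noncomputable def law (n : ℕ) (μ : Measure ℝ) (l : ℝ) : Measure (Path n) :=
  Measure.infinitePi fun _ : ℕ =>
    (expMeasure l).prod ((Measure.pi fun _ : Fin n => μ).prod (volume : Measure unitInterval))

/-- The information available when job `j` arrives: the arrivals up to job `j`, the service times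
of the earlier jobs, and the seeds up to job `j`. -/
abbrev past (n j : ℕ) : MeasurableSpace (Path n) :=
  (⨆ k ≤ j, MeasurableSpace.comap (gap k) inferInstance) ⊔
  (⨆ k < j, MeasurableSpace.comap (service k) inferInstance) ⊔
  (⨆ k ≤ j, MeasurableSpace.comap (seed k) inferInstance)

end Randomness

/-- A (possibly randomised and state-dependent) policy of the `(n, r, 1)` partial fork-join system:
every job is forked to `r` of the `n` servers, chosen on the basis of the information available at
its arrival. -/
structure Policy (n r : ℕ) where
  choice : ℕ → Path n → Finset (Fin n)
  card_choice : ∀ j w, (choice j w).card = r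
  measurable_choice : ∀ j s, MeasurableSet[past n j] {w | choice j w = s}

/-- Forking every job to all `n` servers: the only policy with `r = n`. -/
def forkAll (n : ℕ) : Policy n n where
  choice _ _ := Finset.univ
  card_choice _ _ := by simp
  measurable_choice _ _ := MeasurableSet.const _

/-- The policy with `r = 1` that sends every job to one server, chosen uniformly at random and
independently of everything else. -/
noncomputable def uniformSingle (n : ℕ) [NeZero n] : Policy n 1 where
  choice j w := {Fin.ofNat n ⌊(n : ℝ) * (seed j w : ℝ)⌋₊}
  card_choice _ _ := by simp
  measurable_choice j s := by
    have h1 : Measurable[past n j] (seed j : Path n → unitInterval) := by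
      apply Measurable.mono (comap_measurable (seed j)) _ le_rfl
      exact le_sup_of_le_right (le_iSup₂_of_le j le_rfl le_rfl)
    have h2 : Measurable fun u : unitInterval => ⌊(n : ℝ) * (u : ℝ)⌋₊ := by fun_prop
    exact (h2.comp h1) (MeasurableSet.of_discrete
      (s := {k : ℕ | ({Fin.ofNat n k} : Finset (Fin n)) = s}))

section Latency

variable {n r : ℕ}

/-- Expected response time `E[T_j]` of job `j`, at arrival rate `l` and service law `μ`. -/
noncomputable def jobLatency (μ : Measure ℝ) (l : ℝ) (p : Policy n r) (j : ℕ) : ℝ≥0∞ :=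
  ∫⁻ w, ENNReal.ofReal
    (responseTime (fun k => arrival k w) (fun k => p.choice k w) (fun k => service k w) j)
    ∂(law n μ l)

/-- Average of the expected response times of the jobs `0, …, k`. -/
noncomputable def meanLatency (μ : Measure ℝ) (l : ℝ) (p : Policy n r) (k : ℕ) : ℝ≥0∞ :=
  (∑ j ∈ Finset.range (k + 1), jobLatency μ l p j) / ((k + 1 : ℕ) : ℝ≥0∞)

/-- Upper long-run expected latency. It equals the latency `E[T]` whenever the long-run average
exists. -/
noncomputable def upperLatency (μ : Measure ℝ) (l : ℝ) (p : Policy n r) : ℝ≥0∞ :=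
  limsup (meanLatency μ l p) atTop

/-- Lower long-run expected latency. It equals the latency `E[T]` whenever the long-run average
exists. -/
noncomputable def lowerLatency (μ : Measure ℝ) (l : ℝ) (p : Policy n r) : ℝ≥0∞ :=
  liminf (meanLatency μ l p) atTop

/-- Service capacity of a policy: the supremum of the arrival rates at which the expected latency
is finite. -/
noncomputable def capacity (μ : Measure ℝ) (p : Policy n r) : ℝ≥0∞ :=
  ⨆ (l : ℝ) (_ : 0 < l) (_ : upperLatency μ l p < ∞), ENNReal.ofReal l

end Latency

/-- Tail `P(X > x)` of the service-time law. -/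
noncomputable def tail (μ : Measure ℝ) (x : ℝ) : ℝ := μ.real (Set.Ioi x)

/-- `log P(X > x)` is concave in `x ∈ [0, ∞)`, written multiplicatively so that it is correct where
the tail vanishes (where the logarithm is `-∞`). -/
def LogConcaveTail (μ : Measure ℝ) : Prop :=
  ∀ x y a b : ℝ, 0 ≤ x → 0 ≤ y → 0 < a → 0 < b → a + b = 1 →
    tail μ x ^ a * tail μ y ^ b ≤ tail μ (a * x + b * y)

/-- `log P(X > x)` is convex in `x ∈ [0, ∞)`, written multiplicatively. -/
def LogConvexTail (μ : Measure ℝ) : Prop :=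
  ∀ x y a b : ℝ, 0 ≤ x → 0 ≤ y → 0 < a → 0 < b → a + b = 1 →
    tail μ (a * x + b * y) ≤ tail μ x ^ a * tail μ y ^ b

end ForkJoin

/-! Call the consumption of a job the total time that the servers spend on it. The theorem splits
into a comparison of means in low traffic, statements that policies are unstable in high traffic,
and one exact comparison for exponential service times.

Low traffic. Every response time dominates the minimum of the service times of the job's `r` copies
(`le_jobLatency`). Forking to all servers is a single queue served with the minimum of `n` service
times, and the drift of the squared waiting time (`sum_lintegral_lindley_le`, a Pollaczek–Khinchine
bound) puts its latency within O(λ) of the mean minimum. If `X` is not constant, the mean minima for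
`n - 1` and `n` copies differ, which absorbs the error. If the minimum of `n` service times has
infinite second moment, that bound is void, but then every policy has infinite latency
(`lowerLatency_eq_top_of_heavy_tail`): with probability of order `t * tail t ^ n` all servers get
blocked for a time of order `t`, and of order `t` jobs then wait that long.

High traffic. The competing policies have infinite latency: `n` servers do at most `n` units of work
per unit of time, so jobs of too large mean consumption fall behind linearly
(`lowerLatency_eq_top_of_consumption`). The probability that the consumption exceeds `u` is the
product of the service tails at the elapsed times of the copies when these times add up to `u`
(`measure_lt_consumption`). For a log-convex tail Jensen's inequality makes the equal split the
cheapest, and cheaper the more copies share it. For a log-concave tail the product is at least the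
tail at `u`, which is what a single copy gives. Equality forces `tail (ρ x) = tail x ^ ρ` and hence
the exponential law (`exists_eq_expMeasure`).

In the log-concave case the surplus is not uniform: a second copy due to start long after the first
hardly ever runs. If the delay is `d`, the surplus is at least `δ E (X - d)⁺`, while the job
prolongs the busy period of the system by at most `E (X - d)⁺` on average. So the surplus always
pays for `δ` times the busy time, and the effective capacity drops from `n` to `n - δ`
(`LogConcaveTail.exists_consumption_bound`, `sum_workDone_le`).

The exponential law is log-convex, but there all consumptions have the same law and no policy is
excluded by stability. Instead, the mean response time of a job is at least the service rate times
the mean growth of half the sum of squared workloads (`lintegral_sq_le_lintegral_finish`), with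
equality in the balanced system of forking to all servers, and convexity makes the balanced system
have the least total growth (`sum_sq_le_of_lindley`, `sum_jobLatency_forkAll_le`). -/

namespace ForkJoin

variable {n : ℕ}

/-! ### Resampling coordinates of the sample space -/

/-- Law of the primitives of one job. -/
noncomputable def stepLaw (n : ℕ) (μ : Measure ℝ) (l : ℝ) :
    Measure (ℝ × (Fin n → ℝ) × unitInterval) :=
  (expMeasure l).prod ((Measure.pi fun _ : Fin n => μ).prod (volume : Measure unitInterval))

lemma law_eq (μ : Measure ℝ) (l : ℝ) :
    law n μ l = Measure.infinitePi fun _ : ℕ => stepLaw n μ l := rfl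

/-- Replace the interarrival time before job `k`. -/
def setGap (k : ℕ) (g : ℝ) (w : Path n) : Path n := Function.update w k (g, (w k).2)

/-- Replace the service times of job `k`. -/
def setService (k : ℕ) (x : Fin n → ℝ) (w : Path n) : Path n :=
  Function.update w k ((w k).1, x, (w k).2.2)

/-- Replace the service times and the seed of job `k`. -/
def setMark (k : ℕ) (y : (Fin n → ℝ) × unitInterval) (w : Path n) : Path n :=
  Function.update w k ((w k).1, y)

section Resampling

variable (μ : Measure ℝ) [IsProbabilityMeasure μ] (l : ℝ)

lemma isProbabilityMeasure_stepLaw (hl : 0 < l) : IsProbabilityMeasure (stepLaw n μ l) := by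
  have := isProbabilityMeasure_expMeasure hl
  unfold stepLaw; infer_instance

lemma isProbabilityMeasure_law (hl : 0 < l) : IsProbabilityMeasure (law n μ l) := by
  have := isProbabilityMeasure_stepLaw (n := n) μ l hl
  rw [law_eq]; infer_instance

lemma measurable_update_pair (k : ℕ) :
    Measurable fun z : Path n × (ℝ × (Fin n → ℝ) × unitInterval) =>
      (Function.update z.1 k z.2 : Path n) := by
  refine measurable_pi_lambda _ fun j => ?_
  by_cases h : j = k
  · subst h; simpa using measurable_snd
  · simp only [Function.update_of_ne h]; fun_prop

variable {l}

/-- A fresh independent draw in one coordinate leaves a product law unchanged. This replaces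
conditional expectations throughout: the inner integral is the expectation given all other
coordinates. -/
lemma lintegral_update (hl : 0 < l) (k : ℕ) {f : Path n → ℝ≥0∞} (hf : Measurable f) :
    ∫⁻ w, f w ∂law n μ l
      = ∫⁻ w, ∫⁻ e, f (Function.update w k e) ∂stepLaw n μ l ∂law n μ l := by
  have := isProbabilityMeasure_stepLaw (n := n) μ l hl
  have := isProbabilityMeasure_law (n := n) μ l hl
  have hm := measurable_update_pair (n := n) k
  have key : ((law n μ l).prod (stepLaw n μ l)).map
      (fun z => (Function.update z.1 k z.2 : Path n)) = law n μ l := by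
    conv_rhs => rw [law_eq]
    refine Measure.eq_infinitePi (fun _ => stepLaw n μ l) fun s t ht => ?_
    rw [Measure.map_apply hm (MeasurableSet.pi s.countable_toSet fun i _ => ht i)]
    have hset : (fun z : Path n × (ℝ × (Fin n → ℝ) × unitInterval) =>
        (Function.update z.1 k z.2 : Path n)) ⁻¹' (Set.pi s t)
        = (Set.pi (s.erase k) t) ×ˢ (if k ∈ s then t k else Set.univ) := by
      ext ⟨w, e⟩
      simp only [Set.mem_preimage, Set.mem_pi, Finset.mem_coe, Finset.coe_erase, Set.mem_prod,
        Set.mem_sdiff, Set.mem_singleton_iff]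
      constructor
      · intro h
        refine ⟨fun i hi => by simpa [hi.2] using h i hi.1, ?_⟩
        split_ifs with hk
        · simpa using h k hk
        · trivial
      · rintro ⟨h1, h2⟩ i hi
        by_cases hik : i = k
        · subst hik; simpa [hi] using h2
        · simpa [hik] using h1 i ⟨hi, hik⟩
    rw [hset, Measure.prod_prod, law_eq, Measure.infinitePi_pi _ (fun i _ => ht i)]
    by_cases hk : k ∈ s
    · simp only [hk, if_true]
      rw [Finset.prod_erase_mul _ _ hk]
    · simp [hk]
  conv_lhs => rw [← key]
  rw [lintegral_map hf hm]
  exact lintegral_prod _ (hf.comp hm).aemeasurable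

lemma lintegral_setGap (hl : 0 < l) (k : ℕ) {f : Path n → ℝ≥0∞} (hf : Measurable f) :
    ∫⁻ w, f w ∂law n μ l
      = ∫⁻ w, ∫⁻ g, f (setGap k g w) ∂expMeasure l ∂law n μ l := by
  have := isProbabilityMeasure_expMeasure hl
  have hm := measurable_update_pair (n := n) k
  have h1 : Measurable fun z : Path n × ℝ => f (setGap k z.2 z.1) := by
    refine hf.comp ((hm.comp (f := fun z : Path n × ℝ => (z.1, (z.2, (z.1 k).2))) ?_))
    fun_prop
  -- The whole coordinate is redrawn on both sides; on the right the redrawn gap is overwritten and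
  -- integrates out.
  rw [lintegral_update μ hl k hf, lintegral_update μ hl k h1.lintegral_prod_right']
  refine lintegral_congr fun w => ?_
  have h2 : Measurable fun e => f (Function.update w k e) :=
    hf.comp (hm.comp (measurable_const.prodMk measurable_id))
  have h3 : Measurable fun e => ∫⁻ g, f (setGap k g (Function.update w k e)) ∂expMeasure l :=
    h1.lintegral_prod_right'.comp (hm.comp (measurable_const.prodMk measurable_id))
  unfold stepLaw
  rw [lintegral_prod_symm' _ h2, lintegral_prod_symm' _ h3]
  simp [setGap]

lemma lintegral_setMark (hl : 0 < l) (k : ℕ) {f : Path n → ℝ≥0∞} (hf : Measurable f) :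
    ∫⁻ w, f w ∂law n μ l
      = ∫⁻ w, ∫⁻ y, f (setMark k y w)
          ∂((Measure.pi fun _ : Fin n => μ).prod (volume : Measure unitInterval)) ∂law n μ l := by
  have := isProbabilityMeasure_expMeasure hl
  have hm := measurable_update_pair (n := n) k
  have h1 : Measurable fun z : Path n × ((Fin n → ℝ) × unitInterval) => f (setMark k z.2 z.1) := by
    refine hf.comp ((hm.comp
      (f := fun z : Path n × ((Fin n → ℝ) × unitInterval) => (z.1, ((z.1 k).1, z.2))) ?_))
    fun_prop
  rw [lintegral_update μ hl k hf, lintegral_update μ hl k h1.lintegral_prod_right']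
  refine lintegral_congr fun w => ?_
  have h2 : Measurable fun e => f (Function.update w k e) :=
    hf.comp (hm.comp (measurable_const.prodMk measurable_id))
  have h3 : Measurable fun e => ∫⁻ y, f (setMark k y (Function.update w k e))
      ∂((Measure.pi fun _ : Fin n => μ).prod (volume : Measure unitInterval)) :=
    h1.lintegral_prod_right'.comp (hm.comp (measurable_const.prodMk measurable_id))
  unfold stepLaw
  rw [lintegral_prod _ h2.aemeasurable, lintegral_prod _ h3.aemeasurable]
  simp [setMark]

lemma measurable_setService_pair (k : ℕ) :
    Measurable fun z : Path n × (Fin n → ℝ) => setService k z.2 z.1 := by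
  refine (measurable_update_pair (n := n) k).comp
      (f := fun z : Path n × (Fin n → ℝ) => (z.1, ((z.1 k).1, z.2, (z.1 k).2.2))) ?_
  fun_prop

lemma lintegral_setService (hl : 0 < l) (k : ℕ) {f : Path n → ℝ≥0∞} (hf : Measurable f) :
    ∫⁻ w, f w ∂law n μ l
      = ∫⁻ w, ∫⁻ x, f (setService k x w) ∂(Measure.pi fun _ : Fin n => μ) ∂law n μ l := by
  have hm := measurable_update_pair (n := n) k
  have h1 : Measurable fun z : Path n × (Fin n → ℝ) => f (setService k z.2 z.1) :=
    hf.comp (measurable_setService_pair k)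
  rw [lintegral_setMark μ hl k hf, lintegral_setMark μ hl k h1.lintegral_prod_right']
  refine lintegral_congr fun w => ?_
  have hm' : Measurable fun y => setMark k y w :=
    hm.comp (measurable_const.prodMk (measurable_const.prodMk measurable_id))
  have h2 : Measurable fun y => f (setMark k y w) := hf.comp hm'
  have h3 : Measurable fun y => ∫⁻ x, f (setService k x (setMark k y w))
      ∂(Measure.pi fun _ : Fin n => μ) := h1.lintegral_prod_right'.comp hm'
  rw [lintegral_prod_symm' _ h2, lintegral_prod_symm' _ h3]
  simp [setMark, setService]

end Resampling

/-! ### Effect of replacing a coordinate, and dependence of a policy on the past only -/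

section Coordinates

lemma gap_setService (j k : ℕ) (x : Fin n → ℝ) (w : Path n) :
    gap j (setService k x w) = gap j w := by
  by_cases h : j = k
  · subst h; simp [gap, setService]
  · simp [gap, setService, h]

lemma seed_setService (j k : ℕ) (x : Fin n → ℝ) (w : Path n) :
    seed j (setService k x w) = seed j w := by
  by_cases h : j = k
  · subst h; simp [seed, setService]
  · simp [seed, setService, h]

lemma service_setService_self (k : ℕ) (x : Fin n → ℝ) (w : Path n) :
    service k (setService k x w) = x := by simp [service, setService]

lemma service_setService_of_ne {j k : ℕ} (h : j ≠ k) (x : Fin n → ℝ) (w : Path n) :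
    service j (setService k x w) = service j w := by simp [service, setService, h]

lemma arrival_setService (j k : ℕ) (x : Fin n → ℝ) (w : Path n) :
    arrival j (setService k x w) = arrival j w := by simp [arrival, gap_setService]

lemma gap_setGap_self (k : ℕ) (g : ℝ) (w : Path n) : gap k (setGap k g w) = g := by
  simp [gap, setGap]

lemma gap_setGap_of_ne {j k : ℕ} (h : j ≠ k) (g : ℝ) (w : Path n) :
    gap j (setGap k g w) = gap j w := by simp [gap, setGap, h]

lemma service_setGap (j k : ℕ) (g : ℝ) (w : Path n) :
    service j (setGap k g w) = service j w := by
  by_cases h : j = k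
  · subst h; simp [service, setGap]
  · simp [service, setGap, h]

lemma seed_setGap (j k : ℕ) (g : ℝ) (w : Path n) :
    seed j (setGap k g w) = seed j w := by
  by_cases h : j = k
  · subst h; simp [seed, setGap]
  · simp [seed, setGap, h]

lemma gap_setMark (j k : ℕ) (y : (Fin n → ℝ) × unitInterval) (w : Path n) :
    gap j (setMark k y w) = gap j w := by
  by_cases h : j = k
  · subst h; simp [gap, setMark]
  · simp [gap, setMark, h]

lemma service_setMark_self (k : ℕ) (y : (Fin n → ℝ) × unitInterval) (w : Path n) :
    service k (setMark k y w) = y.1 := by simp [service, setMark]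

lemma seed_setMark_self (k : ℕ) (y : (Fin n → ℝ) × unitInterval) (w : Path n) :
    seed k (setMark k y w) = y.2 := by simp [seed, setMark]

lemma service_setMark_of_ne {j k : ℕ} (h : j ≠ k) (y : (Fin n → ℝ) × unitInterval)
    (w : Path n) : service j (setMark k y w) = service j w := by simp [service, setMark, h]

lemma seed_setMark_of_ne {j k : ℕ} (h : j ≠ k) (y : (Fin n → ℝ) × unitInterval)
    (w : Path n) : seed j (setMark k y w) = seed j w := by simp [seed, setMark, h]

@[fun_prop] lemma measurable_gap (k : ℕ) : Measurable (gap k : Path n → ℝ) := by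
  unfold gap; fun_prop

@[fun_prop] lemma measurable_service (k : ℕ) : Measurable (service k : Path n → Fin n → ℝ) := by
  unfold service; fun_prop

@[fun_prop] lemma measurable_seed (k : ℕ) : Measurable (seed k : Path n → unitInterval) := by
  unfold seed; fun_prop

@[fun_prop] lemma measurable_arrival (k : ℕ) : Measurable (arrival k : Path n → ℝ) := by
  unfold arrival; fun_prop

lemma past_le (j : ℕ) : past n j ≤ MeasurableSpace.pi := by
  refine sup_le (sup_le ?_ ?_) ?_ <;> refine iSup₂_le fun k _ => Measurable.comap_le ?_
  · exact measurable_gap k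
  · exact measurable_service k
  · exact measurable_seed k

/-- The sets that do not separate `w` from `w'` form a σ-algebra, and it contains the generators of
`past n j`. -/
lemma mem_iff_of_past {j : ℕ} {s : Set (Path n)} (hs : MeasurableSet[past n j] s) {w w' : Path n}
    (hg : ∀ k ≤ j, gap k w = gap k w') (hx : ∀ k < j, service k w = service k w')
    (hu : ∀ k ≤ j, seed k w = seed k w') : w ∈ s ↔ w' ∈ s := by
  let m : MeasurableSpace (Path n) :=
    { MeasurableSet' := fun s => w ∈ s ↔ w' ∈ s
      measurableSet_empty := by simp
      measurableSet_compl := fun s h => by simp only [Set.mem_compl_iff]; exact not_congr h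
      measurableSet_iUnion := fun f h => by
        simp only [Set.mem_iUnion]; exact exists_congr h }
  have hle : past n j ≤ m := by
    refine sup_le (sup_le ?_ ?_) ?_ <;> refine iSup₂_le fun k hk => ?_
    · rintro _ ⟨t, -, rfl⟩
      change gap k w ∈ t ↔ gap k w' ∈ t
      rw [hg k hk]
    · rintro _ ⟨t, -, rfl⟩
      change service k w ∈ t ↔ service k w' ∈ t
      rw [hx k hk]
    · rintro _ ⟨t, -, rfl⟩
      change seed k w ∈ t ↔ seed k w' ∈ t
      rw [hu k hk]
  exact hle s hs

variable {r : ℕ}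

lemma Policy.choice_congr (p : Policy n r) {j : ℕ} {w w' : Path n}
    (hg : ∀ k ≤ j, gap k w = gap k w') (hx : ∀ k < j, service k w = service k w')
    (hu : ∀ k ≤ j, seed k w = seed k w') : p.choice j w = p.choice j w' :=
  ((mem_iff_of_past (p.measurable_choice j (p.choice j w)) hg hx hu).1 rfl).symm

lemma Policy.choice_setService (p : Policy n r) {j k : ℕ} (h : j ≤ k) (x : Fin n → ℝ)
    (w : Path n) : p.choice j (setService k x w) = p.choice j w :=
  p.choice_congr (fun _ _ => gap_setService _ _ _ _)
    (fun _ hi => service_setService_of_ne (by omega) _ _) (fun _ _ => seed_setService _ _ _ _)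

lemma Policy.choice_setGap (p : Policy n r) {j k : ℕ} (h : j < k) (g : ℝ)
    (w : Path n) : p.choice j (setGap k g w) = p.choice j w :=
  p.choice_congr (fun _ hi => gap_setGap_of_ne (by omega) _ _)
    (fun _ _ => service_setGap _ _ _ _) (fun _ _ => seed_setGap _ _ _ _)

lemma Policy.choice_setMark (p : Policy n r) {j k : ℕ} (h : j < k)
    (y : (Fin n → ℝ) × unitInterval)
    (w : Path n) : p.choice j (setMark k y w) = p.choice j w :=
  p.choice_congr (fun _ _ => gap_setMark _ _ _ _)
    (fun _ hi => service_setMark_of_ne (by omega) _ _)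
    (fun _ hi => seed_setMark_of_ne (by omega) _ _)

lemma Policy.measurableSet_choice (p : Policy n r) (j : ℕ) (s : Finset (Fin n)) :
    MeasurableSet {w | p.choice j w = s} := past_le j _ (p.measurable_choice j s)

end Coordinates

/-! ### The dynamics along a sample path -/

section PathDynamics

lemma serverFree_congr {A A' : ℕ → ℝ} {R R' : ℕ → Finset (Fin n)} {X X' : ℕ → Fin n → ℝ} {j : ℕ}
    (hA : ∀ k < j, A k = A' k) (hR : ∀ k < j, R k = R' k) (hX : ∀ k < j, X k = X' k) :
    serverFree A R X j = serverFree A' R' X' j := by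
  induction j with
  | zero => rfl
  | succ j ih =>
    have ih' := ih (fun k hk => hA k (by omega)) (fun k hk => hR k (by omega))
      (fun k hk => hX k (by omega))
    ext i
    simp only [serverFree, ih', hA j (by omega), hR j (by omega), hX j (by omega)]

variable {r : ℕ}

/-- Time from which server `i` holds no copy of the jobs before `j`, under the policy `p`. -/
noncomputable def freeAt (p : Policy n r) (j : ℕ) (w : Path n) : Fin n → ℝ :=
  serverFree (fun k => arrival k w) (fun k => p.choice k w) (fun k => service k w) j

/-- Completion time of job `j` under the policy `p`. -/
noncomputable def finishAt (p : Policy n r) (j : ℕ) (w : Path n) : ℝ :=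
  finish (arrival j w) (p.choice j w) (service j w) (freeAt p j w)

lemma jobLatency_eq (μ : Measure ℝ) (l : ℝ) (p : Policy n r) (j : ℕ) :
    jobLatency μ l p j = ∫⁻ w, ENNReal.ofReal (finishAt p j w - arrival j w) ∂law n μ l := rfl

lemma freeAt_zero (p : Policy n r) (w : Path n) (i : Fin n) : freeAt p 0 w i = 0 := rfl

lemma freeAt_succ (p : Policy n r) (j : ℕ) (w : Path n) (i : Fin n) :
    freeAt p (j + 1) w i = if i ∈ p.choice j w then max (freeAt p j w i) (finishAt p j w)
      else freeAt p j w i := rfl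

lemma freeAt_setService (p : Policy n r) {j k : ℕ} (h : j ≤ k) (x : Fin n → ℝ) (w : Path n) :
    freeAt p j (setService k x w) = freeAt p j w :=
  serverFree_congr (fun _ _ => arrival_setService _ _ _ _)
    (fun _ hi => p.choice_setService (by omega) _ _)
    (fun _ hi => service_setService_of_ne (by omega) _ _)

lemma finishAt_setService_of_lt (p : Policy n r) {j k : ℕ} (h : j < k) (x : Fin n → ℝ)
    (w : Path n) : finishAt p j (setService k x w) = finishAt p j w := by
  simp only [finishAt, arrival_setService, p.choice_setService h.le, freeAt_setService p h.le,
    service_setService_of_ne h.ne]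

lemma finishAt_setService_self (p : Policy n r) (k : ℕ) (x : Fin n → ℝ)
    (w : Path n) : finishAt p k (setService k x w)
      = finish (arrival k w) (p.choice k w) x (freeAt p k w) := by
  simp only [finishAt, arrival_setService, p.choice_setService le_rfl, freeAt_setService p le_rfl,
    service_setService_self]

lemma arrival_setGap_of_lt {j k : ℕ} (h : j < k) (g : ℝ) (w : Path n) :
    arrival j (setGap k g w) = arrival j w := by
  unfold arrival
  refine Finset.sum_congr rfl fun i hi => gap_setGap_of_ne ?_ _ _
  have := Finset.mem_range.1 hi
  omega

lemma arrival_setMark (j k : ℕ) (y : (Fin n → ℝ) × unitInterval) (w : Path n) :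
    arrival j (setMark k y w) = arrival j w := by simp [arrival, gap_setMark]

lemma freeAt_setGap (p : Policy n r) {j k : ℕ} (h : j ≤ k) (g : ℝ) (w : Path n) :
    freeAt p j (setGap k g w) = freeAt p j w :=
  serverFree_congr (fun _ hi => arrival_setGap_of_lt (by omega) _ _)
    (fun _ hi => p.choice_setGap (by omega) _ _) (fun _ _ => service_setGap _ _ _ _)

lemma freeAt_setMark (p : Policy n r) {j k : ℕ} (h : j ≤ k) (y : (Fin n → ℝ) × unitInterval)
    (w : Path n) : freeAt p j (setMark k y w) = freeAt p j w :=
  serverFree_congr (fun _ _ => arrival_setMark _ _ _ _)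
    (fun _ hi => p.choice_setMark (by omega) _ _)
    (fun _ hi => service_setMark_of_ne (by omega) _ _)

@[fun_prop] lemma measurable_finish_prod (R : Finset (Fin n)) :
    Measurable fun z : ℝ × (Fin n → ℝ) × (Fin n → ℝ) => finish z.1 R z.2.1 z.2.2 := by
  unfold finish
  refine Measurable.iInf fun i => ?_
  fun_prop

/-- A function that is measurable for each fixed value of the choice is measurable. -/
lemma Policy.measurable_of_choice (p : Policy n r) (j : ℕ) {β : Type*} [MeasurableSpace β]
    {f : Finset (Fin n) → Path n → β} (hf : ∀ s, Measurable (f s)) :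
    Measurable fun w => f (p.choice j w) w := by
  intro t ht
  have : (fun w => f (p.choice j w) w) ⁻¹' t
      = ⋃ s : Finset (Fin n), {w | p.choice j w = s} ∩ f s ⁻¹' t := by
    ext w; simp
  rw [this]
  exact MeasurableSet.iUnion fun s => (p.measurableSet_choice j s).inter (hf s ht)

@[fun_prop] lemma measurable_freeAt (p : Policy n r) (j : ℕ) : Measurable (freeAt p j) := by
  induction j with
  | zero => exact measurable_const
  | succ j ih =>
    refine measurable_pi_lambda _ fun i => ?_
    simp only [freeAt_succ, finishAt]
    refine p.measurable_of_choice j (f := fun s w => if i ∈ s then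
      max (freeAt p j w i) (finish (arrival j w) s (service j w) (freeAt p j w))
      else freeAt p j w i) fun s => ?_
    have h1 : Measurable fun w => freeAt p j w i := (measurable_pi_apply i).comp ih
    split_ifs
    · refine h1.max ((measurable_finish_prod s).comp
        (f := fun w => (arrival j w, service j w, freeAt p j w)) ?_)
      fun_prop
    · exact h1

@[fun_prop] lemma measurable_freeAt_apply (p : Policy n r) (j : ℕ) (i : Fin n) :
    Measurable fun w => freeAt p j w i := (measurable_pi_apply i).comp (measurable_freeAt p j)

@[fun_prop] lemma measurable_finishAt (p : Policy n r) (j : ℕ) : Measurable (finishAt p j) := by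
  refine p.measurable_of_choice j (f := fun s w =>
    finish (arrival j w) s (service j w) (freeAt p j w)) fun s => ?_
  refine (measurable_finish_prod s).comp (f := fun w => (arrival j w, service j w, freeAt p j w)) ?_
  fun_prop

end PathDynamics

/-! ### Marginals -/

section Marginals

variable (μ : Measure ℝ) [IsProbabilityMeasure μ] {l : ℝ}

lemma measurePreserving_gap (hl : 0 < l) (k : ℕ) :
    MeasurePreserving (gap k) (law n μ l) (expMeasure l) := by
  have := isProbabilityMeasure_expMeasure hl
  have := isProbabilityMeasure_stepLaw (n := n) μ l hl
  exact (measurePreserving_fst (μ := expMeasure l)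
    (ν := (Measure.pi fun _ : Fin n => μ).prod (volume : Measure unitInterval))).comp
    (measurePreserving_eval_infinitePi (μ := fun _ : ℕ => stepLaw n μ l) k)

lemma measurePreserving_service (hl : 0 < l) (k : ℕ) :
    MeasurePreserving (service k) (law n μ l) (Measure.pi fun _ : Fin n => μ) := by
  have := isProbabilityMeasure_expMeasure hl
  have := isProbabilityMeasure_stepLaw (n := n) μ l hl
  exact ((measurePreserving_fst (μ := Measure.pi fun _ : Fin n => μ)
    (ν := (volume : Measure unitInterval))).comp
    (measurePreserving_snd (μ := expMeasure l)
    (ν := (Measure.pi fun _ : Fin n => μ).prod (volume : Measure unitInterval)))).comp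
    (measurePreserving_eval_infinitePi (μ := fun _ : ℕ => stepLaw n μ l) k)

lemma ae_service_pos (hl : 0 < l) (hpos : ∀ᵐ x ∂μ, 0 < x) :
    ∀ᵐ w ∂law n μ l, ∀ k i, 0 < service k w i := by
  refine ae_all_iff.2 fun k => ae_all_iff.2 fun i => ?_
  have := ((measurePreserving_eval (fun _ : Fin n => μ) i).comp
    (measurePreserving_service μ hl k)).quasiMeasurePreserving.ae hpos
  exact this

lemma ae_pos_expMeasure (hl : 0 < l) : ∀ᵐ x ∂expMeasure l, 0 < x := by
  have := isProbabilityMeasure_expMeasure hl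
  have h : (expMeasure l).real (Set.Iic 0) = 0 := by
    rw [← cdf_eq_real, cdf_expMeasure_eq hl]; simp
  rw [ae_iff]
  simpa [measureReal_def, Set.Iic, ENNReal.toReal_eq_zero_iff] using h

lemma ae_gap_pos (hl : 0 < l) : ∀ᵐ w ∂law n μ l, ∀ k, 0 < gap k w :=
  ae_all_iff.2 fun k =>
    (measurePreserving_gap μ hl k).quasiMeasurePreserving.ae (ae_pos_expMeasure hl)

lemma arrival_succ (j : ℕ) (w : Path n) : arrival (j + 1) w = arrival j w + gap (j + 1) w := by
  simp [arrival, Finset.sum_range_succ]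

lemma arrival_mono {w : Path n} (hw : ∀ k, 0 < gap k w) : Monotone fun j => arrival j w :=
  monotone_nat_of_le_succ fun j => by rw [arrival_succ]; linarith [hw (j + 1)]

lemma arrival_pos {w : Path n} (hw : ∀ k, 0 < gap k w) (j : ℕ) : 0 < arrival j w :=
  Finset.sum_pos (fun k _ => hw k) (by simp)

end Marginals

/-! ### Elementary properties of completion times -/

section Finish

variable {a : ℝ} {R : Finset (Fin n)} {x f : Fin n → ℝ}

lemma finish_le {i : Fin n} (hi : i ∈ R) : finish a R x f ≤ max a (f i) + x i :=
  ciInf_le (Set.finite_range fun i : {i // i ∈ R} => max a (f i) + x i).bddBelow ⟨i, hi⟩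

lemma exists_finish_eq (hR : R.Nonempty) : ∃ i ∈ R, finish a R x f = max a (f i) + x i := by
  have : Nonempty {i // i ∈ R} := hR.to_subtype
  obtain ⟨i, hi⟩ := exists_eq_ciInf_of_finite (f := fun i : {i // i ∈ R} => max a (f i) + x i)
  exact ⟨i, i.2, hi.symm⟩

lemma lt_finish_iff (hR : R.Nonempty) {t : ℝ} :
    t < finish a R x f ↔ ∀ i ∈ R, t < max a (f i) + x i := by
  constructor
  · exact fun h i hi => h.trans_le (finish_le hi)
  · intro h
    obtain ⟨i, hi, he⟩ := exists_finish_eq (a := a) (x := x) (f := f) hR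
    rw [he]; exact h i hi

/-- Total time that the servers spend on a job. -/
noncomputable def consumption (a : ℝ) (R : Finset (Fin n)) (x f : Fin n → ℝ) : ℝ :=
  ∑ i ∈ R, max (finish a R x f - max a (f i)) 0

lemma consumption_nonneg : 0 ≤ consumption a R x f :=
  Finset.sum_nonneg fun _ _ => le_max_right _ _

@[fun_prop] lemma measurable_finish (a : ℝ) (R : Finset (Fin n)) (f : Fin n → ℝ) :
    Measurable fun x => finish a R x f :=
  (measurable_finish_prod R).comp (f := fun x => (a, x, f)) (by fun_prop)

@[fun_prop] lemma measurable_consumption (a : ℝ) (R : Finset (Fin n)) (f : Fin n → ℝ) :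
    Measurable fun x => consumption a R x f := by
  unfold consumption; fun_prop

end Finish

/-! ### Work conservation along a sample path -/

section WorkConservation

variable (A : ℕ → ℝ) (R : ℕ → Finset (Fin n)) (X : ℕ → Fin n → ℝ)

/-- Completion time of job `j`. -/
noncomputable def finishTime (j : ℕ) : ℝ := finish (A j) (R j) (X j) (serverFree A R X j)

/-- Last completion time of the jobs before `j`. -/
noncomputable def lastFinish : ℕ → ℝ
  | 0 => 0
  | j + 1 => max (lastFinish j) (finishTime A R X j)

variable {A R X}

lemma serverFree_succ (j : ℕ) (i : Fin n) : serverFree A R X (j + 1) i = if i ∈ R j then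
    max (serverFree A R X j i) (finishTime A R X j) else serverFree A R X j i := rfl

lemma lastFinish_succ (j : ℕ) :
    lastFinish A R X (j + 1) = max (lastFinish A R X j) (finishTime A R X j) := rfl

lemma serverFree_le_lastFinish (j : ℕ) (i : Fin n) :
    serverFree A R X j i ≤ lastFinish A R X j := by
  induction j with
  | zero => exact le_rfl
  | succ j ih =>
    rw [serverFree_succ, lastFinish_succ]
    split_ifs
    · exact max_le_max ih le_rfl
    · exact ih.trans (le_max_left _ _)

variable (A R X) in
/-- Time that server `i` spends before time `t` on the jobs before `j`. -/
noncomputable def workDone (t : ℝ) (i : Fin n) (j : ℕ) : ℝ :=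
  ∑ k ∈ Finset.range j, if i ∈ R k then
    max (min (finishTime A R X k) t - max (A k) (serverFree A R X k i)) 0 else 0

variable (A R X) in
/-- Time before `t` during which some server is busy with one of the jobs before `j`. -/
noncomputable def busyTime (t : ℝ) (j : ℕ) : ℝ :=
  ∑ k ∈ Finset.range j, max (min (finishTime A R X k) t - max (A k) (lastFinish A R X k)) 0

/-- The periods in which one server works on successive jobs do not overlap, and the last of them
ends by `serverFree`. -/
lemma workDone_le {t : ℝ} (ht : 0 ≤ t) (i : Fin n) (j : ℕ) :
    workDone A R X t i j ≤ min (serverFree A R X j i) t := by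
  induction j with
  | zero => simp [workDone, serverFree, ht]
  | succ j ih =>
    rw [workDone, Finset.sum_range_succ, ← workDone, serverFree_succ]
    split_ifs with h
    · grind
    · simpa using ih

lemma workDone_le_busyTime (hA : Monotone A) (hA0 : 0 ≤ A 0) {t : ℝ} (ht : 0 ≤ t) (i : Fin n)
    (j : ℕ) : workDone A R X t i j ≤ busyTime A R X t j := by
  -- The induction needs a reserve: time after `a` in which the system is busy although server `i`
  -- is already free of the jobs before `j`. At `j = 0` the index `j - 1` is `0`, and the reserve
  -- vanishes because `A 0 ≥ 0`.
  have key : ∀ j, ∀ a, A (j - 1) ≤ a → workDone A R X t i j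
      + max (min (lastFinish A R X j) t - max a (serverFree A R X j i)) 0
        ≤ busyTime A R X t j := by
    intro j
    induction j with
    | zero =>
      intro a ha
      simp only [workDone, busyTime, serverFree, lastFinish, Finset.range_zero, Finset.sum_empty]
      grind
    | succ j ih =>
      intro a ha
      have ih' := ih (A j) (hA (by omega))
      have h1 := serverFree_le_lastFinish (A := A) (R := R) (X := X) j i
      simp only [Nat.add_sub_cancel] at ha
      rw [workDone, Finset.sum_range_succ, ← workDone, busyTime, Finset.sum_range_succ, ← busyTime,
        serverFree_succ, lastFinish_succ]
      generalize finishTime A R X j = F at *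
      generalize lastFinish A R X j = M at *
      generalize serverFree A R X j i = f at *
      generalize workDone A R X t i j = C at *
      generalize busyTime A R X t j = B at *
      generalize A j = b at *
      split_ifs with h
      · rcases le_total F M with hFM | hFM
        · rw [max_eq_left hFM]; grind
        · rw [max_eq_right hFM]; grind
      · rcases le_total F M with hFM | hFM
        · rw [max_eq_left hFM]; grind
        · rw [max_eq_right hFM]; grind
  exact (le_add_of_nonneg_right (le_max_right _ _)).trans (key j _ le_rfl)

/-- Server `0` works at most `t` and at most the busy time, hence at most any convex combination of
the two; the other servers work at most `t` each. -/
lemma sum_workDone_le [NeZero n] (hA : Monotone A) (hA0 : 0 ≤ A 0) {t δ : ℝ} (ht : 0 ≤ t)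
    (hδ0 : 0 ≤ δ) (hδ1 : δ ≤ 1) (j : ℕ) :
    ∑ i, workDone A R X t i j ≤ (n - δ) * t + δ * busyTime A R X t j := by
  have h1 : ∀ i, workDone A R X t i j ≤ t := fun i => (workDone_le ht i j).trans (min_le_right _ _)
  have h2 := workDone_le_busyTime (R := R) (X := X) hA hA0 ht (0 : Fin n) j
  rw [← Finset.add_sum_erase _ _ (Finset.mem_univ (0 : Fin n))]
  have h3 : ∑ i ∈ Finset.univ.erase (0 : Fin n), workDone A R X t i j ≤ (n - 1) * t := by
    refine (Finset.sum_le_card_nsmul _ _ t fun i _ => h1 i).trans ?_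
    rw [Finset.card_erase_of_mem (Finset.mem_univ _), nsmul_eq_mul, Finset.card_univ,
      Fintype.card_fin, Nat.cast_sub (Nat.one_le_iff_ne_zero.2 (NeZero.ne n))]
    simp
  nlinarith [h1 0, mul_le_mul_of_nonneg_left h2 hδ0,
    mul_le_mul_of_nonneg_left (h1 0) (sub_nonneg.2 hδ1)]

/-- A job complete by `t` has all its consumption counted in `workDone`; any other job is charged
the truncation level `K`. -/
lemma sum_min_consumption_le [NeZero n] (hA : Monotone A) (hA0 : 0 ≤ A 0) {t δ K : ℝ}
    (ht : 0 ≤ t) (hδ0 : 0 ≤ δ) (hδ1 : δ ≤ 1) (j : ℕ) :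
    ∑ k ∈ Finset.range j, min (consumption (A k) (R k) (X k) (serverFree A R X k)) K
      ≤ (n - δ) * t
        + δ * ∑ k ∈ Finset.range j, max (finishTime A R X k - max (A k) (lastFinish A R X k)) 0
        + K * ∑ k ∈ Finset.range j, (if t < finishTime A R X k then 1 else 0) := by
  have h1 := sum_workDone_le (R := R) (X := X) hA hA0 ht hδ0 hδ1 j
  have h2 : busyTime A R X t j
      ≤ ∑ k ∈ Finset.range j, max (finishTime A R X k - max (A k) (lastFinish A R X k)) 0 :=
    Finset.sum_le_sum fun k _ => max_le_max (sub_le_sub_right (min_le_left _ _) _) le_rfl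
  have h3 : ∑ k ∈ Finset.range j, min (consumption (A k) (R k) (X k) (serverFree A R X k)) K
      ≤ ∑ i, workDone A R X t i j
        + K * ∑ k ∈ Finset.range j, (if t < finishTime A R X k then 1 else 0) := by
    simp only [workDone]
    rw [Finset.sum_comm, Finset.mul_sum, ← Finset.sum_add_distrib]
    refine Finset.sum_le_sum fun k _ => ?_
    rw [← Finset.sum_filter]
    simp only [Finset.filter_mem_eq_inter, Finset.univ_inter]
    split_ifs with h
    · rw [mul_one]
      exact (min_le_right _ _).trans
        (le_add_of_nonneg_left (Finset.sum_nonneg fun _ _ => le_max_right _ _))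
    · rw [mul_zero, add_zero, min_eq_left (not_lt.1 h)]
      exact min_le_left _ _
  nlinarith [mul_le_mul_of_nonneg_left h2 hδ0]

end WorkConservation

/-! ### Instability -/

section Instability

variable {r : ℕ}

/-- Last completion time of the jobs before `j` under the policy `p`. -/
noncomputable def lastFinishAt (p : Policy n r) (j : ℕ) (w : Path n) : ℝ :=
  lastFinish (fun k => arrival k w) (fun k => p.choice k w) (fun k => service k w) j

lemma lastFinishAt_succ (p : Policy n r) (j : ℕ) (w : Path n) :
    lastFinishAt p (j + 1) w = max (lastFinishAt p j w) (finishAt p j w) := rfl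

@[fun_prop] lemma measurable_lastFinishAt (p : Policy n r) (j : ℕ) :
    Measurable (lastFinishAt p j) := by
  induction j with
  | zero => exact measurable_const
  | succ j ih => exact ih.max (measurable_finishAt p j)

lemma lastFinishAt_setService (p : Policy n r) {j k : ℕ} (h : j ≤ k) (x : Fin n → ℝ)
    (w : Path n) : lastFinishAt p j (setService k x w) = lastFinishAt p j w := by
  induction j with
  | zero => rfl
  | succ j ih =>
    rw [lastFinishAt_succ, lastFinishAt_succ, ih (by omega), finishAt_setService_of_lt p (by omega)]

/-- Time that the servers spend on job `j` under the policy `p`. -/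
noncomputable def consumptionAt (p : Policy n r) (j : ℕ) (w : Path n) : ℝ :=
  consumption (arrival j w) (p.choice j w) (service j w) (freeAt p j w)

lemma consumptionAt_nonneg (p : Policy n r) (j : ℕ) (w : Path n) : 0 ≤ consumptionAt p j w :=
  consumption_nonneg

@[fun_prop] lemma measurable_consumptionAt (p : Policy n r) (j : ℕ) :
    Measurable (consumptionAt p j) := by
  refine p.measurable_of_choice j (f := fun s w =>
    consumption (arrival j w) s (service j w) (freeAt p j w)) fun s => ?_
  have : Measurable fun w => finish (arrival j w) s (service j w) (freeAt p j w) :=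
    (measurable_finish_prod s).comp (f := fun w => (arrival j w, service j w, freeAt p j w))
      (by fun_prop)
  unfold consumption
  fun_prop

lemma consumptionAt_setService_self (p : Policy n r) (k : ℕ) (x : Fin n → ℝ)
    (w : Path n) : consumptionAt p k (setService k x w)
      = consumption (arrival k w) (p.choice k w) x (freeAt p k w) := by
  simp only [consumptionAt, arrival_setService, p.choice_setService le_rfl,
    freeAt_setService p le_rfl, service_setService_self]

lemma consumptionAt_setService_of_lt (p : Policy n r) {j k : ℕ} (h : j < k) (x : Fin n → ℝ)
    (w : Path n) : consumptionAt p j (setService k x w) = consumptionAt p j w := by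
  simp only [consumptionAt, arrival_setService, p.choice_setService h.le, freeAt_setService p h.le,
    service_setService_of_ne h.ne]

lemma Policy.choice_nonempty (p : Policy n r) (hr : 1 ≤ r) (j : ℕ) (w : Path n) :
    (p.choice j w).Nonempty := by
  rw [← Finset.card_pos, p.card_choice]; omega

lemma lintegral_gap (μ : Measure ℝ) [IsProbabilityMeasure μ] {l : ℝ} (hl : 0 < l) (k : ℕ) :
    ∫⁻ w, ENNReal.ofReal (gap k w) ∂law n μ l = ENNReal.ofReal (1 / l) := by
  have h := (measurePreserving_gap (n := n) μ hl k).lintegral_comp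
    (f := fun x => ENNReal.ofReal x) (by fun_prop)
  rw [h]
  have := isProbabilityMeasure_expMeasure hl
  have h0 : 0 ≤ᵐ[expMeasure l] fun x : ℝ => x := (ae_pos_expMeasure hl).mono fun x hx => hx.le
  rw [lintegral_eq_lintegral_meas_lt _ h0 aemeasurable_id]
  have h1 : ∀ t ∈ Set.Ioi (0 : ℝ), expMeasure l {a | t < a}
      = ENNReal.ofReal (Real.exp (-l * t)) := by
    intro t ht
    have h2 : (expMeasure l).real (Set.Iic t) = 1 - Real.exp (-(l * t)) := by
      rw [← cdf_eq_real, cdf_expMeasure_eq hl, if_pos (le_of_lt ht)]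
    have h3 : (expMeasure l).real (Set.Ioi t) = Real.exp (-l * t) := by
      rw [← Set.compl_Iic, probReal_compl_eq_one_sub measurableSet_Iic, h2]; simp
    rw [← h3, ofReal_measureReal]; rfl
  rw [setLIntegral_congr_fun measurableSet_Ioi h1, ← ofReal_integral_eq_lintegral_ofReal
    (integrableOn_exp_mul_Ioi (by linarith) 0) (ae_of_all _ fun x => (Real.exp_pos _).le),
    integral_exp_mul_Ioi (by linarith)]
  congr 1
  simp [neg_div_neg_eq]

lemma lintegral_arrival (μ : Measure ℝ) [IsProbabilityMeasure μ] {l : ℝ} (hl : 0 < l) (j : ℕ) :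
    ∫⁻ w, ENNReal.ofReal (arrival j w) ∂law n μ l = ENNReal.ofReal ((j + 1) / l) := by
  have h : (fun w : Path n => ENNReal.ofReal (arrival j w)) =ᵐ[law n μ l]
      fun w => ∑ k ∈ Finset.range (j + 1), ENNReal.ofReal (gap k w) := by
    filter_upwards [ae_gap_pos μ hl] with w hw
    exact ENNReal.ofReal_sum_of_nonneg fun k _ => (hw k).le
  rw [lintegral_congr_ae h, lintegral_finsetSum _ fun k _ => by fun_prop]
  simp only [lintegral_gap μ hl, Finset.sum_const, Finset.card_range, nsmul_eq_mul]
  rw [← ENNReal.ofReal_natCast, ← ENNReal.ofReal_mul (by positivity)]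
  congr 1; push_cast; ring

/-- If on average each job consumes at least `v` units of server time, beyond a multiple `δ` of
the time by which it prolongs the busy period of the system, and `l * v > n - δ`, then the latency
is infinite. -/
theorem lowerLatency_eq_top_of_consumption [NeZero n] (μ : Measure ℝ) [IsProbabilityMeasure μ]
    {l v δ K : ℝ} (hl : 0 < l) (hδ0 : 0 ≤ δ) (hδ1 : δ ≤ 1) (hK : 0 < K) (hv : n - δ < l * v)
    (H : ∀ (a m : ℝ) (R : Finset (Fin n)) (f : Fin n → ℝ), R.card = r → (∀ i, f i ≤ m) →
      ENNReal.ofReal v + ENNReal.ofReal δ *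
          ∫⁻ x, ENNReal.ofReal (finish a R x f - max a m) ∂(Measure.pi fun _ : Fin n => μ)
        ≤ ∫⁻ x, ENNReal.ofReal (min (consumption a R x f) K) ∂(Measure.pi fun _ : Fin n => μ))
    (p : Policy n r) : lowerLatency μ l p = ∞ := by
  have := isProbabilityMeasure_law (n := n) μ l hl
  set P := law n μ l with hP
  -- `l * v > n - δ` is strict, so the work of `J` jobs still exceeds, by `η J`, what can be done in
  -- time `J / l + θ J`.
  obtain ⟨θ, hθ, hη⟩ : ∃ θ : ℝ, 0 < θ ∧ 0 < v - (n - δ) * (1 / l + θ) := by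
    have h1 : (0 : ℝ) < v - (n - δ) / l := by
      rw [sub_pos, div_lt_iff₀ hl]; linarith
    have hn : (0 : ℝ) ≤ n := by positivity
    refine ⟨(v - (n - δ) / l) / (2 * (n + 1)), by positivity, ?_⟩
    have h2 : (n - δ) * ((v - (n - δ) / l) / (2 * (n + 1))) ≤ (v - (n - δ) / l) / 2 := by
      rw [mul_div_assoc', div_le_div_iff₀ (by positivity) (by positivity)]
      nlinarith [mul_nonneg h1.le hδ0]
    have h3 : (n - δ) * (1 / l + (v - (n - δ) / l) / (2 * (n + 1)))
      = (n - δ) / l + (n - δ) * ((v - (n - δ) / l) / (2 * (n + 1))) := by ring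
    rw [h3]; linarith
  set η := v - (n - δ) * (1 / l + θ) with hηdef
  have hnδ : (0 : ℝ) ≤ n - δ := by
    have : (1 : ℝ) ≤ n := by exact_mod_cast Nat.one_le_iff_ne_zero.2 (NeZero.ne n)
    linarith
  -- expected consumption of a job
  have hcons : ∀ k, ENNReal.ofReal v + ENNReal.ofReal δ *
      ∫⁻ w, ENNReal.ofReal (finishAt p k w - max (arrival k w) (lastFinishAt p k w)) ∂P
        ≤ ∫⁻ w, ENNReal.ofReal (min (consumptionAt p k w) K) ∂P := by
    intro k
    have m1 : Measurable fun w => ENNReal.ofReal (min (consumptionAt p k w) K) := by fun_prop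
    have m2 : Measurable fun w =>
      ENNReal.ofReal (finishAt p k w - max (arrival k w) (lastFinishAt p k w)) := by fun_prop
    rw [lintegral_setService μ hl k m1, lintegral_setService μ hl k m2]
    have m3 : Measurable fun w => ∫⁻ x, ENNReal.ofReal (finishAt p k (setService k x w)
        - max (arrival k (setService k x w)) (lastFinishAt p k (setService k x w)))
          ∂(Measure.pi fun _ : Fin n => μ) :=
      (m2.comp (measurable_setService_pair k)).lintegral_prod_right'
    have h0 : ENNReal.ofReal v = ∫⁻ _, ENNReal.ofReal v ∂P := by simp
    rw [h0, ← lintegral_const_mul _ m3, ← lintegral_add_left measurable_const]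
    refine lintegral_mono fun w => ?_
    simp only [finishAt_setService_self, consumptionAt_setService_self, arrival_setService,
      lastFinishAt_setService p le_rfl]
    exact H _ _ _ _ (p.card_choice k w) fun i => serverFree_le_lastFinish k i
  -- jobs that are late
  have hlate : ∀ J : ℕ, 0 < J → ENNReal.ofReal (J * η / K) ≤ ∑ k ∈ Finset.range J,
      P {w | arrival (J - 1) w + θ * J < finishAt p k w} := by
    intro J hJ
    set D := ∑ k ∈ Finset.range J, ∫⁻ w, ENNReal.ofReal
      (finishAt p k w - max (arrival k w) (lastFinishAt p k w)) ∂P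
    set N := ∑ k ∈ Finset.range J, P {w | arrival (J - 1) w + θ * J < finishAt p k w}
    have hmeas : ∀ k, MeasurableSet {w : Path n | arrival (J - 1) w + θ * J < finishAt p k w} :=
      fun k => measurableSet_lt (by fun_prop) (by fun_prop)
    -- Work conservation up to the deadline `arrival (J - 1) + θ J`, where a job that misses it
    -- accounts for at most `K`.
    have e1 : ∑ k ∈ Finset.range J, ∫⁻ w, ENNReal.ofReal (min (consumptionAt p k w) K) ∂P
        ≤ ENNReal.ofReal ((n - δ) * (J / l + θ * J)) + ENNReal.ofReal δ * D
          + ENNReal.ofReal K * N := by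
      have hb : ∀ᵐ w ∂P, ∑ k ∈ Finset.range J, ENNReal.ofReal (min (consumptionAt p k w) K)
          ≤ ENNReal.ofReal (n - δ) * (ENNReal.ofReal (arrival (J - 1) w) + ENNReal.ofReal (θ * J))
            + ENNReal.ofReal δ * (∑ k ∈ Finset.range J, ENNReal.ofReal
                (finishAt p k w - max (arrival k w) (lastFinishAt p k w)))
            + ENNReal.ofReal K * (∑ k ∈ Finset.range J, Set.indicator
                {w | arrival (J - 1) w + θ * J < finishAt p k w} 1 w) := by
        filter_upwards [ae_gap_pos μ hl] with w hw
        have ht : 0 ≤ arrival (J - 1) w + θ * J := by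
          have := arrival_pos hw (J - 1); positivity
        have h : ∑ k ∈ Finset.range J, min (consumptionAt p k w) K
            ≤ (n - δ) * (arrival (J - 1) w + θ * J) + δ * ∑ k ∈ Finset.range J,
                max (finishAt p k w - max (arrival k w) (lastFinishAt p k w)) 0
              + K * ∑ k ∈ Finset.range J,
                (if arrival (J - 1) w + θ * J < finishAt p k w then 1 else 0) :=
          sum_min_consumption_le (R := fun k => p.choice k w) (X := fun k => service k w)
            (arrival_mono hw) (arrival_pos hw 0).le ht hδ0 hδ1 J
        have hind : ∀ k, Set.indicator {w | arrival (J - 1) w + θ * J < finishAt p k w}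
            (1 : Path n → ℝ≥0∞) w
            = ENNReal.ofReal (if arrival (J - 1) w + θ * J < finishAt p k w then 1 else 0) := by
          intro k; simp only [Set.indicator, Set.mem_ofPred_eq]; split_ifs <;> simp
        simp only [hind]
        have hmax : ∀ x : ℝ, ENNReal.ofReal x = ENNReal.ofReal (max x 0) := by
          intro x; simp [ENNReal.ofReal, Real.toNNReal]
        simp only [hmax (finishAt p _ w - _)]
        rw [← ENNReal.ofReal_sum_of_nonneg (fun _ _ => le_min (consumptionAt_nonneg p _ _) hK.le),
          ← ENNReal.ofReal_sum_of_nonneg (fun _ _ => le_max_right _ _),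
          ← ENNReal.ofReal_sum_of_nonneg (fun _ _ => by split_ifs <;> norm_num),
          ← ENNReal.ofReal_add (arrival_pos hw _).le (by positivity),
          ← ENNReal.ofReal_mul hnδ, ← ENNReal.ofReal_mul hδ0, ← ENNReal.ofReal_mul hK.le,
          ← ENNReal.ofReal_add (mul_nonneg hnδ ht)
            (mul_nonneg hδ0 (Finset.sum_nonneg fun _ _ => le_max_right _ _)),
          ← ENNReal.ofReal_add (add_nonneg (mul_nonneg hnδ ht)
            (mul_nonneg hδ0 (Finset.sum_nonneg fun _ _ => le_max_right _ _)))
            (mul_nonneg hK.le (Finset.sum_nonneg fun _ _ => by split_ifs <;> norm_num))]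
        exact ENNReal.ofReal_le_ofReal h
      rw [← lintegral_finsetSum _ fun k _ => by fun_prop]
      refine (lintegral_mono_ae hb).trans_eq ?_
      have hmi : ∀ k, Measurable (Set.indicator
          {w : Path n | arrival (J - 1) w + θ * J < finishAt p k w} (1 : Path n → ℝ≥0∞)) :=
        fun k => measurable_one.indicator (hmeas k)
      rw [lintegral_add_right _ (by fun_prop), lintegral_add_right _ (by fun_prop),
        lintegral_const_mul _ (by fun_prop), lintegral_const_mul _ (by fun_prop),
        lintegral_const_mul _ (by fun_prop), lintegral_add_right _ (by fun_prop),
        lintegral_finsetSum _ fun k _ => by fun_prop, lintegral_finsetSum _ fun k _ => hmi k,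
        lintegral_arrival μ hl]
      congr 2
      · rw [lintegral_const, measure_univ, mul_one, ← ENNReal.ofReal_add (by positivity)
          (by positivity), ← ENNReal.ofReal_mul hnδ, Nat.cast_sub hJ]
        simp
      · exact Finset.sum_congr rfl fun k _ => lintegral_indicator_one (hmeas k)
    have e2 : ENNReal.ofReal (J * v) + ENNReal.ofReal δ * D
        ≤ ∑ k ∈ Finset.range J, ∫⁻ w, ENNReal.ofReal (min (consumptionAt p k w) K) ∂P := by
      refine le_trans (le_of_eq ?_) (Finset.sum_le_sum fun k _ => hcons k)
      rw [Finset.sum_add_distrib, Finset.mul_sum]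
      simp [ENNReal.ofReal_mul]
    -- Truncating the consumption at `K` makes this term finite, so that it can be cancelled between
    -- the lower and the upper bound.
    have e3 : ENNReal.ofReal δ * D ≠ ∞ := by
      refine ne_top_of_le_ne_top ?_ (le_add_self.trans e2)
      refine ENNReal.sum_ne_top.2 fun k _ => ?_
      refine ne_top_of_le_ne_top (b := ENNReal.ofReal K) (by simp) ?_
      refine (lintegral_mono fun w => ENNReal.ofReal_le_ofReal (min_le_right _ _)).trans ?_
      simp
    have e4 : ENNReal.ofReal (J * v) ≤ ENNReal.ofReal ((n - δ) * (J / l + θ * J))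
        + ENNReal.ofReal K * N := by
      have := e2.trans e1
      rw [add_right_comm] at this
      exact (ENNReal.add_le_add_iff_right e3).1 this
    have e5 : ENNReal.ofReal (J * η) ≤ ENNReal.ofReal K * N := by
      have : J * v = (n - δ) * (J / l + θ * J) + J * η := by rw [hηdef]; ring
      rw [this, ENNReal.ofReal_add (by positivity) (by positivity)] at e4
      exact (ENNReal.add_le_add_iff_left ENNReal.ofReal_ne_top).1 e4
    rw [ENNReal.ofReal_div_of_pos hK]
    refine ENNReal.div_le_of_le_mul ?_
    rwa [mul_comm N]
  -- growth of the mean latency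
  have hmean : ∀ k : ℕ, ENNReal.ofReal (θ * η / K * k) ≤ meanLatency μ l p k := by
    intro k
    have hJ : (0 : ℝ) < (k + 1 : ℕ) := by positivity
    rw [meanLatency, ENNReal.le_div_iff_mul_le (by simp) (by simp)]
    -- A job that misses the deadline arrived by `arrival k`, so its response time exceeds `θ (k +
    -- 1)`. The expected number of such jobs is of order `k`, so the average grows linearly.
    have e : ∀ i ∈ Finset.range (k + 1), ENNReal.ofReal (θ * (k + 1 : ℕ)) *
        P {w | arrival k w + θ * (k + 1 : ℕ) < finishAt p i w} ≤ jobLatency μ l p i := by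
      intro i hi
      rw [jobLatency_eq, ← hP]
      refine le_trans ?_ (mul_meas_ge_le_lintegral₀ (by fun_prop) (ENNReal.ofReal (θ * (k + 1 : ℕ))))
      refine mul_le_mul_right (measure_mono_ae ?_) _
      filter_upwards [ae_gap_pos μ hl] with w hw hw2
      have := arrival_mono hw (Nat.lt_succ_iff.1 (Finset.mem_range.1 hi))
      refine ENNReal.ofReal_le_ofReal ?_
      change arrival k w + θ * (k + 1 : ℕ) < finishAt p i w at hw2
      simp only at this
      linarith
    refine le_trans ?_ (Finset.sum_le_sum e)
    rw [← Finset.mul_sum]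
    refine le_trans ?_ (mul_le_mul_right (hlate (k + 1) (by omega)) _)
    rw [← ENNReal.ofReal_natCast, ← ENNReal.ofReal_mul (by positivity),
      ← ENNReal.ofReal_mul (by positivity)]
    refine ENNReal.ofReal_le_ofReal ?_
    push_cast
    have : θ * (k + 1) * ((k + 1) * η / K) = θ * η / K * k * (k + 1) + θ * η / K * (k + 1) := by
      ring
    rw [this]
    have : 0 < θ * η / K * (k + 1) := by positivity
    linarith
  have hlim : Tendsto (fun k : ℕ => ENNReal.ofReal (θ * η / K * k)) atTop (nhds ∞) :=
    ENNReal.tendsto_ofReal_nhds_top.2 (tendsto_natCast_atTop_atTop.const_mul_atTop (by positivity))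
  refine top_unique ?_
  rw [lowerLatency, ← hlim.liminf_eq]
  exact liminf_le_liminf (Eventually.of_forall hmean)

end Instability

/-! ### Tails -/

lemma tail_nonneg (μ : Measure ℝ) (x : ℝ) : 0 ≤ tail μ x := measureReal_nonneg

section Tail

variable (μ : Measure ℝ) [IsProbabilityMeasure μ]

lemma measure_Ioi_eq (x : ℝ) : μ (Set.Ioi x) = ENNReal.ofReal (tail μ x) := by
  rw [tail, ofReal_measureReal]

lemma tail_le_one (x : ℝ) : tail μ x ≤ 1 := measureReal_le_one

lemma tail_antitone : Antitone (tail μ) := fun _ _ h => measureReal_mono (Set.Ioi_subset_Ioi h)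

@[fun_prop] lemma measurable_tail : Measurable (tail μ) := (tail_antitone μ).measurable

lemma tail_eq_one_sub_cdf (x : ℝ) : tail μ x = 1 - cdf μ x := by
  rw [tail, cdf_eq_real, ← Set.compl_Iic, probReal_compl_eq_one_sub measurableSet_Iic]

variable {μ}

lemma tail_of_nonpos (hpos : ∀ᵐ x ∂μ, 0 < x) {x : ℝ} (hx : x ≤ 0) : tail μ x = 1 := by
  have : μ (Set.Ioi x) = 1 := by
    rw [prob_compl_eq_zero_iff measurableSet_Ioi |>.symm]
    refine measure_mono_null ?_ (ae_iff.1 hpos)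
    intro y hy
    simp only [Set.mem_compl_iff, Set.mem_Ioi, not_lt] at hy
    exact not_lt.2 (hy.trans hx)
  simp [tail, measureReal_def, this]

lemma tail_max_zero (hpos : ∀ᵐ x ∂μ, 0 < x) (x : ℝ) : tail μ (max x 0) = tail μ x := by
  rcases le_total x 0 with h | h
  · rw [max_eq_right h, tail_of_nonpos hpos le_rfl, tail_of_nonpos hpos h]
  · rw [max_eq_left h]

variable (μ) in
lemma tail_continuousWithinAt (x : ℝ) : ContinuousWithinAt (tail μ) (Set.Ici x) x := by
  have : tail μ = fun x => 1 - cdf μ x := funext (tail_eq_one_sub_cdf μ)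
  rw [this]
  exact continuousWithinAt_const.sub ((cdf μ).right_continuous x)

variable (μ) in
lemma tendsto_tail_atTop : Tendsto (tail μ) atTop (nhds 0) := by
  have : tail μ = fun x => 1 - cdf μ x := funext (tail_eq_one_sub_cdf μ)
  rw [this]
  simpa using (tendsto_cdf_atTop μ).const_sub 1

lemma exists_tail_pos (hpos : ∀ᵐ x ∂μ, 0 < x) : ∃ x, 0 < x ∧ 0 < tail μ x := by
  have h := (tail_continuousWithinAt μ 0).tendsto
  rw [tail_of_nonpos hpos le_rfl] at h
  have h2 := (h.mono_left (nhdsWithin_mono 0 Set.Ioi_subset_Ici_self)).eventually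
    (lt_mem_nhds (show (0 : ℝ) < 1 by norm_num))
  obtain ⟨x, hx, hx0⟩ := (h2.and self_mem_nhdsWithin).exists
  exact ⟨x, hx0, hx⟩

variable (μ) in
lemma lintegral_sub_eq_tail (d : ℝ) :
    ∫⁻ x, ENNReal.ofReal (x - d) ∂μ = ∫⁻ u in Set.Ioi d, ENNReal.ofReal (tail μ u) := by
  have h1 : ∫⁻ x, ENNReal.ofReal (x - d) ∂μ = ∫⁻ x, ENNReal.ofReal (max (x - d) 0) ∂μ := by
    simp [ENNReal.ofReal, Real.toNNReal]
  rw [h1, lintegral_eq_lintegral_meas_lt μ (f := fun x => max (x - d) 0)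
    (ae_of_all _ fun x => le_max_right _ _) (by fun_prop)]
  have h2 : ∀ t ∈ Set.Ioi (0 : ℝ), μ {x | t < max (x - d) 0}
      = ENNReal.ofReal (tail μ (t + d)) := by
    intro t ht
    rw [← measure_Ioi_eq]
    congr 1; ext x
    simp only [Set.mem_ofPred_eq, lt_max_iff, Set.mem_Ioi]
    constructor
    · rintro (h | h)
      · linarith
      · exact absurd h (not_lt.2 (le_of_lt ht))
    · intro h; left; linarith
  rw [setLIntegral_congr_fun measurableSet_Ioi h2, ← lintegral_indicator measurableSet_Ioi,
    ← lintegral_indicator measurableSet_Ioi,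
    ← lintegral_add_right_eq_self (Set.indicator (Set.Ioi d) fun u => ENNReal.ofReal (tail μ u)) d]
  congr 1; ext t
  simp only [Set.indicator, Set.mem_Ioi]
  have : d < t + d ↔ 0 < t := by constructor <;> intro h <;> linarith
  simp only [this]

variable (μ) in
lemma lintegral_ofReal_eq_tail :
    ∫⁻ x, ENNReal.ofReal x ∂μ = ∫⁻ u in Set.Ioi 0, ENNReal.ofReal (tail μ u) := by
  simpa using lintegral_sub_eq_tail μ 0

end Tail

/-! ### Law of the consumption of a job -/

section ConsumptionLaw

lemma lintegral_min_consumption (μ : Measure ℝ) [SigmaFinite μ] (a : ℝ) (R : Finset (Fin n))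
    (f : Fin n → ℝ) {K : ℝ} (hK : 0 ≤ K) :
    ∫⁻ x, ENNReal.ofReal (min (consumption a R x f) K) ∂(Measure.pi fun _ : Fin n => μ)
      = ∫⁻ u in Set.Ioo 0 K, (Measure.pi fun _ : Fin n => μ) {x | u < consumption a R x f} := by
  rw [lintegral_eq_lintegral_meas_lt _ (ae_of_all _ fun x => le_min consumption_nonneg hK)
    (by fun_prop), ← lintegral_indicator measurableSet_Ioi, ← lintegral_indicator measurableSet_Ioo]
  congr 1; ext u
  simp only [Set.indicator, Set.mem_Ioi, Set.mem_Ioo]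
  by_cases hu : 0 < u
  · by_cases hu2 : u < K
    · simp [hu, hu2]
    · simp [hu, hu2]
  · simp [hu]

variable {μ : Measure ℝ} [IsProbabilityMeasure μ]

variable (μ) in
lemma pi_lt_forall (R : Finset (Fin n)) (s : Fin n → ℝ) :
    (Measure.pi fun _ : Fin n => μ) {x | ∀ i ∈ R, s i < x i}
      = ENNReal.ofReal (∏ i ∈ R, tail μ (s i)) := by
  have : {x : Fin n → ℝ | ∀ i ∈ R, s i < x i}
      = Set.pi Set.univ fun i => if i ∈ R then Set.Ioi (s i) else Set.univ := by
    ext x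
    simp only [Set.mem_ofPred_eq, Set.mem_pi, Set.mem_univ, true_imp_iff]
    refine forall_congr' fun i => ?_
    split_ifs with h <;> simp [h]
  rw [this, Measure.pi_pi, ENNReal.ofReal_prod_of_nonneg fun i _ => tail_nonneg μ _,
    ← Finset.prod_subset (Finset.subset_univ R)]
  · exact Finset.prod_congr rfl fun i hi => by rw [if_pos hi, measure_Ioi_eq]
  · intro i _ hi; simp [hi]

variable (μ) in
lemma measure_lt_finish {a : ℝ} {R : Finset (Fin n)} (hR : R.Nonempty) (f : Fin n → ℝ) (t : ℝ) :
    (Measure.pi fun _ : Fin n => μ) {x | t < finish a R x f}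
      = ENNReal.ofReal (∏ i ∈ R, tail μ (t - max a (f i))) := by
  rw [← pi_lt_forall μ R fun i => t - max a (f i)]
  congr 1; ext x
  simp only [Set.mem_ofPred_eq, lt_finish_iff hR]
  exact forall₂_congr fun i _ => by constructor <;> intro h <;> linarith

/-- `t` is the instant at which copies started at the times `S i` have together run for `u`, if none
of them finishes before. That one of them has started by `t` is recorded because it makes the total
strictly increasing from `t` on. -/
lemma exists_total_elapsed {R : Finset (Fin n)} (hR : R.Nonempty) (S : Fin n → ℝ) {u : ℝ}
    (hu : 0 ≤ u) : ∃ t, (∃ i ∈ R, S i ≤ t) ∧ ∑ i ∈ R, max (t - S i) 0 = u := by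
  obtain ⟨i, hi, hmin⟩ := R.exists_min_image S hR
  have hc : Continuous fun t => ∑ i ∈ R, max (t - S i) 0 := by fun_prop
  have h0 : ∑ j ∈ R, max (S i - S j) 0 = 0 :=
    Finset.sum_eq_zero fun j hj => max_eq_right (by linarith [hmin j hj])
  have h1 : u ≤ ∑ j ∈ R, max (S i + u - S j) 0 := by
    refine le_trans ?_ (Finset.single_le_sum (f := fun j => max (S i + u - S j) 0)
      (fun j _ => le_max_right _ _) hi)
    exact le_trans (by linarith) (le_max_left _ _)
  obtain ⟨t, ht, htu⟩ := intermediate_value_Icc (show S i ≤ S i + u by linarith) hc.continuousOn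
    (show u ∈ Set.Icc _ _ from ⟨h0.trans_le hu, h1⟩)
  exact ⟨t, ⟨i, hi, ht.1⟩, htu⟩

/-- Consumption is a deterministic nondecreasing function of the completion time, strictly
increasing beyond `t`. So exceeding `u` means that no copy is complete at `t`, which is an
intersection of independent events. -/
lemma measure_lt_consumption (hpos : ∀ᵐ x ∂μ, 0 < x) {a : ℝ} {R : Finset (Fin n)}
    (f : Fin n → ℝ) {u t : ℝ}
    (ht : ∃ i ∈ R, max a (f i) ≤ t) (htu : ∑ i ∈ R, max (t - max a (f i)) 0 = u) :
    (Measure.pi fun _ : Fin n => μ) {x | u < consumption a R x f}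
      = ENNReal.ofReal (∏ i ∈ R, tail μ (max (t - max a (f i)) 0)) := by
  obtain ⟨i, hi, hit⟩ := ht
  simp only [tail_max_zero hpos]
  rw [← measure_lt_finish μ ⟨i, hi⟩]
  congr 1; ext x
  simp only [Set.mem_ofPred_eq]
  rw [← htu, consumption]
  constructor
  · intro h
    by_contra hle
    refine absurd h (not_lt.2 (Finset.sum_le_sum fun j _ => max_le_max ?_ le_rfl))
    linarith
  · intro h
    refine Finset.sum_lt_sum (fun j _ => max_le_max (by linarith) le_rfl) ⟨i, hi, ?_⟩
    rw [max_eq_left (by linarith)]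
    exact lt_of_lt_of_le (by linarith) (le_max_left _ _)

end ConsumptionLaw

/-! ### Right-continuous functions and almost everywhere equality -/

/-- Values that differ at `x` would differ on an interval to the right of `x`. Used to turn equality
of integrals of tails into a functional equation valid at every point. -/
lemma eq_of_ae_eq_of_rightContinuous {f g : ℝ → ℝ}
    (hf : ∀ x, ContinuousWithinAt f (Set.Ici x) x) (hg : ∀ x, ContinuousWithinAt g (Set.Ici x) x)
    (h : ∀ᵐ x ∂volume.restrict (Set.Ioi (0 : ℝ)), f x = g x) {x : ℝ} (hx : 0 ≤ x) :
    f x = g x := by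
  by_contra hne
  have h1 : Tendsto (fun y => (f y, g y)) (nhdsWithin x (Set.Ioi x)) (nhds (f x, g x)) :=
    ((hf x).mono_left (nhdsWithin_mono x Set.Ioi_subset_Ici_self)).prodMk_nhds
      ((hg x).mono_left (nhdsWithin_mono x Set.Ioi_subset_Ici_self))
  have h2 : ∀ᶠ y in nhdsWithin x (Set.Ioi x), f y ≠ g y :=
    h1.eventually (isOpen_ne_fun continuous_fst continuous_snd |>.mem_nhds hne)
  obtain ⟨c, hc, hsub⟩ := mem_nhdsGT_iff_exists_Ioo_subset.1 h2
  rw [ae_restrict_iff' measurableSet_Ioi, ae_iff] at h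
  have h3 : volume (Set.Ioo x c) = 0 := by
    refine measure_mono_null (fun y hy => ?_) h
    simp only [Set.mem_ofPred_eq, Classical.not_imp]
    exact ⟨lt_of_le_of_lt hx hy.1, hsub hy⟩
  rw [Real.volume_Ioo, ENNReal.ofReal_eq_zero] at h3
  simp only [Set.mem_Ioi] at hc
  linarith

section Exponential

variable {μ : Measure ℝ} [IsProbabilityMeasure μ]

lemma eq_expMeasure_of_tail (hpos : ∀ᵐ x ∂μ, 0 < x) {s : ℝ} (hs : 0 < s)
    (h : ∀ x, 0 < x → tail μ x = Real.exp (-(s * x))) : μ = expMeasure s := by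
  have := isProbabilityMeasure_expMeasure hs
  refine Measure.eq_of_cdf _ _ ?_
  ext x
  rw [cdf_expMeasure_eq hs]
  have h1 := tail_eq_one_sub_cdf μ x
  rcases lt_trichotomy x 0 with hx | hx | hx
  · rw [tail_of_nonpos hpos hx.le] at h1
    rw [if_neg (not_le.2 hx)]; linarith
  · subst hx
    rw [tail_of_nonpos hpos le_rfl] at h1
    simp; linarith
  · rw [h x hx] at h1
    rw [if_pos hx.le]; linarith

lemma tail_expMeasure {s : ℝ} (hs : 0 < s) {x : ℝ} (hx : 0 ≤ x) :
    tail (expMeasure s) x = Real.exp (-(s * x)) := by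
  have := isProbabilityMeasure_expMeasure hs
  rw [tail_eq_one_sub_cdf, cdf_expMeasure_eq hs, if_pos hx]; ring

/-- A service law whose tail satisfies `tail (ρ x) = tail x ^ ρ` for one `ρ > 1`, and for which
`log (tail x) / x` is monotone, is exponential. -/
lemma exists_eq_expMeasure (hpos : ∀ᵐ x ∂μ, 0 < x) {ρ : ℝ} (hρ : 1 < ρ)
    (h : ∀ x, 0 < x → tail μ (ρ * x) = tail μ x ^ ρ)
    (hm : MonotoneOn (fun x => Real.log (tail μ x) / x) (Set.Ioi 0) ∨
      AntitoneOn (fun x => Real.log (tail μ x) / x) (Set.Ioi 0)) :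
    ∃ s : ℝ, 0 < s ∧ μ = expMeasure s := by
  have hρ0 : 0 < ρ := by linarith
  obtain ⟨x₀, hx₀, ht₀⟩ := exists_tail_pos hpos
  have hiter : ∀ k : ℕ, ∀ x, 0 < x → tail μ (ρ ^ k * x) = tail μ x ^ (ρ ^ k) := by
    intro k
    induction k with
    | zero => intro x _; simp
    | succ k ih =>
      intro x hx
      rw [pow_succ, mul_assoc, ih (ρ * x) (by positivity), h x hx,
        ← Real.rpow_mul (tail_nonneg μ x), mul_comm ρ]
  have hbig : ∀ x y : ℝ, 0 < x → ∃ k : ℕ, y ≤ ρ ^ k * x := by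
    intro x y hx
    obtain ⟨k, hk⟩ := pow_unbounded_of_one_lt (y / x) hρ
    exact ⟨k, by rw [div_lt_iff₀ hx] at hk; exact hk.le⟩
  -- Positivity near `0` spreads to all `x` by the scaling relation.
  have htpos : ∀ x, 0 < tail μ x := by
    intro x
    obtain ⟨k, hk⟩ := hbig x₀ x hx₀
    refine lt_of_lt_of_le ?_ (tail_antitone μ hk)
    rw [hiter k x₀ hx₀]; positivity
  -- `φ` is monotone and invariant under `x ↦ ρ x`, hence constant; the tail is then an exponential
  -- function.
  set φ := fun x => Real.log (tail μ x) / x with hφ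
  have hinv : ∀ k : ℕ, ∀ x, 0 < x → φ (ρ ^ k * x) = φ x := by
    intro k x hx
    simp only [hφ]
    rw [hiter k x hx, Real.log_rpow (htpos x)]
    field_simp
  have hle : ∀ x y, 0 < x → x ≤ y → φ x = φ y := by
    intro x y hx hxy
    obtain ⟨k, hk⟩ := hbig x y hx
    have hy : 0 < y := hx.trans_le hxy
    rcases hm with hm | hm
    · exact le_antisymm (hm hx hy hxy) ((hm hy (hy.trans_le hk) hk).trans_eq (hinv k x hx))
    · exact le_antisymm ((hinv k x hx).symm.trans_le (hm hy (hy.trans_le hk) hk)) (hm hx hy hxy)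
  have hconst : ∀ x, 0 < x → φ x = φ 1 := by
    intro x hx
    rcases le_total x 1 with h1 | h1
    · exact hle x 1 hx h1
    · exact (hle 1 x one_pos h1).symm
  have hexp : ∀ x, 0 < x → tail μ x = Real.exp (-(-φ 1 * x)) := by
    intro x hx
    rw [← Real.exp_log (htpos x)]
    have := hconst x hx
    simp only [hφ] at this ⊢
    congr 1
    rw [div_eq_iff hx.ne'] at this
    rw [this]; ring
  have hs : 0 < -φ 1 := by
    by_contra hneg
    have h1 : ∀ x : ℝ, 0 < x → 1 ≤ tail μ x := by
      intro x hx
      rw [hexp x hx]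
      refine Real.one_le_exp ?_
      nlinarith [mul_nonneg (not_lt.1 hneg |> neg_nonneg.2) hx.le]
    have h2 := (tendsto_tail_atTop μ).eventually (gt_mem_nhds (show (0 : ℝ) < 1 by norm_num))
    obtain ⟨x, hx1, hx2⟩ := (h2.and (eventually_gt_atTop 0)).exists
    exact absurd (h1 x hx2) (not_le.2 hx1)
  exact ⟨_, hs, eq_expMeasure_of_tail hpos hs hexp⟩

end Exponential

/-! ### Log-concave tails -/

section LogConcave

/-- `x` and `y` are convex combinations of `e` and `b` with interchanged weights; multiply the two
defining inequalities. -/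
lemma LogConcaveTail.tail_mul_le {μ : Measure ℝ} (h : LogConcaveTail μ) {e b x y : ℝ} (he : 0 ≤ e)
    (hx : e ≤ x) (hy : e ≤ y) (hsum : x + y = e + b) :
    tail μ e * tail μ b ≤ tail μ x * tail μ y := by
  rcases hx.eq_or_lt with rfl | hx
  · rw [show y = b by linarith]
  rcases hy.eq_or_lt with rfl | hy
  · rw [show x = b by linarith, mul_comm]
  have hb : e < b := by linarith
  have hbe : 0 < b - e := by linarith
  have h1 := h e b ((b - x) / (b - e)) ((x - e) / (b - e)) he (by linarith)
    (div_pos (by linarith) hbe) (div_pos (by linarith) hbe) (by field_simp; ring)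
  have h2 := h e b ((x - e) / (b - e)) ((b - x) / (b - e)) he (by linarith)
    (div_pos (by linarith) hbe) (div_pos (by linarith) hbe) (by field_simp; ring)
  have e1 : (b - x) / (b - e) * e + (x - e) / (b - e) * b = x := by field_simp; ring
  have e2 : (x - e) / (b - e) * e + (b - x) / (b - e) * b = y := by
    rw [show y = e + b - x by linarith]; field_simp; ring
  rw [e1] at h1
  rw [e2] at h2
  have hp : 0 ≤ (b - x) / (b - e) := div_nonneg (by linarith) hbe.le
  have hq : 0 ≤ (x - e) / (b - e) := div_nonneg (by linarith) hbe.le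
  have hpq : (b - x) / (b - e) + (x - e) / (b - e) = 1 := by field_simp; ring
  have hpow : ∀ z, tail μ z ^ ((b - x) / (b - e)) * tail μ z ^ ((x - e) / (b - e)) = tail μ z := by
    intro z
    rw [← Real.rpow_add_of_nonneg (tail_nonneg μ _) hp hq, hpq, Real.rpow_one]
  calc tail μ e * tail μ b
      = (tail μ e ^ ((b - x) / (b - e)) * tail μ e ^ ((x - e) / (b - e)))
        * (tail μ b ^ ((b - x) / (b - e)) * tail μ b ^ ((x - e) / (b - e))) := by
        rw [hpow, hpow]
    _ = (tail μ e ^ ((b - x) / (b - e)) * tail μ b ^ ((x - e) / (b - e)))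
        * (tail μ e ^ ((x - e) / (b - e)) * tail μ b ^ ((b - x) / (b - e))) := by ring
    _ ≤ _ := mul_le_mul h1 h2 (mul_nonneg (Real.rpow_nonneg (tail_nonneg μ _) _)
        (Real.rpow_nonneg (tail_nonneg μ _) _)) (tail_nonneg μ _)

variable {μ : Measure ℝ} [IsProbabilityMeasure μ]

/-- Concavity of the log-tail between `0`, where it vanishes, and `x`. -/
lemma LogConcaveTail.rpow_le (h : LogConcaveTail μ) (hpos : ∀ᵐ x ∂μ, 0 < x) {x c : ℝ}
    (hx : 0 ≤ x) (hc0 : 0 ≤ c) (hc1 : c ≤ 1) : tail μ x ^ c ≤ tail μ (c * x) := by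
  rcases hc0.eq_or_lt with rfl | hc0
  · simp [tail_of_nonpos hpos le_rfl]
  rcases hc1.eq_or_lt with rfl | hc1
  · simp
  · have := h x 0 c (1 - c) hx le_rfl hc0 (by linarith) (by ring)
    simpa [tail_of_nonpos hpos le_rfl] using this

/-- Multiply the bounds of `LogConcaveTail.rpow_le` with exponents `x / (x + y)` and `y / (x + y)`,
whose sum is `1`. -/
lemma LogConcaveTail.tail_add_le (h : LogConcaveTail μ) (hpos : ∀ᵐ x ∂μ, 0 < x) {x y : ℝ}
    (hx : 0 ≤ x) (hy : 0 ≤ y) : tail μ (x + y) ≤ tail μ x * tail μ y := by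
  rcases (add_nonneg hx hy).eq_or_lt with h0 | h0
  · have hx0 : x = 0 := by linarith
    have hy0 : y = 0 := by linarith
    simp [hx0, hy0, tail_of_nonpos hpos le_rfl]
  · have h1 := h.rpow_le hpos (c := x / (x + y)) h0.le (by positivity)
      ((div_le_one h0).2 (by linarith))
    have h2 := h.rpow_le hpos (c := y / (x + y)) h0.le (by positivity)
      ((div_le_one h0).2 (by linarith))
    rw [div_mul_cancel₀ _ h0.ne'] at h1 h2
    have h3 := mul_le_mul h1 h2 (Real.rpow_nonneg (tail_nonneg μ _) _) (tail_nonneg μ _)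
    rwa [← Real.rpow_add_of_nonneg (tail_nonneg μ _) (by positivity) (by positivity), ← add_div,
      div_self h0.ne', Real.rpow_one] at h3

lemma LogConcaveTail.tail_sum_le (h : LogConcaveTail μ) (hpos : ∀ᵐ x ∂μ, 0 < x) {ι : Type*}
    (R : Finset ι) {τ : ι → ℝ} (hτ : ∀ i ∈ R, 0 ≤ τ i) :
    tail μ (∑ i ∈ R, τ i) ≤ ∏ i ∈ R, tail μ (τ i) := by
  classical
  induction R using Finset.induction_on with
  | empty => simpa using tail_le_one μ 0
  | insert i R hi ih =>
    rw [Finset.sum_insert hi, Finset.prod_insert hi]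
    have hτ' : ∀ j ∈ R, 0 ≤ τ j := fun j hj => hτ j (Finset.mem_insert_of_mem hj)
    exact (h.tail_add_le hpos (hτ i (Finset.mem_insert_self i R)) (Finset.sum_nonneg hτ')).trans
      (mul_le_mul_of_nonneg_left (ih hτ') (tail_nonneg μ _))

/-- Among nonnegative `τ` with given sum `e + b` and maximum at most `b`, the product of the tails
is smallest when only two entries `b`, `e` are nonzero. -/
lemma LogConcaveTail.mul_le_prod (h : LogConcaveTail μ) (hpos : ∀ᵐ x ∂μ, 0 < x) {ι : Type*}
    [DecidableEq ι] {R : Finset ι} {τ : ι → ℝ} (hτ : ∀ i ∈ R, 0 ≤ τ i) {i : ι} (hi : i ∈ R)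
    (hmax : ∀ j ∈ R, τ j ≤ τ i) {e b : ℝ} (he : 0 ≤ e) (heb : e ≤ b)
    (hsum : ∑ i ∈ R, τ i = e + b) (hib : τ i ≤ b) :
    tail μ e * tail μ b ≤ ∏ i ∈ R, tail μ (τ i) := by
  -- If the largest entry is at least `e`, merge all other entries by submultiplicativity and spread
  -- the two numbers that remain.
  rcases le_or_gt e (τ i) with hc | hc
  · rw [← Finset.mul_prod_erase _ _ hi]
    rw [← Finset.add_sum_erase _ _ hi] at hsum
    refine (h.tail_mul_le he hc (y := ∑ j ∈ R.erase i, τ j) (by linarith) (by linarith)).trans ?_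
    exact mul_le_mul_of_nonneg_left (h.tail_sum_le hpos _ fun j hj =>
      hτ j (Finset.mem_of_mem_erase hj)) (tail_nonneg μ _)
  -- If all entries are below `e`, compare each factor with a power of `tail μ e`. The exponents add
  -- up to `1 + b / e`, and `tail μ e ^ (b / e) ≥ tail μ b`.
  · have he0 : 0 < e := (hτ i hi).trans_lt hc
    have hb0 : 0 < b := he0.trans_le heb
    have h1 : ∀ j ∈ R, tail μ e ^ (τ j / e) ≤ tail μ (τ j) := by
      intro j hj
      have := h.rpow_le hpos (x := e) (c := τ j / e) he0.le (div_nonneg (hτ j hj) he0.le)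
        ((div_le_one he0).2 ((hmax j hj).trans hc.le))
      rwa [div_mul_cancel₀ _ he0.ne'] at this
    have h2 := Finset.prod_le_prod (fun j _ => Real.rpow_nonneg (tail_nonneg μ e) _) h1
    refine le_trans ?_ h2
    have h3 : ∏ j ∈ R, tail μ e ^ (τ j / e) = tail μ e ^ ((e + b) / e) := by
      have : ∀ R' : Finset ι, (∀ j ∈ R', 0 ≤ τ j) →
          ∏ j ∈ R', tail μ e ^ (τ j / e) = tail μ e ^ ((∑ j ∈ R', τ j) / e) := by
        intro R'
        induction R' using Finset.induction_on with
        | empty => simp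
        | insert j R' hj ih =>
          intro hh
          have hh' : ∀ k ∈ R', 0 ≤ τ k := fun k hk => hh k (Finset.mem_insert_of_mem hk)
          rw [Finset.prod_insert hj, Finset.sum_insert hj, ih hh', add_div,
            Real.rpow_add_of_nonneg (tail_nonneg μ e)
            (div_nonneg (hh j (Finset.mem_insert_self j R')) he0.le)
            (div_nonneg (Finset.sum_nonneg hh') he0.le)]
      rw [this R hτ, hsum]
    rw [h3, add_div, div_self he0.ne', Real.rpow_add_of_nonneg (tail_nonneg μ e) zero_le_one
      (by positivity), Real.rpow_one]
    refine mul_le_mul_of_nonneg_left ?_ (tail_nonneg μ _)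
    have h4 := h.rpow_le hpos (x := b) (c := e / b) hb0.le (by positivity)
      ((div_le_one hb0).2 heb)
    rw [div_mul_cancel₀ _ hb0.ne'] at h4
    have h5 := Real.rpow_le_rpow (Real.rpow_nonneg (tail_nonneg μ _) _) h4
      (show 0 ≤ b / e by positivity)
    rwa [← Real.rpow_mul (tail_nonneg μ _), show e / b * (b / e) = 1 by field_simp,
      Real.rpow_one] at h5

lemma LogConcaveTail.exists_exp_bound (h : LogConcaveTail μ) (hpos : ∀ᵐ x ∂μ, 0 < x) :
    ∃ c x₀ : ℝ, 0 < c ∧ 0 < x₀ ∧ ∀ x, x₀ ≤ x → tail μ x ≤ Real.exp (-c * x) := by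
  have h2 := (tendsto_tail_atTop μ).eventually (gt_mem_nhds (show (0 : ℝ) < 1 by norm_num))
  obtain ⟨x₀, hx1, hx0⟩ := (h2.and (eventually_gt_atTop 0)).exists
  -- The `1 / 2` keeps `q` positive when the tail vanishes at `x₀`, so that `-log q / x₀` is still a
  -- valid decay rate.
  set q := max (tail μ x₀) (1 / 2) with hq
  have hq0 : 0 < q := lt_of_lt_of_le (by norm_num) (le_max_right _ _)
  have hq1 : q < 1 := max_lt hx1 (by norm_num)
  refine ⟨-Real.log q / x₀, x₀, div_pos (by linarith [Real.log_neg hq0 hq1]) hx0, hx0, ?_⟩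
  intro x hx
  have hxp : 0 < x := hx0.trans_le hx
  have h4 := h.rpow_le hpos (x := x) (c := x₀ / x) hxp.le (by positivity)
      ((div_le_one hxp).2 hx)
  rw [div_mul_cancel₀ _ hxp.ne'] at h4
  have h5 := Real.rpow_le_rpow (Real.rpow_nonneg (tail_nonneg μ _) _)
    (h4.trans (le_max_left _ (1 / 2))) (show 0 ≤ x / x₀ by positivity)
  rw [← Real.rpow_mul (tail_nonneg μ _), show x₀ / x * (x / x₀) = 1 by field_simp,
      Real.rpow_one, ← hq] at h5
  refine h5.trans_eq ?_
  rw [Real.rpow_def_of_pos hq0]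
  congr 1; ring

lemma LogConcaveTail.lintegral_sq_lt_top (h : LogConcaveTail μ) (hpos : ∀ᵐ x ∂μ, 0 < x) :
    ∫⁻ x, ENNReal.ofReal x ^ 2 ∂μ < ∞ := by
  obtain ⟨c, x₀, hc, hx₀, hb⟩ := h.exists_exp_bound hpos
  have h0 : 0 ≤ᵐ[μ] fun x : ℝ => x := hpos.mono fun x hx => hx.le
  have h1 : ∫⁻ x, ENNReal.ofReal x ^ 2 ∂μ = ∫⁻ x, ENNReal.ofReal (x ^ (2 : ℝ)) ∂μ := by
    refine lintegral_congr_ae (hpos.mono fun x hx => ?_)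
    simp only
    rw [← ENNReal.ofReal_pow hx.le]
    norm_num
  rw [h1, lintegral_rpow_eq_lintegral_meas_lt_mul μ h0 aemeasurable_id (by norm_num)]
  refine ENNReal.mul_lt_top (by simp) ?_
  have hsplit : Set.Ioi (0 : ℝ) = Set.Ioc 0 x₀ ∪ Set.Ioi x₀ := (Set.Ioc_union_Ioi_eq_Ioi hx₀.le).symm
  rw [hsplit]
  refine (lintegral_union_le _ _ _).trans_lt (ENNReal.add_lt_top.2 ⟨?_, ?_⟩)
  · refine lt_of_le_of_lt (setLIntegral_mono' (g := fun _ => ENNReal.ofReal x₀) measurableSet_Ioc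
      fun t ht => ?_) ?_
    · refine (mul_le_of_le_one_left zero_le prob_le_one).trans (ENNReal.ofReal_le_ofReal ?_)
      norm_num; exact ht.2
    · simp [ENNReal.mul_lt_top]
  · have hi : IntegrableOn (fun x : ℝ => x ^ (1 : ℝ) * Real.exp (-c * x ^ (1 : ℝ))) (Set.Ioi 0) :=
      integrableOn_rpow_mul_exp_neg_mul_rpow (by norm_num) one_pos hc
    have hi2 := (hi.mono_set (Set.Ioi_subset_Ioi hx₀.le)).lintegral_lt_top
    refine lt_of_le_of_lt (setLIntegral_mono' measurableSet_Ioi fun t ht => ?_) hi2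
    have ht0 : 0 < t := hx₀.trans ht
    have : μ {a | t < a} = ENNReal.ofReal (tail μ t) := measure_Ioi_eq μ t
    rw [this, ← ENNReal.ofReal_mul (tail_nonneg μ _)]
    refine ENNReal.ofReal_le_ofReal ?_
    have := hb t (le_of_lt ht)
    norm_num
    rw [mul_comm]
    simp only [neg_mul] at this
    exact mul_le_mul_of_nonneg_left this ht0.le

end LogConcave

/-! ### Finiteness of the mean, and changes of variables on the half-line -/

lemma lintegral_lt_top_of_sq {μ : Measure ℝ} [IsProbabilityMeasure μ]
    (h : ∫⁻ x, ENNReal.ofReal x ^ 2 ∂μ < ∞) : ∫⁻ x, ENNReal.ofReal x ∂μ < ∞ := by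
  refine lt_of_le_of_lt (lintegral_mono (g := fun x => 1 + ENNReal.ofReal x ^ 2) fun x => ?_) ?_
  · rcases le_total (ENNReal.ofReal x) 1 with h1 | h1
    · exact h1.trans le_self_add
    · exact (le_self_pow h1 (by norm_num)).trans le_add_self
  · rw [lintegral_add_left measurable_const]
    simpa using h

lemma lintegral_comp_div {f : ℝ → ℝ≥0∞} (hf : Measurable f) {c : ℝ} (hc : 0 < c) :
    ∫⁻ u, f (u / c) = ENNReal.ofReal c * ∫⁻ u, f u := by
  have h := Real.map_volume_mul_left (a := c⁻¹) (by positivity)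
  rw [inv_inv, abs_of_pos hc] at h
  rw [← smul_eq_mul, ← lintegral_smul_measure, ← h, lintegral_map hf (by fun_prop)]
  simp only [div_eq_inv_mul]

lemma setLIntegral_comp_div {f : ℝ → ℝ≥0∞} (hf : Measurable f) {c : ℝ} (hc : 0 < c) :
    ∫⁻ u in Set.Ioi 0, f (u / c) = ENNReal.ofReal c * ∫⁻ u in Set.Ioi 0, f u := by
  rw [← lintegral_indicator measurableSet_Ioi, ← lintegral_indicator measurableSet_Ioi,
    ← lintegral_comp_div (hf.indicator measurableSet_Ioi) hc]
  refine lintegral_congr fun u => ?_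
  simp [Set.indicator, div_pos_iff_of_pos_right hc]

/-- Substitute `u = d + 2 s`: when two copies started `d` apart have together run for `u`, their
elapsed times are `(u + d) / 2` and `(u - d) / 2`. -/
lemma setLIntegral_comp_add_sub {f g : ℝ → ℝ≥0∞} (hf : Measurable f) (hg : Measurable g) (d : ℝ) :
    ∫⁻ u in Set.Ioi d, f ((u + d) / 2) * g ((u - d) / 2)
      = 2 * ∫⁻ s in Set.Ioi 0, f (d + s) * g s := by
  have h1 : (2 : ℝ≥0∞) = ENNReal.ofReal 2 := by simp
  rw [h1, ← setLIntegral_comp_div (by fun_prop) two_pos, ← lintegral_indicator measurableSet_Ioi,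
    ← lintegral_indicator measurableSet_Ioi,
    ← lintegral_sub_right_eq_self (Set.indicator (Set.Ioi 0) fun u => f (d + u / 2) * g (u / 2)) d]
  refine lintegral_congr fun u => ?_
  simp only [Set.indicator, Set.mem_Ioi, sub_pos]
  rw [show d + (u - d) / 2 = (u + d) / 2 by ring]

lemma setLIntegral_comp_add_left (f : ℝ → ℝ≥0∞) (d : ℝ) :
    ∫⁻ s in Set.Ioi 0, f (d + s) = ∫⁻ u in Set.Ioi d, f u := by
  rw [← lintegral_indicator measurableSet_Ioi, ← lintegral_indicator measurableSet_Ioi,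
    ← lintegral_add_left_eq_self (Set.indicator (Set.Ioi d) f) d]
  refine lintegral_congr fun u => ?_
  simp [Set.indicator]

/-! ### Integral inequalities for log-concave tails -/

section LogConcave

variable {μ : Measure ℝ} [IsProbabilityMeasure μ]

/-- Chebyshev's association inequality for a log-concave tail and its translate. -/
lemma LogConcaveTail.lintegral_mul_le (h : LogConcaveTail μ) {d : ℝ} (hd : 0 ≤ d) :
    (∫⁻ s in Set.Ioi 0, ENNReal.ofReal (tail μ s) * ENNReal.ofReal (tail μ s))
        * ∫⁻ s in Set.Ioi 0, ENNReal.ofReal (tail μ (d + s))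
      ≤ (∫⁻ s in Set.Ioi 0, ENNReal.ofReal (tail μ (d + s)) * ENNReal.ofReal (tail μ s))
        * ∫⁻ s in Set.Ioi 0, ENNReal.ofReal (tail μ s) := by
  set ν := volume.restrict (Set.Ioi (0 : ℝ)) with hν
  set f : ℝ → ℝ≥0∞ := fun s => ENNReal.ofReal (tail μ s) with hf
  set g : ℝ → ℝ≥0∞ := fun s => ENNReal.ofReal (tail μ (d + s)) with hg
  have mf : Measurable f := by fun_prop
  have mg : Measurable g := by fun_prop
  have e1 : ∫⁻ z, (f z.1 * f z.1) * g z.2 ∂ν.prod ν = (∫⁻ s, f s * f s ∂ν) * ∫⁻ s, g s ∂ν :=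
    lintegral_prod_mul (f := fun s => f s * f s) (by fun_prop) (by fun_prop)
  have e2 : ∫⁻ z, g z.1 * (f z.2 * f z.2) ∂ν.prod ν = (∫⁻ s, g s ∂ν) * ∫⁻ s, f s * f s ∂ν :=
    lintegral_prod_mul (g := fun s => f s * f s) (by fun_prop) (by fun_prop)
  have e3 : ∫⁻ z, (g z.1 * f z.1) * f z.2 ∂ν.prod ν = (∫⁻ s, g s * f s ∂ν) * ∫⁻ s, f s ∂ν :=
    lintegral_prod_mul (f := fun s => g s * f s) (by fun_prop) (by fun_prop)
  have e4 : ∫⁻ z, f z.1 * (g z.2 * f z.2) ∂ν.prod ν = (∫⁻ s, f s ∂ν) * ∫⁻ s, g s * f s ∂ν :=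
    lintegral_prod_mul (g := fun s => g s * f s) (by fun_prop) (by fun_prop)
  -- Symmetrized over pairs `(s, t)`, the difference of the integrands is `(f s - f t) * (g s * f t
  -- - f s * g t)`. Both factors have the same sign, since `f` and, by log-concavity, `g / f`
  -- decrease.
  have key : ∫⁻ z, (f z.1 * f z.1) * g z.2 + g z.1 * (f z.2 * f z.2) ∂ν.prod ν
      ≤ ∫⁻ z, (g z.1 * f z.1) * f z.2 + f z.1 * (g z.2 * f z.2) ∂ν.prod ν := by
    rw [hν, Measure.prod_restrict]
    refine setLIntegral_mono' (measurableSet_Ioi.prod measurableSet_Ioi) fun z hz => ?_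
    obtain ⟨s, t⟩ := z
    have hs : 0 < s := hz.1
    have ht : 0 < t := hz.2
    simp only [hf, hg]
    have n := tail_nonneg μ
    rw [← ENNReal.ofReal_mul (n _), ← ENNReal.ofReal_mul (mul_nonneg (n _) (n _)),
      ← ENNReal.ofReal_mul (n _), ← ENNReal.ofReal_mul (n _), ← ENNReal.ofReal_mul (n _),
      ← ENNReal.ofReal_mul (mul_nonneg (n _) (n _)), ← ENNReal.ofReal_mul (n _),
      ← ENNReal.ofReal_mul (n _),
      ← ENNReal.ofReal_add (mul_nonneg (mul_nonneg (n _) (n _)) (n _))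
        (mul_nonneg (n _) (mul_nonneg (n _) (n _))),
      ← ENNReal.ofReal_add (mul_nonneg (mul_nonneg (n _) (n _)) (n _))
        (mul_nonneg (n _) (mul_nonneg (n _) (n _)))]
    refine ENNReal.ofReal_le_ofReal ?_
    rcases le_total s t with hst | hst
    · have h1 := tail_antitone μ hst
      have h2 := h.tail_mul_le (e := s) (b := d + t) (x := d + s) (y := t) hs.le (by linarith) hst
        (by ring)
      nlinarith
    · have h1 := tail_antitone μ hst
      have h2 := h.tail_mul_le (e := t) (b := d + s) (x := d + t) (y := s) ht.le (by linarith) hst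
        (by ring)
      nlinarith
  rw [lintegral_add_left (by fun_prop), lintegral_add_left (by fun_prop), e1, e2, e3, e4,
    mul_comm (∫⁻ s, g s ∂ν), mul_comm (∫⁻ s, f s ∂ν), ← two_mul, ← two_mul] at key
  exact (ENNReal.mul_le_mul_iff_right (by simp) (by simp)).1 key

/-- Two copies of a job that start together need strictly more than the service time of one
copy, unless the service time is exponential. -/
lemma LogConcaveTail.lintegral_lt (h : LogConcaveTail μ) (hpos : ∀ᵐ x ∂μ, 0 < x)
    (hne : ∀ s : ℝ, 0 < s → μ ≠ expMeasure s)
    (hfin : ∫⁻ u in Set.Ioi 0, ENNReal.ofReal (tail μ u) ≠ ∞) :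
    ∫⁻ u in Set.Ioi 0, ENNReal.ofReal (tail μ u)
      < 2 * ∫⁻ s in Set.Ioi 0, ENNReal.ofReal (tail μ s) * ENNReal.ofReal (tail μ s) := by
  by_contra hcon
  rw [not_lt] at hcon
  -- Rescaling the left side reduces the claim to comparing `tail (2 s)` with `tail s ^ 2`; equal
  -- integrals would make them equal everywhere.
  have h1 : ∫⁻ u in Set.Ioi 0, ENNReal.ofReal (tail μ u)
      = 2 * ∫⁻ u in Set.Ioi 0, ENNReal.ofReal (tail μ (2 * u)) := by
    have := setLIntegral_comp_div (f := fun u => ENNReal.ofReal (tail μ (2 * u)))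
      (by fun_prop) two_pos
    simpa [mul_div_cancel₀] using this
  rw [h1] at hcon hfin
  have h2 := (ENNReal.mul_le_mul_iff_right (by simp) (by simp)).1 hcon
  have hle : ∀ s ∈ Set.Ioi (0 : ℝ), ENNReal.ofReal (tail μ (2 * s))
      ≤ ENNReal.ofReal (tail μ s) * ENNReal.ofReal (tail μ s) := by
    intro s hs
    rw [← ENNReal.ofReal_mul (tail_nonneg μ _), two_mul]
    exact ENNReal.ofReal_le_ofReal (h.tail_add_le hpos (le_of_lt hs) (le_of_lt hs))
  have h3 := ae_eq_of_ae_le_of_lintegral_le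
    ((ae_restrict_iff' measurableSet_Ioi).2 (ae_of_all _ hle))
    (fun h => hfin (by rw [h]; simp)) (by fun_prop) h2
  have h4 : ∀ x, 0 ≤ x → tail μ (2 * x) = tail μ x * tail μ x := by
    intro x hx
    refine eq_of_ae_eq_of_rightContinuous (f := fun x => tail μ (2 * x))
      (g := fun x => tail μ x * tail μ x) ?_ ?_ ?_ hx
    · intro y
      refine (tail_continuousWithinAt μ (2 * y)).comp (f := fun x => 2 * x)
        (continuous_const_mul 2).continuousWithinAt fun z hz => ?_
      simp only [Set.mem_Ici] at hz ⊢; linarith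
    · exact fun y => (tail_continuousWithinAt μ y).mul (tail_continuousWithinAt μ y)
    · filter_upwards [h3] with y hy
      rw [← ENNReal.ofReal_mul (tail_nonneg μ _)] at hy
      exact (ENNReal.ofReal_eq_ofReal_iff (tail_nonneg μ _)
        (mul_nonneg (tail_nonneg μ _) (tail_nonneg μ _))).1 hy
  obtain ⟨s, hs, he⟩ := exists_eq_expMeasure hpos (ρ := 2) (by norm_num)
    (fun x hx => by rw [h4 x hx.le, Real.rpow_two, sq]) (Or.inr (by
      intro x hx y hy hxy
      simp only [Set.mem_Ioi] at hx hy
      simp only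
      rw [div_le_div_iff₀ hy hx]
      have h6 := h.rpow_le hpos (x := y) (c := x / y) hy.le (by positivity) ((div_le_one hy).2 hxy)
      rw [div_mul_cancel₀ _ hy.ne'] at h6
      -- As `Real.log 0 = 0`, a vanishing tail must be excluded: by the functional equation a zero
      -- at `y` passes to every `y / 2 ^ k`, against positivity near `0`.
      rcases (tail_nonneg μ y).eq_or_lt with h0 | h0
      · have hz : ∀ k : ℕ, tail μ (y / 2 ^ k) = 0 := by
          intro k
          induction k with
          | zero => simpa using h0.symm
          | succ k ih =>
            have := h4 (y / 2 ^ (k + 1)) (by positivity)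
            rw [show 2 * (y / 2 ^ (k + 1)) = y / 2 ^ k by rw [pow_succ]; field_simp, ih] at this
            exact mul_self_eq_zero.1 this.symm
        obtain ⟨x₀, hx₀, ht₀⟩ := exists_tail_pos hpos
        obtain ⟨k, hk⟩ := pow_unbounded_of_one_lt (y / x₀) (show (1 : ℝ) < 2 by norm_num)
        have : y / 2 ^ k ≤ x₀ := by
          rw [div_lt_iff₀ hx₀] at hk
          rw [div_le_iff₀ (by positivity)]; linarith
        have := tail_antitone μ this
        rw [hz k] at this
        exact absurd this (not_le.2 ht₀)
      · have h7 := Real.log_le_log (Real.rpow_pos_of_pos h0 _) h6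
        rw [Real.log_rpow h0, div_mul_eq_mul_div, div_le_iff₀ hy] at h7
        linarith))
  exact hne s hs he

end LogConcave

/-! ### Lower bounds for the consumption of a job -/

section ConsumptionBounds

variable {μ : Measure ℝ} [IsProbabilityMeasure μ]

/-- The job ends no later than its copy `i` alone would, and that copy can start at `m - d`. With
`m` the end of the current busy period this bounds the mean prolongation. -/
lemma lintegral_finish_sub_le {a m d : ℝ} {R : Finset (Fin n)} {f : Fin n → ℝ} {i : Fin n}
    (hi : i ∈ R) (hd : max a (f i) + d ≤ m) :
    ∫⁻ x, ENNReal.ofReal (finish a R x f - m) ∂(Measure.pi fun _ : Fin n => μ)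
      ≤ ∫⁻ u in Set.Ioi d, ENNReal.ofReal (tail μ u) := by
  rw [← lintegral_sub_eq_tail, ← (measurePreserving_eval (fun _ : Fin n => μ) i).lintegral_comp
    (f := fun x => ENNReal.ofReal (x - d)) (by fun_prop)]
  refine lintegral_mono fun x => ENNReal.ofReal_le_ofReal ?_
  have := finish_le (a := a) (x := x) (f := f) hi
  simp only [Function.eval]
  linarith

variable (μ) in
/-- The expected consumption that is lost by truncating at `K`. -/
lemma exists_truncation (n : ℕ) (hfin : ∫⁻ u in Set.Ioi 0, ENNReal.ofReal (tail μ u) ≠ ∞)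
    {ε : ℝ≥0∞} (hε : 0 < ε) (hn : 0 < n) : ∃ K : ℝ, 0 < K ∧
      ∫⁻ u in Set.Ici K, ENNReal.ofReal (tail μ (u / n)) ≤ ε := by
  have hn' : (0 : ℝ) < n := by exact_mod_cast hn
  have h1 : ∫⁻ u in Set.Ioi 0, ENNReal.ofReal (tail μ (u / n)) ≠ ∞ := by
    rw [setLIntegral_comp_div (f := fun u => ENNReal.ofReal (tail μ u)) (by fun_prop) hn']
    exact ENNReal.mul_ne_top ENNReal.ofReal_ne_top hfin
  have h2 := tendsto_lintegral_of_dominated_convergence (μ := volume)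
    (F := fun (k : ℕ) => Set.indicator (Set.Ici (k + 1 : ℝ))
      fun u => ENNReal.ofReal (tail μ (u / n)))
    (f := fun _ => 0) (Set.indicator (Set.Ioi 0) fun u => ENNReal.ofReal (tail μ (u / n)))
    (fun k => Measurable.indicator (by fun_prop) measurableSet_Ici)
    (fun k => ae_of_all _ fun u => Set.indicator_le_indicator_of_subset
      (fun x hx => by
        simp only [Set.mem_Ici, Set.mem_Ioi] at hx ⊢
        have : (0 : ℝ) ≤ k := by positivity
        linarith) (fun _ => zero_le) u)
    (by rwa [lintegral_indicator measurableSet_Ioi])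
    (ae_of_all _ fun u => by
      refine tendsto_const_nhds.congr' ?_
      filter_upwards [(tendsto_natCast_atTop_atTop (R := ℝ)).eventually_gt_atTop u] with k hk
      rw [Set.indicator_of_notMem]
      simp only [Set.mem_Ici, not_le]; linarith)
  rw [lintegral_zero] at h2
  obtain ⟨k, hk⟩ := (h2.eventually (ge_mem_nhds hε)).exists
  refine ⟨k + 1, by positivity, ?_⟩
  rwa [lintegral_indicator measurableSet_Ici] at hk

/-- When the copies have together run for `u`, one of them has run for at least `u / n`. The bound
does not depend on the state, so one truncation level serves all states. -/
lemma measure_lt_consumption_le (hpos : ∀ᵐ x ∂μ, 0 < x) (a : ℝ) {R : Finset (Fin n)}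
    (hR : R.Nonempty) (f : Fin n → ℝ) {u : ℝ} (hu : 0 ≤ u) :
    (Measure.pi fun _ : Fin n => μ) {x | u < consumption a R x f}
      ≤ ENNReal.ofReal (tail μ (u / n)) := by
  obtain ⟨t, ht, htu⟩ := exists_total_elapsed hR (fun i => max a (f i)) hu
  rw [measure_lt_consumption hpos f ht htu]
  refine ENNReal.ofReal_le_ofReal ?_
  obtain ⟨i, hi, hmax⟩ := R.exists_max_image (fun i => max (t - max a (f i)) 0) hR
  rw [← Finset.mul_prod_erase _ _ hi]
  refine (mul_le_of_le_one_right (tail_nonneg μ _) (Finset.prod_le_one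
    (fun _ _ => tail_nonneg μ _) fun _ _ => tail_le_one μ _)).trans (tail_antitone μ ?_)
  have hn : (0 : ℝ) < n := by exact_mod_cast i.pos
  rw [div_le_iff₀ hn, ← htu]
  refine (Finset.sum_le_card_nsmul _ _ _ hmax).trans ?_
  rw [nsmul_eq_mul, mul_comm]
  refine mul_le_mul_of_nonneg_left ?_ (le_max_right _ _)
  exact_mod_cast (Finset.card_le_univ R).trans_eq (Fintype.card_fin n)

lemma setLIntegral_le_min_consumption (hpos : ∀ᵐ x ∂μ, 0 < x) (a : ℝ) {R : Finset (Fin n)}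
    (hR : R.Nonempty) (f : Fin n → ℝ) {K : ℝ} (hK : 0 < K) {ε : ℝ≥0∞}
    (hε : ∫⁻ u in Set.Ici K, ENNReal.ofReal (tail μ (u / n)) ≤ ε) :
    ∫⁻ u in Set.Ioi 0, (Measure.pi fun _ : Fin n => μ) {x | u < consumption a R x f}
      ≤ ∫⁻ x, ENNReal.ofReal (min (consumption a R x f) K) ∂(Measure.pi fun _ : Fin n => μ)
        + ε := by
  rw [lintegral_min_consumption μ a R f hK.le]
  have hsplit : Set.Ioi (0 : ℝ) = Set.Ioo 0 K ∪ Set.Ici K := (Set.Ioo_union_Ici_eq_Ioi hK).symm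
  rw [hsplit]
  refine (lintegral_union_le _ _ _).trans (add_le_add le_rfl (le_trans ?_ hε))
  exact setLIntegral_mono' measurableSet_Ici fun u hu =>
    measure_lt_consumption_le hpos a hR f (hK.le.trans hu)

/-- A single copy consumes exactly its service time. In the form required by
`lowerLatency_eq_top_of_consumption`, with `δ = 0`, this bounds the capacity for `r = 1` from above.
-/
lemma exists_truncation_single (hpos : ∀ᵐ x ∂μ, 0 < x) [NeZero n]
    (hfin : ∫⁻ u in Set.Ioi 0, ENNReal.ofReal (tail μ u) ≠ ∞) {v : ℝ} (hv0 : 0 ≤ v)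
    (hv : v < (∫⁻ u in Set.Ioi 0, ENNReal.ofReal (tail μ u)).toReal) :
    ∃ K : ℝ, 0 < K ∧ ∀ (a m : ℝ) (R : Finset (Fin n)) (f : Fin n → ℝ), R.card = 1 →
      (∀ i, f i ≤ m) → ENNReal.ofReal v + ENNReal.ofReal 0 *
          ∫⁻ x, ENNReal.ofReal (finish a R x f - max a m) ∂(Measure.pi fun _ : Fin n => μ)
        ≤ ∫⁻ x, ENNReal.ofReal (min (consumption a R x f) K)
          ∂(Measure.pi fun _ : Fin n => μ) := by
  set m₁ := ∫⁻ u in Set.Ioi 0, ENNReal.ofReal (tail μ u) with hm₁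
  obtain ⟨K, hK, hK2⟩ := exists_truncation μ n hfin (ε := ENNReal.ofReal (m₁.toReal - v))
    (by simpa using hv) (Nat.pos_of_ne_zero (NeZero.ne n))
  refine ⟨K, hK, fun a m R f hR _ => ?_⟩
  have hne : R.Nonempty := by rw [← Finset.card_pos]; omega
  have h1 := setLIntegral_le_min_consumption hpos a hne f hK hK2
  have h2 : m₁ ≤ ∫⁻ u in Set.Ioi 0,
      (Measure.pi fun _ : Fin n => μ) {x | u < consumption a R x f} := by
    refine setLIntegral_mono' measurableSet_Ioi fun u hu => ?_
    obtain ⟨t, ht, htu⟩ := exists_total_elapsed hne (fun i => max a (f i)) (le_of_lt hu)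
    rw [measure_lt_consumption hpos f ht htu]
    obtain ⟨i, rfl⟩ := Finset.card_eq_one.1 hR
    simp only [Finset.sum_singleton] at htu
    simp [htu]
  have h3 := h2.trans h1
  have h5 : m₁ = ENNReal.ofReal v + ENNReal.ofReal (m₁.toReal - v) := by
    rw [← ENNReal.ofReal_add hv0 (by linarith), add_sub_cancel, ENNReal.ofReal_toReal hfin]
  rw [ENNReal.ofReal_zero, zero_mul, add_zero]
  refine (ENNReal.add_le_add_iff_right ENNReal.ofReal_ne_top).1 (le_trans (le_of_eq ?_) h3)
  exact h5.symm

/-- The first bound is submultiplicativity. The second is `LogConcaveTail.mul_le_prod` with the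
elapsed times that the copies `i` and `j` would have if only these two ran. -/
lemma LogConcaveTail.le_measure_lt_consumption (h : LogConcaveTail μ) (hpos : ∀ᵐ x ∂μ, 0 < x)
    {a : ℝ} {R : Finset (Fin n)} {f : Fin n → ℝ} {i j : Fin n} (hi : i ∈ R) (hj : j ∈ R)
    (hij : i ≠ j) (hmin : ∀ k ∈ R, max a (f i) ≤ max a (f k)) {u : ℝ} (hu : 0 ≤ u) :
    ENNReal.ofReal (tail μ u) ≤ (Measure.pi fun _ : Fin n => μ) {x | u < consumption a R x f} ∧
    (max a (f j) - max a (f i) ≤ u →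
      ENNReal.ofReal (tail μ ((u + (max a (f j) - max a (f i))) / 2))
          * ENNReal.ofReal (tail μ ((u - (max a (f j) - max a (f i))) / 2))
        ≤ (Measure.pi fun _ : Fin n => μ) {x | u < consumption a R x f}) := by
  obtain ⟨t, ht, htu⟩ := exists_total_elapsed ⟨i, hi⟩ (fun i => max a (f i)) hu
  rw [measure_lt_consumption hpos f ht htu]
  constructor
  · refine ENNReal.ofReal_le_ofReal ?_
    rw [← htu]
    exact h.tail_sum_le hpos R fun k _ => le_max_right _ _
  · intro hd
    rw [← ENNReal.ofReal_mul (tail_nonneg μ _)]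
    refine ENNReal.ofReal_le_ofReal ?_
    rw [mul_comm]
    have hd0 := hmin j hj
    obtain ⟨k, hk, hkt⟩ := ht
    have hit := (hmin k hk).trans hkt
    refine h.mul_le_prod hpos (fun k _ => le_max_right _ _) hi
      (fun k hk => max_le_max (by linarith [hmin k hk]) le_rfl) (by linarith) (by linarith)
      (by rw [htu]; ring) ?_
    -- The elapsed times of `i` and `j` add up to at most `u` and differ by at most the delay `d`,
    -- so that of `i` is at most `(u + d) / 2`.
    have h2 : max (t - max a (f i)) 0 + max (t - max a (f j)) 0 ≤ u := by
      rw [← htu]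
      exact Finset.add_le_sum (f := fun k => max (t - max a (f k)) 0) (fun k _ => le_max_right _ _) hi hj hij
    have h3 := le_max_left (t - max a (f j)) 0
    rw [max_eq_left (by linarith : 0 ≤ t - max a (f i))] at h2 ⊢
    linarith

/-- With a second copy delayed by `d`, the surplus over the mean service time is at least `δ * J`,
where `J = E (X - d)⁺`. It may be tiny, but `J` also bounds the mean prolongation of the busy
period, so the surplus covers the `δ` term for every state. -/
lemma LogConcaveTail.exists_consumption_bound (h : LogConcaveTail μ) (hpos : ∀ᵐ x ∂μ, 0 < x)
    [NeZero n] (hne : ∀ s : ℝ, 0 < s → μ ≠ expMeasure s)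
    (hfin : ∫⁻ u in Set.Ioi 0, ENNReal.ofReal (tail μ u) ≠ ∞)
    (hm0 : ∫⁻ u in Set.Ioi 0, ENNReal.ofReal (tail μ u) ≠ 0) :
    ∃ δ : ℝ, 0 < δ ∧ δ ≤ 1 ∧
      ∀ v : ℝ, 0 ≤ v → v < (∫⁻ u in Set.Ioi 0, ENNReal.ofReal (tail μ u)).toReal →
    ∃ K : ℝ, 0 < K ∧ ∀ (a m : ℝ) (R : Finset (Fin n)) (f : Fin n → ℝ), 1 < R.card →
      (∀ i, f i ≤ m) → ENNReal.ofReal v + ENNReal.ofReal δ *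
          ∫⁻ x, ENNReal.ofReal (finish a R x f - max a m) ∂(Measure.pi fun _ : Fin n => μ)
        ≤ ∫⁻ x, ENNReal.ofReal (min (consumption a R x f) K)
          ∂(Measure.pi fun _ : Fin n => μ) := by
  have hlt := h.lintegral_lt hpos hne hfin
  set m₁ := ∫⁻ u in Set.Ioi 0, ENNReal.ofReal (tail μ u) with hm₁
  set m₂ := ∫⁻ s in Set.Ioi 0, ENNReal.ofReal (tail μ s) * ENNReal.ofReal (tail μ s) with hm₂
  have hm₂fin : m₂ ≤ m₁ := setLIntegral_mono' measurableSet_Ioi fun s _ =>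
    mul_le_of_le_one_left zero_le (by simpa using tail_le_one μ s)
  have hm₂ne : m₂ ≠ ∞ := ne_top_of_le_ne_top hfin hm₂fin
  have hm₁pos : 0 < m₁.toReal := ENNReal.toReal_pos hm0 hfin
  have hm₂le : m₂.toReal ≤ m₁.toReal := ENNReal.toReal_mono hfin hm₂fin
  have hlt' : m₁.toReal < 2 * m₂.toReal := by
    have := (ENNReal.toReal_lt_toReal hfin (ENNReal.mul_ne_top (by simp) hm₂ne)).2 hlt
    simpa using this
  -- `δ` is the relative surplus of two copies that start together, so `(1 + δ) m₁ = 2 m₂`; it is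
  -- positive because the law is not exponential.
  set δ := 2 * m₂.toReal / m₁.toReal - 1 with hδ
  have hδ0 : 0 < δ := by rw [hδ, sub_pos, one_lt_div hm₁pos]; exact hlt'
  have hδ1 : δ ≤ 1 := by
    rw [hδ, sub_le_iff_le_add, div_le_iff₀ hm₁pos]; linarith
  have hδm : ENNReal.ofReal (1 + δ) * m₁ = 2 * m₂ := by
    rw [← ENNReal.ofReal_toReal hfin, ← ENNReal.ofReal_mul (by linarith),
      ← ENNReal.ofReal_toReal hm₂ne, show (2 : ℝ≥0∞) = ENNReal.ofReal 2 by simp,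
      ← ENNReal.ofReal_mul (by norm_num)]
    congr 1; rw [hδ]; field_simp; ring
  refine ⟨δ, hδ0, hδ1, fun v hv0 hv => ?_⟩
  obtain ⟨K, hK, hK2⟩ := exists_truncation μ n hfin (ε := ENNReal.ofReal (m₁.toReal - v))
    (by simpa using hv) (Nat.pos_of_ne_zero (NeZero.ne n))
  refine ⟨K, hK, fun a m R f hR hm => ?_⟩
  have hRne : R.Nonempty := by rw [← Finset.card_pos]; omega
  obtain ⟨i, hi, hmin⟩ := R.exists_min_image (fun i => max a (f i)) hRne
  obtain ⟨j, hj, hji⟩ := Finset.exists_mem_ne hR i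
  set d := max a (f j) - max a (f i) with hd
  have hd0 : 0 ≤ d := by linarith [hmin j hj]
  have h1 := setLIntegral_le_min_consumption hpos a hRne f hK hK2
  set J := ∫⁻ u in Set.Ioi d, ENNReal.ofReal (tail μ u) with hJ
  have hJfin : J ≠ ∞ := ne_top_of_le_ne_top hfin (lintegral_mono_set (Set.Ioi_subset_Ioi hd0))
  have hfinish : ∫⁻ x, ENNReal.ofReal (finish a R x f - max a m) ∂(Measure.pi fun _ : Fin n => μ)
      ≤ J := by
    refine lintegral_finish_sub_le hi ?_
    rw [hd, add_sub_cancel]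
    exact max_le_max le_rfl (hm j)
  have h2 : m₁ + ENNReal.ofReal δ * J ≤ ∫⁻ u in Set.Ioi 0,
      (Measure.pi fun _ : Fin n => μ) {x | u < consumption a R x f} := by
    have hsplit : Set.Ioi (0 : ℝ) = Set.Ioc 0 d ∪ Set.Ioi d := (Set.Ioc_union_Ioi_eq_Ioi hd0).symm
    have hdisj : Disjoint (Set.Ioc (0 : ℝ) d) (Set.Ioi d) :=
      Set.disjoint_left.2 fun x hx hx2 => absurd hx.2 (not_le.2 hx2)
    have e1 : m₁ = (∫⁻ u in Set.Ioc 0 d, ENNReal.ofReal (tail μ u)) + J := by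
      rw [hm₁, hsplit, lintegral_union measurableSet_Ioi hdisj]
    rw [e1, hsplit, lintegral_union measurableSet_Ioi hdisj, add_assoc]
    refine add_le_add (setLIntegral_mono' measurableSet_Ioc fun u hu =>
      (h.le_measure_lt_consumption hpos hi hj hji.symm hmin hu.1.le).1) ?_
    have e2 : J + ENNReal.ofReal δ * J = ENNReal.ofReal (1 + δ) * J := by
      rw [ENNReal.ofReal_add zero_le_one hδ0.le, add_mul, ENNReal.ofReal_one, one_mul]
    rw [e2]
    -- Association shows that for any delay the relative surplus beyond `d` is at least that for
    -- delay `0`.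
    have e3 : ENNReal.ofReal (1 + δ) * J ≤ 2 * ∫⁻ s in Set.Ioi 0,
        ENNReal.ofReal (tail μ (d + s)) * ENNReal.ofReal (tail μ s) := by
      have e4 := h.lintegral_mul_le hd0
      rw [setLIntegral_comp_add_left (fun u => ENNReal.ofReal (tail μ u)), ← hm₁, ← hm₂,
        ← hJ] at e4
      refine (ENNReal.mul_le_mul_iff_left hm0 hfin).1 ?_
      rw [mul_right_comm, hδm, mul_assoc, mul_assoc]
      exact mul_le_mul_right e4 2
    refine e3.trans ?_
    rw [← setLIntegral_comp_add_sub (f := fun u => ENNReal.ofReal (tail μ u))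
      (g := fun u => ENNReal.ofReal (tail μ u)) (by fun_prop) (by fun_prop)]
    exact setLIntegral_mono' measurableSet_Ioi fun u hu =>
      (h.le_measure_lt_consumption hpos hi hj hji.symm hmin (hd0.trans (le_of_lt hu))).2
        (le_of_lt hu)
  have h3 := h2.trans h1
  have h4 : ENNReal.ofReal δ * ∫⁻ x, ENNReal.ofReal (finish a R x f - max a m)
      ∂(Measure.pi fun _ : Fin n => μ) ≤ ENNReal.ofReal δ * J := mul_le_mul_right hfinish _
  refine (add_le_add le_rfl h4).trans ?_
  have h5 : m₁ = ENNReal.ofReal v + ENNReal.ofReal (m₁.toReal - v) := by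
    rw [← ENNReal.ofReal_add hv0 (by linarith), add_sub_cancel, ENNReal.ofReal_toReal hfin]
  refine (ENNReal.add_le_add_iff_right ENNReal.ofReal_ne_top).1 (le_trans (le_of_eq ?_) h3)
  rw [add_right_comm, ← h5]

end ConsumptionBounds

/-! ### Log-convex tails -/

section LogConvex

variable {μ : Measure ℝ} [IsProbabilityMeasure μ]

lemma LogConvexTail.le_rpow (h : LogConvexTail μ) (hpos : ∀ᵐ x ∂μ, 0 < x) {x c : ℝ}
    (hx : 0 ≤ x) (hc0 : 0 < c) (hc1 : c ≤ 1) : tail μ (c * x) ≤ tail μ x ^ c := by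
  rcases hc1.eq_or_lt with rfl | hc1
  · simp
  · have := h x 0 c (1 - c) hx le_rfl hc0 (by linarith) (by ring)
    simpa [tail_of_nonpos hpos le_rfl] using this

/-- A zero of the tail would, by log-convexity with the point `0`, annihilate the tail on the whole
of `(0, x]`. So logarithms may be taken freely. -/
lemma LogConvexTail.tail_pos (h : LogConvexTail μ) (hpos : ∀ᵐ x ∂μ, 0 < x) (x : ℝ) :
    0 < tail μ x := by
  by_contra hx
  have hx0 : tail μ x = 0 := le_antisymm (not_lt.1 hx) (tail_nonneg μ x)
  obtain ⟨x₀, hx₀, ht₀⟩ := exists_tail_pos hpos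
  have hlt : x₀ < x := by
    by_contra hle
    have := tail_antitone μ (not_lt.1 hle)
    rw [hx0] at this; linarith
  have hxp : 0 < x := hx₀.trans hlt
  have h1 := h.le_rpow hpos (x := x) (c := x₀ / x) hxp.le (by positivity)
    ((div_le_one hxp).2 hlt.le)
  rw [div_mul_cancel₀ _ hxp.ne', hx0, Real.zero_rpow (by positivity)] at h1
  linarith

lemma LogConvexTail.convexOn_log (h : LogConvexTail μ) (hpos : ∀ᵐ x ∂μ, 0 < x) :
    ConvexOn ℝ (Set.Ici 0) fun x => Real.log (tail μ x) := by
  refine convexOn_iff_forall_pos.2 ⟨convex_Ici 0, fun x hx y hy a b ha hb hab => ?_⟩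
  have h1 := h x y a b hx hy ha hb hab
  have hp := h.tail_pos hpos
  have h2 := Real.log_le_log (hp _) h1
  rwa [Real.log_mul (Real.rpow_pos_of_pos (hp x) _).ne' (Real.rpow_pos_of_pos (hp y) _).ne',
    Real.log_rpow (hp x), Real.log_rpow (hp y)] at h2

lemma LogConvexTail.pow_le_pow (h : LogConvexTail μ) (hpos : ∀ᵐ x ∂μ, 0 < x) {r m : ℕ}
    (hr : 1 ≤ r) (hrm : r ≤ m) {u : ℝ} (hu : 0 ≤ u) :
    tail μ (u / m) ^ m ≤ tail μ (u / r) ^ r := by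
  have hr0 : (0 : ℝ) < r := by exact_mod_cast hr
  have hm0 : (0 : ℝ) < m := by exact_mod_cast hr.trans hrm
  have h1 := h.le_rpow hpos (x := u / r) (c := r / m) (by positivity) (by positivity)
    ((div_le_one hm0).2 (by exact_mod_cast hrm))
  rw [show (r : ℝ) / m * (u / r) = u / m by field_simp] at h1
  have h2 := pow_le_pow_left₀ (tail_nonneg μ _) h1 m
  rwa [← Real.rpow_mul_natCast (tail_nonneg μ _), div_mul_cancel₀ _ hm0.ne', Real.rpow_natCast]
    at h2

/-- Jensen's inequality for the convex log-tail reduces to equal elapsed times; splitting the same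
total among more copies lowers the product further. -/
lemma LogConvexTail.pow_le_prod (h : LogConvexTail μ) (hpos : ∀ᵐ x ∂μ, 0 < x) {ι : Type*}
    {R : Finset ι} (hR : R.Nonempty) {τ : ι → ℝ} (hτ : ∀ i ∈ R, 0 ≤ τ i) {m : ℕ}
    (hm : R.card ≤ m) :
    tail μ ((∑ i ∈ R, τ i) / m) ^ m ≤ ∏ i ∈ R, tail μ (τ i) := by
  refine (h.pow_le_pow hpos hR.card_pos hm (Finset.sum_nonneg hτ)).trans ?_
  have hc : (0 : ℝ) < R.card := by exact_mod_cast hR.card_pos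
  have hp := h.tail_pos hpos
  have h1 := (h.convexOn_log hpos).map_sum_le (t := R) (w := fun _ => (1 : ℝ) / R.card) (p := τ)
    (fun _ _ => by positivity) (by simp [hc.ne']) hτ
  simp only [smul_eq_mul, ← Finset.mul_sum] at h1
  rw [← Real.log_prod fun i _ => (hp _).ne', one_div_mul_eq_div, one_div_mul_eq_div,
    le_div_iff₀ hc] at h1
  rw [← Real.log_le_log_iff (pow_pos (hp _) _) (Finset.prod_pos fun i _ => hp _), Real.log_pow]
  linarith

/-- Whatever the state, a job with at most `m` copies consumes at least as much on average as `m`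
copies started together would. -/
lemma LogConvexTail.exists_consumption_bound (h : LogConvexTail μ) (hpos : ∀ᵐ x ∂μ, 0 < x)
    {m : ℕ} {v : ℝ}
    (hv : ENNReal.ofReal v < ∫⁻ u in Set.Ioi 0, ENNReal.ofReal (tail μ (u / m) ^ m)) :
    ∃ K : ℝ, 0 < K ∧ ∀ (a b : ℝ) (R : Finset (Fin n)) (f : Fin n → ℝ), 1 ≤ R.card →
      R.card ≤ m → (∀ i, f i ≤ b) → ENNReal.ofReal v + ENNReal.ofReal 0 *
          ∫⁻ x, ENNReal.ofReal (finish a R x f - max a b) ∂(Measure.pi fun _ : Fin n => μ)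
        ≤ ∫⁻ x, ENNReal.ofReal (min (consumption a R x f) K)
          ∂(Measure.pi fun _ : Fin n => μ) := by
  -- Monotone convergence supplies the truncation level; the full integral may be infinite here.
  have hU : Set.Ioi (0 : ℝ) = ⋃ k : ℕ, Set.Ioo (0 : ℝ) (k + 1) := by
    ext x
    simp only [Set.mem_Ioi, Set.mem_iUnion, Set.mem_Ioo]
    constructor
    · intro hx
      obtain ⟨k, hk⟩ := exists_nat_gt x
      exact ⟨k, hx, by linarith⟩
    · rintro ⟨k, hk, -⟩; exact hk
  have hdir : Directed (· ⊆ ·) fun k : ℕ => Set.Ioo (0 : ℝ) (k + 1) :=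
    Monotone.directed_le fun i j hij => Set.Ioo_subset_Ioo_right (by simpa using hij)
  rw [hU, setLIntegral_iUnion_of_directed _ hdir, lt_iSup_iff] at hv
  obtain ⟨k, hk⟩ := hv
  refine ⟨k + 1, by positivity, fun a b R f hR hRm _ => ?_⟩
  rw [ENNReal.ofReal_zero, zero_mul, add_zero,
    lintegral_min_consumption μ a R f (by positivity : (0 : ℝ) ≤ k + 1)]
  refine hk.le.trans (setLIntegral_mono' measurableSet_Ioo fun u hu => ?_)
  have hRne : R.Nonempty := Finset.card_pos.1 hR
  obtain ⟨t, ht, htu⟩ := exists_total_elapsed hRne (fun i => max a (f i)) hu.1.le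
  rw [measure_lt_consumption hpos f ht htu]
  refine ENNReal.ofReal_le_ofReal ?_
  rw [← htu]
  exact h.pow_le_prod hpos hRne (fun _ _ => le_max_right _ _) hRm

/-- Unless the service time is exponential, `m + 1` copies of a job that start together need
strictly less server time than `m` copies. -/
lemma LogConvexTail.lintegral_lt (h : LogConvexTail μ) (hpos : ∀ᵐ x ∂μ, 0 < x)
    (hne : ∀ s : ℝ, 0 < s → μ ≠ expMeasure s) {m : ℕ} (hm : 1 ≤ m)
    (hfin : ∫⁻ u in Set.Ioi 0,
      ENNReal.ofReal (tail μ (u / (m + 1 : ℕ)) ^ (m + 1)) ≠ ∞) :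
    ∫⁻ u in Set.Ioi 0, ENNReal.ofReal (tail μ (u / (m + 1 : ℕ)) ^ (m + 1))
      < ∫⁻ u in Set.Ioi 0, ENNReal.ofReal (tail μ (u / m) ^ m) := by
  by_contra hcon
  rw [not_lt] at hcon
  have hm0 : (0 : ℝ) < m := by exact_mod_cast hm
  have hM0 : (0 : ℝ) < (m + 1 : ℕ) := by positivity
  have hle : ∀ u ∈ Set.Ioi (0 : ℝ), ENNReal.ofReal (tail μ (u / (m + 1 : ℕ)) ^ (m + 1))
      ≤ ENNReal.ofReal (tail μ (u / m) ^ m) := fun u hu =>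
    ENNReal.ofReal_le_ofReal (h.pow_le_pow hpos hm (Nat.le_succ m) (le_of_lt hu))
  have h3 := ae_eq_of_ae_le_of_lintegral_le
    ((ae_restrict_iff' measurableSet_Ioi).2 (ae_of_all _ hle)) hfin (by fun_prop) hcon
  have hcont : ∀ (k : ℕ), 0 < k → ∀ y,
      ContinuousWithinAt (fun u => tail μ (u / k) ^ k) (Set.Ici y) y := by
    intro k hk y
    refine ContinuousWithinAt.pow ((tail_continuousWithinAt μ (y / k)).comp
      (f := fun u : ℝ => u / (k : ℝ)) (continuous_id.div_const _).continuousWithinAt fun z hz => ?_) k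
    simp only [Set.mem_Ici] at hz ⊢
    exact div_le_div_of_nonneg_right hz (by positivity)
  have h4 : ∀ u, 0 ≤ u → tail μ (u / (m + 1 : ℕ)) ^ (m + 1) = tail μ (u / m) ^ m := by
    intro u hu
    refine eq_of_ae_eq_of_rightContinuous (f := fun u => tail μ (u / (m + 1 : ℕ)) ^ (m + 1))
      (g := fun u => tail μ (u / m) ^ m) (hcont (m + 1) (by omega)) (hcont m hm) ?_ hu
    filter_upwards [h3] with y hy
    exact (ENNReal.ofReal_eq_ofReal_iff (pow_nonneg (tail_nonneg μ _) _)
      (pow_nonneg (tail_nonneg μ _) _)).1 hy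
  -- Equality of the powers at `u = (m + 1) x` is the scaling relation with ratio `(m + 1) / m`.
  obtain ⟨s, hs, he⟩ := exists_eq_expMeasure hpos (ρ := (m + 1 : ℕ) / m)
    (by rw [lt_div_iff₀ hm0]; push_cast; linarith)
    (fun x hx => by
      have h5 := h4 ((m + 1 : ℕ) * x) (by positivity)
      rw [mul_div_cancel_left₀ _ hM0.ne'] at h5
      rw [div_mul_eq_mul_div, div_eq_mul_inv ((m + 1 : ℕ) : ℝ), Real.rpow_mul (tail_nonneg μ _),
        Real.rpow_natCast, h5, Real.pow_rpow_inv_natCast (tail_nonneg μ _) (by omega)])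
      (Or.inl (by
      intro x hx y hy hxy
      simp only [Set.mem_Ioi] at hx hy
      simp only
      rw [div_le_div_iff₀ hx hy]
      have h6 := h.le_rpow hpos (x := y) (c := x / y) hy.le (by positivity) ((div_le_one hy).2 hxy)
      rw [div_mul_cancel₀ _ hy.ne'] at h6
      have h7 := Real.log_le_log (h.tail_pos hpos _) h6
      rw [Real.log_rpow (h.tail_pos hpos _), div_mul_eq_mul_div, le_div_iff₀ hy] at h7
      linarith))
  exact hne s hs he

end LogConvex

/-! ### Heavy tails: infinite second moment of the minimum of `n` service times -/

section Potential

/-- Lower bound for the number of late jobs among the next `m` ones when `u` servers are not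
blocked, each copy blocks its server with probability at least `q`, and `m ≤ M`. -/
noncomputable def latePotential (n M : ℕ) (q : ℝ) (u m : ℕ) : ℝ :=
  (1 / (2 * n) : ℝ) ^ u * min 1 (M * q ^ u) * max ((m : ℝ) - u / (2 * n) * M) 0

variable {M : ℕ} {q : ℝ}

lemma latePotential_coeff_nonneg (hq : 0 ≤ q) (u : ℕ) :
    0 ≤ (1 / (2 * n) : ℝ) ^ u * min 1 (M * q ^ u) := by positivity

lemma latePotential_coeff_le_one (hn : 1 ≤ n) (u : ℕ) :
    (1 / (2 * n) : ℝ) ^ u * min 1 (M * q ^ u) ≤ 1 := by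
  have hn' : (1 : ℝ) ≤ n := by exact_mod_cast hn
  have h1 : (1 / (2 * n) : ℝ) ≤ 1 := by rw [div_le_one (by positivity)]; linarith
  exact (mul_le_mul_of_nonneg_left (min_le_left _ _) (by positivity)).trans
    (by rw [mul_one]; exact pow_le_one₀ (by positivity) h1)

lemma latePotential_nonneg (hq : 0 ≤ q) (u m : ℕ) : 0 ≤ latePotential n M q u m :=
  mul_nonneg (latePotential_coeff_nonneg hq u) (le_max_right _ _)

lemma latePotential_zero (u : ℕ) : latePotential n M q u 0 = 0 := by
  have : max (((0 : ℕ) : ℝ) - u / (2 * n) * M) 0 = 0 := max_eq_right (by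
    have : (0 : ℝ) ≤ u / (2 * n) * M := by positivity
    simpa using this)
  rw [latePotential, this, mul_zero]

lemma latePotential_coeff_antitone (hn : 1 ≤ n) (hq : 0 ≤ q) (hq1 : q ≤ 1) {u u' : ℕ}
    (h : u ≤ u') : (1 / (2 * n) : ℝ) ^ u' * min 1 (M * q ^ u')
      ≤ (1 / (2 * n) : ℝ) ^ u * min 1 (M * q ^ u) := by
  have hn' : (1 : ℝ) ≤ n := by exact_mod_cast hn
  have h1 : (1 / (2 * n) : ℝ) ≤ 1 := by rw [div_le_one (by positivity)]; linarith
  refine mul_le_mul (pow_le_pow_of_le_one (by positivity) h1 h)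
    (min_le_min le_rfl (mul_le_mul_of_nonneg_left (pow_le_pow_of_le_one hq hq1 h) (by positivity)))
    (by positivity) (by positivity)

lemma latePotential_antitone (hn : 1 ≤ n) (hq : 0 ≤ q) (hq1 : q ≤ 1) {u u' : ℕ} (h : u ≤ u')
    (m : ℕ) : latePotential n M q u' m ≤ latePotential n M q u m := by
  refine mul_le_mul (latePotential_coeff_antitone hn hq hq1 h) (max_le_max ?_ le_rfl)
    (le_max_right _ _) (latePotential_coeff_nonneg hq u)
  have : (u : ℝ) ≤ u' := by exact_mod_cast h
  gcongr

/-- One-job inequality of dynamic programming. A job with `v` copies at open servers is late with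
probability at least `q ^ v`; then it counts as one late job and closes these `v` servers. -/
lemma latePotential_step (hn : 1 ≤ n) (hM : 1 ≤ M) (hq : 0 ≤ q) (hq1 : q ≤ 1) (u v m : ℕ)
    (hv : v ≤ u) : latePotential n M q u (m + 1) ≤ latePotential n M q u m
      + q ^ v * (1 + latePotential n M q (u - v) m - latePotential n M q u m) := by
  have hn' : (1 : ℝ) ≤ n := by exact_mod_cast hn
  have hM' : (1 : ℝ) ≤ M := by exact_mod_cast hM
  have hanti := latePotential_antitone (M := M) hn hq hq1 (Nat.sub_le u v) m
  have hqv : 0 ≤ q ^ v := pow_nonneg hq v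
  have hc0 := latePotential_coeff_nonneg (n := n) (M := M) hq u
  have hc1 := latePotential_coeff_le_one (M := M) (q := q) hn u
  rcases le_or_gt ((m + 1 : ℕ) : ℝ) (u / (2 * n) * M) with hc | hc
  · have h1 : latePotential n M q u (m + 1) = 0 := by
      rw [latePotential, max_eq_right (by linarith), mul_zero]
    have h2 := latePotential_nonneg (n := n) (M := M) hq u m
    rw [h1]
    nlinarith
  have hstep : latePotential n M q u (m + 1) ≤ latePotential n M q u m
      + (1 / (2 * n) : ℝ) ^ u * min 1 (M * q ^ u) := by
    rw [latePotential, latePotential, ← mul_add_one]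
    refine mul_le_mul_of_nonneg_left ?_ hc0
    push_cast
    grind
  rcases Nat.eq_zero_or_pos v with rfl | hv0
  · simp only [pow_zero, one_mul, Nat.sub_zero]
    linarith
  have hc0' := latePotential_coeff_nonneg (n := n) (M := M) hq (u - v)
  have hc1' := latePotential_coeff_le_one (M := M) (q := q) hn (u - v)
  have hcc := latePotential_coeff_antitone (M := M) hn hq hq1 (Nat.sub_le u v)
  -- Each server closed shortens by `M / (2 n)` the number of jobs written off in the potential, so
  -- a late job gains an amount of order `M`.
  have hgain : (1 / (2 * n) : ℝ) ^ (u - v) * min 1 (M * q ^ (u - v)) * (M / (2 * n))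
      ≤ 1 + latePotential n M q (u - v) m - latePotential n M q u m := by
    have e1 : ((u - v : ℕ) : ℝ) / (2 * n) * M + M / (2 * n) ≤ u / (2 * n) * M := by
      have : ((u - v : ℕ) : ℝ) + 1 ≤ u := by
        have : u - v + 1 ≤ u := by omega
        exact_mod_cast this
      have h3 : (((u - v : ℕ) : ℝ) + 1) * (M / (2 * n)) ≤ u * (M / (2 * n)) := by gcongr
      calc _ = (((u - v : ℕ) : ℝ) + 1) * (M / (2 * n)) := by ring
        _ ≤ u * (M / (2 * n)) := h3
        _ = _ := by ring
    have e2 : latePotential n M q u m ≤ (1 / (2 * n) : ℝ) ^ (u - v) * min 1 (M * q ^ (u - v))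
        * max ((m : ℝ) - u / (2 * n) * M) 0 :=
      mul_le_mul_of_nonneg_right hcc (le_max_right _ _)
    have e3 : (1 / (2 * n) : ℝ) ^ (u - v) * min 1 (M * q ^ (u - v)) * ((m : ℝ) - (u - v : ℕ) / (2 * n) * M)
        ≤ latePotential n M q (u - v) m :=
      mul_le_mul_of_nonneg_left (le_max_left _ _) hc0'
    generalize (1 / (2 * n) : ℝ) ^ (u - v) * min 1 (M * q ^ (u - v)) = κ at *
    push_cast at hc
    have e4 : κ * (M / (2 * n) - 1 + max ((m : ℝ) - u / (2 * n) * M) 0)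
        ≤ κ * ((m : ℝ) - (u - v : ℕ) / (2 * n) * M) := by
      refine mul_le_mul_of_nonneg_left ?_ hc0'
      rcases le_total ((m : ℝ) - u / (2 * n) * M) 0 with h0 | h0
      · rw [max_eq_right h0]; linarith
      · rw [max_eq_left h0]; linarith
    linarith
  -- The gain, weighted by the probability `q ^ v`, pays for one more job. The factor `1 / (2 n)`
  -- per open server in the potential is what makes this exact.
  have hkey : (1 / (2 * n) : ℝ) ^ u * min 1 (M * q ^ u)
      ≤ q ^ v * ((1 / (2 * n) : ℝ) ^ (u - v) * min 1 (M * q ^ (u - v)) * (M / (2 * n))) := by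
    have h1 : (1 / (2 * n) : ℝ) ^ u ≤ (1 / (2 * n) : ℝ) ^ (u - v) * (1 / (2 * n)) := by
      rw [← pow_succ]
      exact pow_le_pow_of_le_one (by positivity)
        (by rw [div_le_one (by positivity)]; linarith) (by omega)
    have h2 : min 1 (M * q ^ u) ≤ q ^ v * M * min 1 (M * q ^ (u - v)) := by
      have hqu : q ^ u = q ^ v * q ^ (u - v) := by rw [← pow_add]; congr 1; omega
      have hqle : q ^ u ≤ q ^ v := pow_le_pow_of_le_one hq hq1 hv
      have hqu0 : 0 ≤ q ^ u := pow_nonneg hq u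
      rw [mul_min_of_nonneg _ _ (by positivity)]
      refine (min_le_right _ _).trans (le_min (by nlinarith) ?_)
      have : q ^ v * M * (M * q ^ (u - v)) = M * (M * q ^ u) := by rw [hqu]; ring
      rw [this]
      nlinarith [mul_nonneg (by linarith : (0 : ℝ) ≤ M) hqu0]
    calc _ ≤ (1 / (2 * n) : ℝ) ^ (u - v) * (1 / (2 * n))
          * (q ^ v * M * min 1 (M * q ^ (u - v))) :=
        mul_le_mul h1 h2 (by positivity) (by positivity)
      _ = _ := by ring
  linarith [mul_le_mul_of_nonneg_left hgain hqv]

/-- Even with all `n` servers open only `n * M / (2 n) = M / 2` jobs of the window are written off.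
-/
lemma le_latePotential (hn : 1 ≤ n) (hq : 0 ≤ q) (hq1 : q ≤ 1) {u : ℕ} (hu : u ≤ n) :
    (1 / (2 * n) : ℝ) ^ n * min 1 (M * q ^ n) * (M / 2) ≤ latePotential n M q u M := by
  refine le_trans ?_ (latePotential_antitone hn hq hq1 hu M)
  refine mul_le_mul_of_nonneg_left ?_ (latePotential_coeff_nonneg hq n)
  have hn' : (0 : ℝ) < n := by exact_mod_cast hn
  have : (M : ℝ) - n / (2 * n) * M = M / 2 := by field_simp; ring
  rw [this]
  exact le_max_left _ _

end Potential

/-! ### Blocking of servers and late jobs in a window -/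

section HeavyTail

variable {r : ℕ} (μ : Measure ℝ) [IsProbabilityMeasure μ] {l : ℝ}

/-- Servers that become free of the jobs before `k` by the time `s` after the arrival of job
`k₀`. -/
noncomputable def openServers (p : Policy n r) (s : ℝ) (k₀ k : ℕ) (w : Path n) : Finset (Fin n) :=
  Finset.univ.filter fun i => freeAt p k w i ≤ arrival k₀ w + s

variable {μ}

lemma mem_openServers {p : Policy n r} {s : ℝ} {k₀ k : ℕ} {w : Path n} {i : Fin n} :
    i ∈ openServers p s k₀ k w ↔ freeAt p k w i ≤ arrival k₀ w + s := by simp [openServers]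

/-- A late job closes exactly the open servers it was sent to; a job that is not late closes none.
-/
lemma card_openServers_succ (p : Policy n r) (s : ℝ) (k₀ k : ℕ) (w : Path n) :
    (openServers p s k₀ (k + 1) w).card = if arrival k₀ w + s < finishAt p k w then
      (openServers p s k₀ k w).card - (p.choice k w ∩ openServers p s k₀ k w).card
      else (openServers p s k₀ k w).card := by
  split_ifs with h
  · rw [← Finset.card_sdiff]
    congr 1; ext i
    simp only [Finset.mem_sdiff, mem_openServers, freeAt_succ]
    split_ifs with hi
    · simp [hi, h]
    · simp [hi]
  · congr 1; ext i
    simp only [mem_openServers, freeAt_succ]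
    by_cases hi : i ∈ p.choice k w
    · simp [hi, not_lt.1 h]
    · simp [hi]

/-- A copy at a closed server cannot meet the deadline, so only the copies at open servers have to
exceed `s`. -/
lemma le_measure_late (hpos : ∀ᵐ x ∂μ, 0 < x) (p : Policy n r) (hr : 1 ≤ r) {s : ℝ}
    {k₀ k : ℕ} {w : Path n} (hA : arrival k₀ w ≤ arrival k w) :
    ENNReal.ofReal (tail μ s ^ (p.choice k w ∩ openServers p s k₀ k w).card)
      ≤ (Measure.pi fun _ : Fin n => μ)
        {x | arrival k₀ w + s < finish (arrival k w) (p.choice k w) x (freeAt p k w)} := by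
  rw [measure_lt_finish μ (p.choice_nonempty hr k w)]
  refine ENNReal.ofReal_le_ofReal ?_
  rw [← Finset.prod_const]
  have : ∏ i ∈ p.choice k w ∩ openServers p s k₀ k w, tail μ s
      = ∏ i ∈ p.choice k w, if i ∈ openServers p s k₀ k w then tail μ s else 1 := by
    rw [Finset.prod_ite_mem]
  rw [this]
  refine Finset.prod_le_prod (fun i _ => by split_ifs <;> simp [tail_nonneg]) fun i _ => ?_
  split_ifs with hi
  · exact tail_antitone μ (by linarith [le_max_left (arrival k w) (freeAt p k w i)])
  · rw [tail_of_nonpos hpos]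
    simp only [mem_openServers, not_le] at hi
    linarith [le_max_right (arrival k w) (freeAt p k w i)]

lemma measurable_card_openServers (p : Policy n r) (s : ℝ) (k₀ k : ℕ) :
    Measurable fun w => (openServers p s k₀ k w).card := by
  have : (fun w => (openServers p s k₀ k w).card)
      = fun w => ∑ i, if freeAt p k w i ≤ arrival k₀ w + s then 1 else 0 := by
    ext w; rw [openServers, Finset.card_filter]
  rw [this]
  refine Finset.measurable_sum _ fun i _ => ?_
  exact Measurable.ite (measurableSet_le (by fun_prop) (by fun_prop)) measurable_const
    measurable_const

lemma openServers_setService (p : Policy n r) (s : ℝ) {k₀ k : ℕ} (x : Fin n → ℝ) (w : Path n) :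
    openServers p s k₀ k (setService k x w) = openServers p s k₀ k w := by
  simp [openServers, freeAt_setService p le_rfl, arrival_setService]

/-- Expected number of late jobs in a window, on an event that depends on the arrivals only. -/
lemma lintegral_latePotential_le (hpos : ∀ᵐ x ∂μ, 0 < x) (hn : 1 ≤ n) (hl : 0 < l)
    (p : Policy n r) (hr : 1 ≤ r)
    {s : ℝ} {M : ℕ} (hM : 1 ≤ M) (k₀ : ℕ) {D : Set (Path n)} (hD : MeasurableSet D)
    (hD2 : ∀ k x w, setService k x w ∈ D ↔ w ∈ D) (m : ℕ) : ∀ k, k₀ ≤ k →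
    ∫⁻ w, D.indicator 1 w * ENNReal.ofReal (latePotential n M (tail μ s)
        (openServers p s k₀ k w).card m) ∂law n μ l
      ≤ ∑ j ∈ Finset.range m,
        law n μ l (D ∩ {w | arrival k₀ w + s < finishAt p (k + j) w}) := by
  induction m with
  | zero => intro k _; simp [latePotential_zero]
  | succ m ih =>
    intro k hk
    have hq := tail_nonneg μ s
    have hq1 := tail_le_one μ s
    set q := tail μ s with hqdef
    have hmL : ∀ k m, Measurable fun w => ENNReal.ofReal (latePotential n M q
        (openServers p s k₀ k w).card m) := fun k m =>
      (measurable_of_countable fun u => ENNReal.ofReal (latePotential n M q u m)).comp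
        (measurable_card_openServers p s k₀ k)
    have hmD : Measurable (D.indicator (1 : Path n → ℝ≥0∞)) := measurable_one.indicator hD
    have hbad : ∀ k, MeasurableSet {w : Path n | arrival k₀ w + s < finishAt p k w} :=
      fun k => measurableSet_lt (by fun_prop) (by fun_prop)
    rw [Finset.sum_range_succ', add_zero]
    have h1 := ih (k + 1) (by omega)
    have h2 : ∑ j ∈ Finset.range m,
        law n μ l (D ∩ {w | arrival k₀ w + s < finishAt p (k + 1 + j) w})
        = ∑ j ∈ Finset.range m,
        law n μ l (D ∩ {w | arrival k₀ w + s < finishAt p (k + (j + 1)) w}) :=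
      Finset.sum_congr rfl fun j _ => by rw [show k + 1 + j = k + (j + 1) by omega]
    rw [h2] at h1
    refine le_trans ?_ (add_le_add_left h1 _)
    rw [← lintegral_indicator_one (hD.inter (hbad k)),
      ← lintegral_add_left (f := fun w => D.indicator 1 w * ENNReal.ofReal (latePotential n M q
        (openServers p s k₀ (k + 1) w).card m)) (hmD.mul (hmL (k + 1) m))]
    set G : Path n → ℝ≥0∞ := fun w => D.indicator 1 w * ENNReal.ofReal (latePotential n M q
        (openServers p s k₀ (k + 1) w).card m)
        + (D ∩ {w | arrival k₀ w + s < finishAt p k w}).indicator 1 w with hG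
    have hmG : Measurable G := (hmD.mul (hmL (k + 1) m)).add
      (measurable_one.indicator (hD.inter (hbad k)))
    rw [lintegral_setService μ hl k hmG]
    refine lintegral_mono_ae ?_
    filter_upwards [ae_gap_pos μ hl] with w hw
    by_cases hwD : w ∈ D
    swap
    · simp [hwD]
    rw [Set.indicator_of_mem hwD, Pi.one_apply, one_mul]
    set u := (openServers p s k₀ k w).card with hu
    set v := (p.choice k w ∩ openServers p s k₀ k w).card with hv
    have hvu : v ≤ u := Finset.card_le_card Finset.inter_subset_right
    set B : Set (Fin n → ℝ) :=
      {x | arrival k₀ w + s < finish (arrival k w) (p.choice k w) x (freeAt p k w)} with hB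
    have hmB : MeasurableSet B := measurableSet_lt measurable_const (by fun_prop)
    have hΔ : 0 ≤ 1 + latePotential n M q (u - v) m - latePotential n M q u m := by
      have := latePotential_antitone (M := M) hn hq hq1 (Nat.sub_le u v) m
      linarith
    -- With all else fixed, `G` depends on the service times of job `k` only through whether the job
    -- is late.
    have hGx : ∀ x, G (setService k x w) = ENNReal.ofReal (latePotential n M q u m)
        + B.indicator (fun _ => ENNReal.ofReal
          (1 + latePotential n M q (u - v) m - latePotential n M q u m)) x := by
      intro x
      simp only [hG, Set.indicator, Set.mem_inter_iff, hD2, hwD, true_and, if_true, Pi.one_apply,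
        one_mul, card_openServers_succ, Set.mem_ofPred_eq, arrival_setService,
        finishAt_setService_self, openServers_setService, p.choice_setService le_rfl, hB,
        ← hu, ← hv]
      split_ifs with hx
      · rw [← ENNReal.ofReal_one, ← ENNReal.ofReal_add (latePotential_nonneg hq _ _) zero_le_one,
          ← ENNReal.ofReal_add (latePotential_nonneg hq _ _) hΔ]
        congr 1; ring
      · rfl
    simp only [hGx]
    rw [lintegral_add_left measurable_const, lintegral_const, measure_univ, mul_one,
      lintegral_indicator_const hmB]
    have hP := le_measure_late hpos p hr (s := s) (k₀ := k₀) (k := k) (w := w) (arrival_mono hw hk)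
    refine le_trans ?_ (add_le_add le_rfl (mul_le_mul_right hP _))
    rw [← ENNReal.ofReal_mul hΔ, ← ENNReal.ofReal_add (latePotential_nonneg hq _ _)
      (mul_nonneg hΔ (pow_nonneg hq _))]
    refine ENNReal.ofReal_le_ofReal ?_
    rw [mul_comm (1 + _ - _)]
    exact latePotential_step hn hM hq hq1 u v m hvu

end HeavyTail

/-! ### From late jobs to infinite latency -/

section HeavyTail

variable {r : ℕ} {μ : Measure ℝ} [IsProbabilityMeasure μ] {l : ℝ}

/-- Markov's inequality: the window has mean length `M / l ≤ t / 2`. -/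
lemma ofReal_half_le_measure_span (hl : 0 < l) (k M : ℕ) {t : ℝ} (ht : 0 < t)
    (hM : (M : ℝ) ≤ l * t / 2) :
    ENNReal.ofReal (1 / 2) ≤ law n μ l {w | arrival (k + M) w - arrival k w ≤ t} := by
  have := isProbabilityMeasure_law (n := n) μ l hl
  set D := {w : Path n | arrival (k + M) w - arrival k w ≤ t} with hD
  have hmD : MeasurableSet D := measurableSet_le (by fun_prop) measurable_const
  have hsum : ∀ (M : ℕ) (w : Path n), arrival (k + M) w - arrival k w
      = ∑ j ∈ Finset.range M, gap (k + 1 + j) w := by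
    intro M w
    induction M with
    | zero => simp
    | succ M ih =>
      rw [Finset.sum_range_succ, ← ih, ← add_assoc, arrival_succ,
        show k + M + 1 = k + 1 + M by omega]
      ring
  have h1 : ∫⁻ w, ENNReal.ofReal (arrival (k + M) w - arrival k w) ∂law n μ l
      = ENNReal.ofReal (M / l) := by
    have h : (fun w : Path n => ENNReal.ofReal (arrival (k + M) w - arrival k w)) =ᵐ[law n μ l]
        fun w => ∑ j ∈ Finset.range M, ENNReal.ofReal (gap (k + 1 + j) w) := by
      filter_upwards [ae_gap_pos μ hl] with w hw
      rw [hsum, ENNReal.ofReal_sum_of_nonneg fun j _ => (hw _).le]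
    rw [lintegral_congr_ae h, lintegral_finsetSum _ fun j _ => by fun_prop]
    simp only [lintegral_gap μ hl, Finset.sum_const, Finset.card_range, nsmul_eq_mul]
    rw [← ENNReal.ofReal_natCast, ← ENNReal.ofReal_mul (by positivity)]
    congr 1; ring
  have h2 : law n μ l Dᶜ ≤ ENNReal.ofReal (1 / 2) := by
    have h3 := mul_meas_ge_le_lintegral₀ (μ := law n μ l)
      (f := fun w => ENNReal.ofReal (arrival (k + M) w - arrival k w)) (by fun_prop)
      (ENNReal.ofReal t)
    rw [h1] at h3
    have h4 : law n μ l Dᶜ ≤ law n μ l {w | ENNReal.ofReal t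
        ≤ ENNReal.ofReal (arrival (k + M) w - arrival k w)} := by
      refine measure_mono fun w hw => ?_
      simp only [hD, Set.mem_compl_iff, Set.mem_ofPred_eq, not_le] at hw ⊢
      exact ENNReal.ofReal_le_ofReal hw.le
    have h5 := (mul_le_mul_right h4 (ENNReal.ofReal t)).trans h3
    have h6 : ENNReal.ofReal (M / l) ≤ ENNReal.ofReal t * ENNReal.ofReal (1 / 2) := by
      rw [← ENNReal.ofReal_mul ht.le]
      refine ENNReal.ofReal_le_ofReal ?_
      rw [div_le_iff₀ hl]; linarith
    exact (ENNReal.mul_le_mul_iff_right (by simpa using ht) ENNReal.ofReal_ne_top).1 (h5.trans h6)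
  have h7 : law n μ l D = 1 - law n μ l Dᶜ := by
    rw [prob_compl_eq_one_sub hmD, ENNReal.sub_sub_cancel ENNReal.one_ne_top prob_le_one]
  rw [h7]
  refine le_trans ?_ (tsub_le_tsub_left h2 1)
  rw [← ENNReal.ofReal_one, ← ENNReal.ofReal_sub _ (by norm_num)]
  norm_num

/-- In every window of `⌊l t / 2⌋` jobs, many have a response time larger than `t`. -/
lemma le_sum_measure_late (hpos : ∀ᵐ x ∂μ, 0 < x) (hn : 1 ≤ n) (hl : 0 < l) (p : Policy n r)
    (hr : 1 ≤ r) {t : ℝ} (ht : 2 / l ≤ t) (k : ℕ) :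
    ENNReal.ofReal ((1 / (2 * n) : ℝ) ^ n / 4 * min 1 (l * t / 4 * tail μ (2 * t) ^ n)
        * ⌊l * t / 2⌋₊)
      ≤ ∑ j ∈ Finset.range ⌊l * t / 2⌋₊,
        law n μ l {w | t < finishAt p (k + j) w - arrival (k + j) w} := by
  have ht0 : 0 < t := lt_of_lt_of_le (by positivity) ht
  rw [div_le_iff₀ hl] at ht
  set M := ⌊l * t / 2⌋₊ with hM
  have hM1 : 1 ≤ M := Nat.one_le_floor_iff _ |>.2 (by linarith)
  have hMle : (M : ℝ) ≤ l * t / 2 := Nat.floor_le (by positivity)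
  have hMge : l * t / 4 ≤ M := by
    have h1 := Nat.lt_floor_add_one (l * t / 2)
    rw [← hM] at h1
    have : (1 : ℝ) ≤ M := by exact_mod_cast hM1
    linarith
  set D := {w : Path n | arrival (k + M) w - arrival k w ≤ t} with hD
  have hmD : MeasurableSet D := measurableSet_le (by fun_prop) measurable_const
  have hPD := ofReal_half_le_measure_span (n := n) (μ := μ) hl k M ht0 hMle
  -- The deadline is `2 t` after the start of the window. As the window lasts at most `t` on `D`,
  -- missing the deadline means a response time above `t`.
  have h1 := lintegral_latePotential_le hpos hn hl p hr (s := 2 * t) hM1 k hmD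
    (fun j x w => by simp [hD, arrival_setService]) M k le_rfl
  set c := (1 / (2 * n) : ℝ) ^ n * min 1 (M * tail μ (2 * t) ^ n) * (M / 2) with hc
  have h2 : ENNReal.ofReal (1 / 2) * ENNReal.ofReal c ≤ ∫⁻ w, D.indicator 1 w * ENNReal.ofReal
      (latePotential n M (tail μ (2 * t)) (openServers p (2 * t) k k w).card M) ∂law n μ l := by
    have h3 : law n μ l D * ENNReal.ofReal c
        = ∫⁻ w, D.indicator 1 w * ENNReal.ofReal c ∂law n μ l := by
      rw [lintegral_mul_const _ (measurable_one.indicator hmD), lintegral_indicator_one hmD]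
    refine (mul_le_mul_left hPD _).trans (h3.trans_le (lintegral_mono fun w => ?_))
    refine mul_le_mul_right (ENNReal.ofReal_le_ofReal ?_) _
    refine le_latePotential hn (tail_nonneg μ _) (tail_le_one μ _) ?_
    exact (Finset.card_le_univ _).trans_eq (Fintype.card_fin n)
  have h4 : ENNReal.ofReal ((1 / (2 * n) : ℝ) ^ n / 4 * min 1 (l * t / 4 * tail μ (2 * t) ^ n) * M)
      ≤ ENNReal.ofReal (1 / 2) * ENNReal.ofReal c := by
    rw [← ENNReal.ofReal_mul (by norm_num)]
    refine ENNReal.ofReal_le_ofReal ?_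
    have h5 : min 1 (l * t / 4 * tail μ (2 * t) ^ n) ≤ min 1 (M * tail μ (2 * t) ^ n) :=
      min_le_min le_rfl (mul_le_mul_of_nonneg_right hMge (pow_nonneg (tail_nonneg μ _) _))
    calc _ ≤ (1 / (2 * n) : ℝ) ^ n / 4 * min 1 (M * tail μ (2 * t) ^ n) * M := by gcongr
      _ = _ := by rw [hc]; ring
  refine (h4.trans h2).trans (h1.trans (Finset.sum_le_sum fun j hj => measure_mono_ae ?_))
  filter_upwards [ae_gap_pos μ hl] with w hw hwD
  obtain ⟨hw1, hw2⟩ := hwD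
  have h6 := arrival_mono hw (show k + j ≤ k + M by have := Finset.mem_range.1 hj; omega)
  change arrival (k + M) w - arrival k w ≤ t at hw1
  change arrival k w + 2 * t < finishAt p (k + j) w at hw2
  change t < finishAt p (k + j) w - arrival (k + j) w
  simp only at h6
  linarith

lemma jobLatency_eq_lintegral_measure (μ : Measure ℝ) (l : ℝ) (p : Policy n r) (j : ℕ) :
    jobLatency μ l p j
      = ∫⁻ t in Set.Ioi 0, law n μ l {w | t < finishAt p j w - arrival j w} := by
  rw [jobLatency_eq]
  have h1 : ∀ w : Path n, ENNReal.ofReal (finishAt p j w - arrival j w)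
      = ENNReal.ofReal (max (finishAt p j w - arrival j w) 0) := by
    intro w; simp [ENNReal.ofReal, Real.toNNReal]
  simp only [h1]
  rw [lintegral_eq_lintegral_meas_lt _ (f := fun w => max (finishAt p j w - arrival j w) 0)
    (ae_of_all _ fun x => le_max_right _ _) (by fun_prop)]
  refine setLIntegral_congr_fun measurableSet_Ioi fun t ht => ?_
  simp only [lt_max_iff, not_lt_of_gt (show (0 : ℝ) < t from ht), or_false]

/-- Cut the jobs into consecutive windows of `M`; the incomplete last window costs a factor `2`. -/
lemma le_liminf_measure_late (hpos : ∀ᵐ x ∂μ, 0 < x) (hn : 1 ≤ n) (hl : 0 < l) (p : Policy n r)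
    (hr : 1 ≤ r) {t : ℝ} (ht : 2 / l ≤ t) :
    ENNReal.ofReal ((1 / (2 * n) : ℝ) ^ n / 8 * min 1 (l * t / 4 * tail μ (2 * t) ^ n))
      ≤ liminf (fun k : ℕ => (∑ j ∈ Finset.range (k + 1),
        law n μ l {w | t < finishAt p j w - arrival j w}) / ((k + 1 : ℕ) : ℝ≥0∞)) atTop := by
  have ht0 : 0 < t := lt_of_lt_of_le (by positivity) ht
  set M := ⌊l * t / 2⌋₊ with hM
  have hM1 : 1 ≤ M := Nat.one_le_floor_iff _ |>.2 (by rw [div_le_iff₀ hl] at ht; linarith)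
  set b := (1 / (2 * n) : ℝ) ^ n / 4 * min 1 (l * t / 4 * tail μ (2 * t) ^ n) with hb
  have hb0 : 0 ≤ b := by
    have := tail_nonneg μ (2 * t)
    positivity
  have hblock : ∀ a : ℕ, ENNReal.ofReal (b * M * a)
      ≤ ∑ j ∈ Finset.range (M * a), law n μ l {w | t < finishAt p j w - arrival j w} := by
    intro a
    induction a with
    | zero => simp
    | succ a ih =>
      rw [Nat.mul_succ, Finset.sum_range_add]
      have h1 := le_sum_measure_late hpos hn hl p hr ht (M * a)
      refine le_trans (le_of_eq ?_) (add_le_add ih h1)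
      rw [← hM, ← hb, ← ENNReal.ofReal_add (by positivity) (by positivity)]
      congr 1; push_cast; ring
  refine le_liminf_of_le (by isBoundedDefault) ?_
  filter_upwards [eventually_ge_atTop M] with k hk
  rw [ENNReal.le_div_iff_mul_le (by simp) (by simp)]
  set a := (k + 1) / M with ha
  have h2 : M * a ≤ k + 1 := Nat.mul_div_le _ _
  have h3 : k + 1 < M * a + M := by
    have := Nat.lt_mul_div_succ (k + 1) hM1
    rw [Nat.mul_succ] at this; exact this
  have h4 : M ≤ M * a := Nat.le_mul_of_pos_right _ (Nat.div_pos (by omega) hM1)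
  have h5 : ((k + 1 : ℕ) : ℝ) ≤ 2 * (M * a) := by
    have : k + 1 ≤ 2 * (M * a) := by omega
    exact_mod_cast this
  calc _ ≤ ENNReal.ofReal (b * M * a) := by
        rw [← ENNReal.ofReal_natCast, ← ENNReal.ofReal_mul (by
          have := tail_nonneg μ (2 * t)
          positivity)]
        refine ENNReal.ofReal_le_ofReal ?_
        have : (1 / (2 * n) : ℝ) ^ n / 8 * min 1 (l * t / 4 * tail μ (2 * t) ^ n) = b / 2 := by
          rw [hb]; ring
        rw [this]
        nlinarith
    _ ≤ _ := hblock a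
    _ ≤ _ := Finset.sum_le_sum_of_subset (Finset.range_subset_range.2 h2)

/-- A fraction of late jobs cannot exceed `1`, so the integrand appears capped. If the capped
integral were finite, the integrand would eventually be bounded, and capping would then change the
integral by a constant factor at most. -/
lemma lintegral_min_eq_top (μ : Measure ℝ) [IsProbabilityMeasure μ] (n : ℕ)
    (h : ∫⁻ t in Set.Ioi 0, ENNReal.ofReal (t * tail μ t ^ n) = ∞) {s₀ : ℝ} (hs₀ : 0 ≤ s₀) :
    ∫⁻ t in Set.Ioi s₀, ENNReal.ofReal (min 1 (t * tail μ t ^ n)) = ∞ := by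
  by_contra hfin
  set I := (∫⁻ t in Set.Ioi s₀, ENNReal.ofReal (min 1 (t * tail μ t ^ n))).toReal with hI
  have hI0 : 0 ≤ I := ENNReal.toReal_nonneg
  have hIeq : ∫⁻ t in Set.Ioi s₀, ENNReal.ofReal (min 1 (t * tail μ t ^ n)) = ENNReal.ofReal I :=
    (ENNReal.ofReal_toReal hfin).symm
  -- If `s * tail μ s ^ n > 2`, monotonicity of the tail makes the capped integrand equal to `1` on
  -- `(s / 2, s)`, which alone contributes `s / 2 > I`.
  have hsmall : ∀ s, 2 * s₀ + 2 * I < s → s * tail μ s ^ n ≤ 2 := by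
    intro s hs
    by_contra hbig
    rw [not_le] at hbig
    have hs0 : 0 < s := by linarith
    have h1 : ENNReal.ofReal (s / 2) ≤ ENNReal.ofReal I := by
      rw [← hIeq]
      have h2 : ∫⁻ _ in Set.Ioo (s / 2) s, (1 : ℝ≥0∞) = ENNReal.ofReal (s / 2) := by
        rw [setLIntegral_one, Real.volume_Ioo]; congr 1; ring
      rw [← h2]
      refine (setLIntegral_mono' measurableSet_Ioo fun x hx => ?_).trans
        (lintegral_mono_set (fun x hx => ?_))
      · rw [← ENNReal.ofReal_one]
        refine ENNReal.ofReal_le_ofReal (le_min le_rfl ?_)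
        have h3 : tail μ s ^ n ≤ tail μ x ^ n :=
          pow_le_pow_left₀ (tail_nonneg μ _) (tail_antitone μ hx.2.le) n
        have h4 := pow_nonneg (tail_nonneg μ s) n
        have h5 := hx.1
        calc 1 ≤ s / 2 * tail μ s ^ n := by linarith
          _ ≤ x * tail μ x ^ n := by
            refine mul_le_mul h5.le h3 h4 (by linarith)
      · have := hx.1
        simp only [Set.mem_Ioi]; linarith
    rw [ENNReal.ofReal_le_ofReal_iff hI0] at h1
    linarith
  set s₁ := 2 * s₀ + 2 * I with hs₁
  have hs₁0 : 0 ≤ s₁ := by positivity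
  refine absurd h (ne_of_lt ?_)
  rw [← Set.Ioc_union_Ioi_eq_Ioi hs₁0]
  refine (lintegral_union_le _ _ _).trans_lt (ENNReal.add_lt_top.2 ⟨?_, ?_⟩)
  · refine lt_of_le_of_lt (setLIntegral_mono' (g := fun _ => ENNReal.ofReal s₁) measurableSet_Ioc
      fun t ht => ENNReal.ofReal_le_ofReal ?_) ?_
    · exact (mul_le_of_le_one_right ht.1.le (pow_le_one₀ (tail_nonneg μ _) (tail_le_one μ _))).trans
        ht.2
    · simp [ENNReal.mul_lt_top]
  · refine lt_of_le_of_lt (setLIntegral_mono' (g := fun t => 2 * ENNReal.ofReal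
      (min 1 (t * tail μ t ^ n))) measurableSet_Ioi fun t ht => ?_) ?_
    · rw [show (2 : ℝ≥0∞) = ENNReal.ofReal 2 by simp, ← ENNReal.ofReal_mul (by norm_num)]
      refine ENNReal.ofReal_le_ofReal ?_
      have := hsmall t ht
      have h0 : 0 ≤ t * tail μ t ^ n :=
        mul_nonneg (hs₁0.trans (le_of_lt ht)) (pow_nonneg (tail_nonneg μ _) _)
      rcases le_total 1 (t * tail μ t ^ n) with h1 | h1
      · rw [min_eq_left h1]; linarith
      · rw [min_eq_right h1]; linarith
    · rw [lintegral_const_mul _ (by fun_prop)]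
      refine ENNReal.mul_lt_top (by simp) (lt_of_le_of_lt (lintegral_mono_set
        (Set.Ioi_subset_Ioi (by linarith : s₀ ≤ s₁))) (lt_top_iff_ne_top.2 hfin))

/-- If the minimum of `n` service times has infinite second moment, every policy has infinite
latency at every arrival rate. -/
theorem lowerLatency_eq_top_of_heavy_tail (hpos : ∀ᵐ x ∂μ, 0 < x) (hn : 1 ≤ n) (hl : 0 < l)
    (h : ∫⁻ t in Set.Ioi 0, ENNReal.ofReal (t * tail μ t ^ n) = ∞) (p : Policy n r)
    (hr : 1 ≤ r) : lowerLatency μ l p = ∞ := by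
  set P := fun (t : ℝ) (j : ℕ) => law n μ l {w | t < finishAt p j w - arrival j w} with hP
  have hPm : ∀ j, Measurable fun t => P t j := by
    intro j
    refine Antitone.measurable fun s t hst => measure_mono fun w hw => ?_
    exact lt_of_le_of_lt hst hw
  have hmean : ∀ k, meanLatency μ l p k = ∫⁻ t in Set.Ioi 0,
      (∑ j ∈ Finset.range (k + 1), P t j) / ((k + 1 : ℕ) : ℝ≥0∞) := by
    intro k
    simp only [meanLatency, jobLatency_eq_lintegral_measure, div_eq_mul_inv]
    rw [lintegral_mul_const _ (Finset.measurable_sum _ fun j _ => hPm j),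
      lintegral_finsetSum _ fun j _ => hPm j]
  refine top_unique ?_
  rw [lowerLatency, funext hmean]
  -- Fatou's lemma in `t` takes the liminf of the averages inside.
  refine le_trans ?_ (lintegral_liminf_le fun k => by
    have := Finset.measurable_sum (Finset.range (k + 1)) fun j _ => hPm j
    exact this.div_const _)
  set c := (1 / (2 * n) : ℝ) ^ n / 8 * min 1 (l / 8) with hc
  have hn' : (0 : ℝ) < n := by exact_mod_cast hn
  have hc0 : 0 < c := by positivity
  have hl2 : 0 < 2 / l := by positivity
  have hsub : Set.Ioi (2 / l) ⊆ Set.Ioi (0 : ℝ) := Set.Ioi_subset_Ioi hl2.le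
  refine le_trans ?_ (lintegral_mono_set hsub)
  have hg : ∀ t ∈ Set.Ioi (2 / l), ENNReal.ofReal c
      * ENNReal.ofReal (min 1 (2 * t * tail μ (2 * t) ^ n))
      ≤ liminf (fun k : ℕ => (∑ j ∈ Finset.range (k + 1), P t j) / ((k + 1 : ℕ) : ℝ≥0∞)) atTop := by
    intro t ht
    refine le_trans ?_ (le_liminf_measure_late hpos hn hl p hr (le_of_lt ht))
    rw [← ENNReal.ofReal_mul hc0.le]
    refine ENNReal.ofReal_le_ofReal ?_
    have ht0 : 0 < t := hl2.trans ht
    have h0 : 0 ≤ 2 * t * tail μ (2 * t) ^ n := by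
      have := tail_nonneg μ (2 * t); positivity
    rw [hc, mul_assoc]
    refine mul_le_mul_of_nonneg_left (le_min ?_ ?_) (by positivity)
    · exact mul_le_one₀ (min_le_left _ _) (by positivity) (min_le_left _ _)
    · calc min 1 (l / 8) * min 1 (2 * t * tail μ (2 * t) ^ n)
          ≤ l / 8 * (2 * t * tail μ (2 * t) ^ n) :=
            mul_le_mul (min_le_right _ _) (min_le_right _ _) (by positivity) (by positivity)
        _ = _ := by ring
  refine le_trans ?_ (setLIntegral_mono' measurableSet_Ioi hg)
  rw [lintegral_const_mul _ (by fun_prop)]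
  have hsubst : ∫⁻ t in Set.Ioi (2 / l), ENNReal.ofReal (min 1 (2 * t * tail μ (2 * t) ^ n)) = ∞ := by
    by_contra hne
    have h2 := lintegral_min_eq_top μ n h (s₀ := 2 * (2 / l)) (by positivity)
    refine absurd h2 ?_
    have h3 := lintegral_comp_div (f := Set.indicator (Set.Ioi (2 / l)) fun t => ENNReal.ofReal
      (min 1 (2 * t * tail μ (2 * t) ^ n))) (Measurable.indicator (by fun_prop) measurableSet_Ioi)
      two_pos
    rw [lintegral_indicator measurableSet_Ioi] at h3
    have h4 : ∀ u : ℝ, Set.indicator (Set.Ioi (2 / l)) (fun t => ENNReal.ofReal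
        (min 1 (2 * t * tail μ (2 * t) ^ n))) (u / 2)
        = Set.indicator (Set.Ioi (2 * (2 / l))) (fun t => ENNReal.ofReal
        (min 1 (t * tail μ t ^ n))) u := by
      intro u
      have : 2 / l < u / 2 ↔ 2 * (2 / l) < u := by constructor <;> intro h <;> linarith
      simp only [Set.indicator, Set.mem_Ioi, this, mul_div_cancel₀ u (two_ne_zero)]
    simp only [h4] at h3
    rw [lintegral_indicator measurableSet_Ioi] at h3
    rw [h3]
    exact ENNReal.mul_ne_top ENNReal.ofReal_ne_top hne
  rw [hsubst, ENNReal.mul_top (by simpa using hc0)]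

end HeavyTail

/-! ### Waiting times -/

section Waiting

variable {r : ℕ}

/-- Time that a copy at server `i` of job `j` would have to wait. -/
noncomputable def waitAt (p : Policy n r) (j : ℕ) (i : Fin n) (w : Path n) : ℝ :=
  max (freeAt p j w i - arrival j w) 0

/-- Time that server `i` spends on job `j`. -/
noncomputable def workAt (p : Policy n r) (j : ℕ) (i : Fin n) (w : Path n) : ℝ :=
  if i ∈ p.choice j w then max (finishAt p j w - max (arrival j w) (freeAt p j w i)) 0 else 0

@[fun_prop] lemma measurable_waitAt (p : Policy n r) (j : ℕ) (i : Fin n) :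
    Measurable (waitAt p j i) := by
  unfold waitAt; fun_prop

@[fun_prop] lemma measurable_workAt (p : Policy n r) (j : ℕ) (i : Fin n) :
    Measurable (workAt p j i) := by
  refine p.measurable_of_choice j (f := fun s w => if i ∈ s then
    max (finishAt p j w - max (arrival j w) (freeAt p j w i)) 0 else 0) fun s => ?_
  split_ifs <;> fun_prop

lemma waitAt_nonneg (p : Policy n r) (j : ℕ) (i : Fin n) (w : Path n) : 0 ≤ waitAt p j i w :=
  le_max_right _ _

lemma workAt_nonneg (p : Policy n r) (j : ℕ) (i : Fin n) (w : Path n) : 0 ≤ workAt p j i w := by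
  unfold workAt; split_ifs
  · exact le_max_right _ _
  · exact le_rfl

lemma waitAt_zero (p : Policy n r) (i : Fin n) {w : Path n} (hw : ∀ k, 0 < gap k w) :
    waitAt p 0 i w = 0 := by
  rw [waitAt, freeAt_zero, max_eq_right]
  linarith [arrival_pos hw 0]

lemma waitAt_succ (p : Policy n r) (j : ℕ) (i : Fin n) {w : Path n} (hw : ∀ k, 0 < gap k w) :
    waitAt p (j + 1) i w = max (waitAt p j i w + workAt p j i w - gap (j + 1) w) 0 := by
  have hg := hw (j + 1)
  rw [waitAt, waitAt, workAt, freeAt_succ, arrival_succ]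
  generalize gap (j + 1) w = g at *
  generalize arrival j w = a
  generalize finishAt p j w = F
  generalize freeAt p j w i = f
  split_ifs <;> grind

lemma waitAt_setGap (p : Policy n r) {j k : ℕ} (h : j < k) (i : Fin n) (g : ℝ) (w : Path n) :
    waitAt p j i (setGap k g w) = waitAt p j i w := by
  rw [waitAt, waitAt, freeAt_setGap p h.le, arrival_setGap_of_lt h]

lemma waitAt_setMark (p : Policy n r) {j k : ℕ} (h : j ≤ k) (i : Fin n)
    (y : (Fin n → ℝ) × unitInterval) (w : Path n) :
    waitAt p j i (setMark k y w) = waitAt p j i w := by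
  rw [waitAt, waitAt, freeAt_setMark p h, arrival_setMark]

lemma waitAt_setService (p : Policy n r) {j k : ℕ} (h : j ≤ k) (i : Fin n)
    (x : Fin n → ℝ) (w : Path n) :
    waitAt p j i (setService k x w) = waitAt p j i w := by
  rw [waitAt, waitAt, freeAt_setService p h, arrival_setService]

end Waiting

/-! ### Mean waiting time of a Lindley recursion -/

section Lindley

/-- With the factor `2 / l` the integrand times the exponential density is the derivative of `-exp
(-l g) * (x - g) ^ 2` on `[0, x]`. -/
lemma lintegral_expMeasure_le {l : ℝ} (hl : 0 < l) {x : ℝ} (hx : 0 ≤ x) :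
    ∫⁻ g, ENNReal.ofReal (max (x - g) 0) ^ 2 + ENNReal.ofReal (2 / l) *
      ENNReal.ofReal (max (x - g) 0) ∂expMeasure l ≤ ENNReal.ofReal x ^ 2 := by
  have h0 : ∀ g, ENNReal.ofReal (max (x - g) 0) ^ 2 + ENNReal.ofReal (2 / l) *
      ENNReal.ofReal (max (x - g) 0)
      = ENNReal.ofReal (max (x - g) 0 ^ 2 + 2 / l * max (x - g) 0) := by
    intro g
    rw [← ENNReal.ofReal_pow (le_max_right _ _), ← ENNReal.ofReal_mul (by positivity),
      ← ENNReal.ofReal_add (by positivity) (by positivity)]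
  simp only [h0]
  have hdens : expMeasure l = volume.withDensity (exponentialPDF l) := rfl
  have hmeas : Measurable (exponentialPDF l) :=
    (measurable_exponentialPDFReal l).ennreal_ofReal
  rw [hdens, lintegral_withDensity_eq_lintegral_mul _ hmeas (by fun_prop)]
  have h1 : ∀ g, (exponentialPDF l * fun g =>
      ENNReal.ofReal (max (x - g) 0 ^ 2 + 2 / l * max (x - g) 0)) g
      ≤ Set.indicator (Set.Icc 0 x) (fun g => ENNReal.ofReal
        (Real.exp (-(l * g)) * (l * (x - g) ^ 2 + 2 * (x - g)))) g := by
    intro g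
    rw [Pi.mul_apply]
    by_cases hg : 0 ≤ g
    · by_cases hgx : g ≤ x
      · rw [Set.indicator_of_mem (show g ∈ Set.Icc 0 x from ⟨hg, hgx⟩),
          exponentialPDF_of_nonneg hg, ← ENNReal.ofReal_mul (by positivity),
          max_eq_left (by linarith)]
        refine ENNReal.ofReal_le_ofReal (le_of_eq ?_)
        field_simp
      · rw [max_eq_right (by linarith)]; simp
    · rw [exponentialPDF_of_neg (not_le.1 hg), zero_mul]; exact zero_le
  refine (lintegral_mono h1).trans ?_
  rw [lintegral_indicator measurableSet_Icc]
  have hcont : Continuous fun g => Real.exp (-(l * g)) * (l * (x - g) ^ 2 + 2 * (x - g)) := by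
    fun_prop
  have hderiv : ∀ g ∈ Set.uIcc 0 x, HasDerivAt (fun g => -(Real.exp (-(l * g)) * (x - g) ^ 2))
      (Real.exp (-(l * g)) * (l * (x - g) ^ 2 + 2 * (x - g))) g := by
    intro g _
    have h1 : HasDerivAt (fun g => Real.exp (-(l * g))) (Real.exp (-(l * g)) * -(l * 1)) g :=
      (((hasDerivAt_id g).const_mul l).neg).exp
    have h2 : HasDerivAt (fun g => (x - g) ^ 2) (2 * (x - g) ^ 1 * -1) g := by
      have := ((hasDerivAt_id g).const_sub x).pow 2
      simpa only [id, Nat.cast_ofNat, Nat.reduceSub] using! this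
    convert! (h1.mul h2).neg using 1
    ring
  have hint := intervalIntegral.integral_eq_sub_of_hasDerivAt hderiv
    (hcont.intervalIntegrable 0 x)
  rw [← ofReal_integral_eq_lintegral_ofReal (hcont.continuousOn.integrableOn_compact
    isCompact_Icc) ((ae_restrict_iff' measurableSet_Icc).2 (ae_of_all _ fun g hg => by
      have : 0 ≤ x - g := by linarith [hg.2]
      positivity)), integral_Icc_eq_integral_Ioc, ← intervalIntegral.integral_of_le hx, hint]
  simp [ENNReal.ofReal_pow hx]

variable (μ : Measure ℝ) [IsProbabilityMeasure μ] {l : ℝ}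

/-- Mean value of a Lindley recursion with Poisson arrivals (Pollaczek–Khinchine bound). -/
theorem sum_lintegral_lindley_le (hl : 0 < l) {W Z : ℕ → Path n → ℝ} (hWm : ∀ j, Measurable (W j))
    (hZm : ∀ j, Measurable (Z j)) (hW0 : ∀ j w, 0 ≤ W j w)
    (hZ0 : ∀ j, ∀ᵐ w ∂law n μ l, 0 ≤ Z j w) (hinit : ∀ᵐ w ∂law n μ l, W 0 w = 0)
    (hrec : ∀ j, ∀ᵐ w ∂law n μ l, W (j + 1) w ≤ max (W j w + Z j w - gap (j + 1) w) 0)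
    (hWg : ∀ j g w, W j (setGap (j + 1) g w) = W j w)
    (hZg : ∀ j g w, Z j (setGap (j + 1) g w) = Z j w) {z₁ z₂ : ℝ} (hz₁ : 0 ≤ z₁) (hz₂ : 0 ≤ z₂)
    (hWZ : ∀ j, ∫⁻ w, ENNReal.ofReal (W j w) * ENNReal.ofReal (Z j w) ∂law n μ l
      ≤ (∫⁻ w, ENNReal.ofReal (W j w) ∂law n μ l) * ENNReal.ofReal z₁)
    (hZ2 : ∀ j, ∫⁻ w, ENNReal.ofReal (Z j w) ^ 2 ∂law n μ l ≤ ENNReal.ofReal z₂)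
    (hlz : l * z₁ < 1) (J : ℕ) :
    ∑ j ∈ Finset.range J, ∫⁻ w, ENNReal.ofReal (W j w) ∂law n μ l
      ≤ J * ENNReal.ofReal (l * z₂ / (2 * (1 - l * z₁))) := by
  have := isProbabilityMeasure_law (n := n) μ l hl
  set a : ℕ → ℝ≥0∞ := fun j => ∫⁻ w, ENNReal.ofReal (W j w) ^ 2 ∂law n μ l with ha
  set b : ℕ → ℝ≥0∞ := fun j => ∫⁻ w, ENNReal.ofReal (W j w) ∂law n μ l with hb
  have hb0 : b 0 = 0 := by
    simp only [hb]
    rw [lintegral_congr_ae (g := fun _ => 0) (hinit.mono fun w hw => by simp [hw])]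
    simp
  have ha0 : a 0 = 0 := by
    simp only [ha]
    rw [lintegral_congr_ae (g := fun _ => 0) (hinit.mono fun w hw => by simp [hw])]
    simp
  -- Drift of the second moment: integrating the gap produces the first moment `b (j + 1)` on the
  -- left, and the square of `W + Z` expands on the right. The telescoped sum then bounds the sum of
  -- the `b j`, since `2 z₁ < 2 / l`.
  have hstep : ∀ j, a (j + 1) + ENNReal.ofReal (2 / l) * b (j + 1)
      ≤ a j + ENNReal.ofReal (2 * z₁) * b j + ENNReal.ofReal z₂ := by
    intro j
    have e1 : a (j + 1) + ENNReal.ofReal (2 / l) * b (j + 1)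
        = ∫⁻ w, ENNReal.ofReal (W (j + 1) w) ^ 2
          + ENNReal.ofReal (2 / l) * ENNReal.ofReal (W (j + 1) w) ∂law n μ l := by
      rw [lintegral_add_left (by fun_prop), lintegral_const_mul _ (by fun_prop)]
    rw [e1]
    have e2 : ∫⁻ w, ENNReal.ofReal (W (j + 1) w) ^ 2
          + ENNReal.ofReal (2 / l) * ENNReal.ofReal (W (j + 1) w) ∂law n μ l
        ≤ ∫⁻ w, ENNReal.ofReal (max (W j w + Z j w - gap (j + 1) w) 0) ^ 2
          + ENNReal.ofReal (2 / l) * ENNReal.ofReal (max (W j w + Z j w - gap (j + 1) w) 0)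
            ∂law n μ l := by
      refine lintegral_mono_ae ((hrec j).mono fun w hw => ?_)
      gcongr
    refine e2.trans ?_
    rw [lintegral_setGap μ hl (j + 1) (by fun_prop)]
    have e3 : ∫⁻ w, ∫⁻ g, ENNReal.ofReal (max (W j (setGap (j + 1) g w) + Z j (setGap (j + 1) g w)
          - gap (j + 1) (setGap (j + 1) g w)) 0) ^ 2 + ENNReal.ofReal (2 / l) * ENNReal.ofReal
          (max (W j (setGap (j + 1) g w) + Z j (setGap (j + 1) g w)
          - gap (j + 1) (setGap (j + 1) g w)) 0) ∂expMeasure l ∂law n μ l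
        ≤ ∫⁻ w, ENNReal.ofReal (W j w + Z j w) ^ 2 ∂law n μ l := by
      refine lintegral_mono_ae ((hZ0 j).mono fun w hw => ?_)
      simp only [hWg, hZg, gap_setGap_self]
      exact lintegral_expMeasure_le hl (add_nonneg (hW0 j w) hw)
    refine e3.trans ?_
    have e4 : ∫⁻ w, ENNReal.ofReal (W j w + Z j w) ^ 2 ∂law n μ l
        = ∫⁻ w, ENNReal.ofReal (W j w) ^ 2 + 2 * (ENNReal.ofReal (W j w) * ENNReal.ofReal (Z j w))
          + ENNReal.ofReal (Z j w) ^ 2 ∂law n μ l := by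
      refine lintegral_congr_ae ((hZ0 j).mono fun w hw => ?_)
      simp only
      rw [ENNReal.ofReal_add (hW0 j w) hw]; ring
    rw [e4, lintegral_add_left (by fun_prop), lintegral_add_left (by fun_prop),
      lintegral_const_mul _ (by fun_prop)]
    refine add_le_add (add_le_add le_rfl ?_) (hZ2 j)
    rw [ENNReal.ofReal_mul zero_le_two, mul_assoc, mul_comm (ENNReal.ofReal z₁)]
    simpa using mul_le_mul_right (hWZ j) 2
  have hba : ∀ j, b j ≤ 1 + a j := by
    intro j
    have : (1 : ℝ≥0∞) = ∫⁻ _, 1 ∂law n μ l := by simp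
    rw [this]
    simp only [ha, hb]
    rw [← lintegral_add_left measurable_const]
    refine lintegral_mono fun w => ?_
    rcases le_total (ENNReal.ofReal (W j w)) 1 with h1 | h1
    · exact h1.trans le_self_add
    · exact (le_self_pow h1 (by norm_num)).trans le_add_self
  have hfin : ∀ j, a j ≠ ∞ := by
    intro j
    induction j with
    | zero => simp [ha0]
    | succ j ih =>
      refine ne_top_of_le_ne_top ?_ (le_self_add.trans (hstep j))
      have hbj : b j ≠ ∞ := ne_top_of_le_ne_top (by simp [ih]) (hba j)
      exact ENNReal.add_ne_top.2 ⟨ENNReal.add_ne_top.2 ⟨ih, 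
        ENNReal.mul_ne_top ENNReal.ofReal_ne_top hbj⟩, ENNReal.ofReal_ne_top⟩
  have hbfin : ∀ j, b j ≠ ∞ := fun j => ne_top_of_le_ne_top (by simp [hfin j]) (hba j)
  have hsum : ∀ J, a J + ENNReal.ofReal (2 / l) * ∑ j ∈ Finset.range J, b (j + 1)
      ≤ ENNReal.ofReal (2 * z₁) * ∑ j ∈ Finset.range J, b j + J * ENNReal.ofReal z₂ := by
    intro J
    induction J with
    | zero => simp [ha0]
    | succ J ih =>
      rw [Finset.sum_range_succ, Finset.sum_range_succ, mul_add, mul_add]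
      calc a (J + 1) + (ENNReal.ofReal (2 / l) * ∑ j ∈ Finset.range J, b (j + 1)
            + ENNReal.ofReal (2 / l) * b (J + 1))
          = (a (J + 1) + ENNReal.ofReal (2 / l) * b (J + 1))
            + ENNReal.ofReal (2 / l) * ∑ j ∈ Finset.range J, b (j + 1) := by ring
        _ ≤ (a J + ENNReal.ofReal (2 * z₁) * b J + ENNReal.ofReal z₂)
            + ENNReal.ofReal (2 / l) * ∑ j ∈ Finset.range J, b (j + 1) :=
            add_le_add (hstep J) le_rfl
        _ = (a J + ENNReal.ofReal (2 / l) * ∑ j ∈ Finset.range J, b (j + 1))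
            + ENNReal.ofReal (2 * z₁) * b J + ENNReal.ofReal z₂ := by ring
        _ ≤ (ENNReal.ofReal (2 * z₁) * ∑ j ∈ Finset.range J, b j + J * ENNReal.ofReal z₂)
            + ENNReal.ofReal (2 * z₁) * b J + ENNReal.ofReal z₂ := by gcongr
        _ = _ := by push_cast; ring
  set B := ∑ j ∈ Finset.range J, b j with hB
  have hBfin : B ≠ ∞ := ENNReal.sum_ne_top.2 fun j _ => hbfin j
  have hBle : B ≤ ∑ j ∈ Finset.range J, b (j + 1) := by
    have h1 := Finset.sum_range_succ b J
    rw [Finset.sum_range_succ' b J, hb0, add_zero] at h1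
    rw [h1]; exact le_self_add
  have hmain : ENNReal.ofReal (2 / l) * B
      ≤ ENNReal.ofReal (2 * z₁) * B + J * ENNReal.ofReal z₂ :=
    (mul_le_mul_right hBle _).trans (le_add_self.trans (hsum J))
  rw [← ENNReal.ofReal_toReal hBfin] at hmain ⊢
  set β := B.toReal with hβ
  have hβ0 : 0 ≤ β := ENNReal.toReal_nonneg
  rw [← ENNReal.ofReal_natCast, ← ENNReal.ofReal_mul (by positivity),
    ← ENNReal.ofReal_mul (by positivity), ← ENNReal.ofReal_mul (by positivity),
    ← ENNReal.ofReal_add (by positivity) (by positivity),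
    ENNReal.ofReal_le_ofReal_iff (by positivity)] at hmain
  rw [← ENNReal.ofReal_natCast, ← ENNReal.ofReal_mul (by positivity)]
  refine ENNReal.ofReal_le_ofReal ?_
  rw [mul_div_assoc', le_div_iff₀ (by linarith)]
  have h5 : 2 / l * β = 2 * β / l := by ring
  rw [h5, div_le_iff₀ hl] at hmain
  nlinarith

end Lindley

/-! ### Moments -/

section Moments

variable {α : Type*} [MeasurableSpace α] (ν : Measure α) {f : α → ℝ}

lemma lintegral_ofReal_eq (hf : Measurable f) :
    ∫⁻ x, ENNReal.ofReal (f x) ∂ν = ∫⁻ t in Set.Ioi 0, ν {x | t < f x} := by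
  have h1 : ∫⁻ x, ENNReal.ofReal (f x) ∂ν = ∫⁻ x, ENNReal.ofReal (max (f x) 0) ∂ν := by
    simp [ENNReal.ofReal, Real.toNNReal]
  rw [h1, lintegral_eq_lintegral_meas_lt ν (f := fun x => max (f x) 0)
    (ae_of_all _ fun x => le_max_right _ _) (by fun_prop)]
  refine setLIntegral_congr_fun measurableSet_Ioi fun t ht => ?_
  simp only [lt_max_iff, not_lt.2 (le_of_lt (Set.mem_Ioi.1 ht)), or_false]

lemma lintegral_ofReal_sq_eq (hf : Measurable f) :
    ∫⁻ x, ENNReal.ofReal (f x) ^ 2 ∂ν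
      = 2 * ∫⁻ t in Set.Ioi 0, ν {x | t < f x} * ENNReal.ofReal t := by
  have h1 : ∫⁻ x, ENNReal.ofReal (f x) ^ 2 ∂ν
      = ∫⁻ x, ENNReal.ofReal (max (f x) 0 ^ (2 : ℝ)) ∂ν := by
    refine lintegral_congr fun x => ?_
    rw [Real.rpow_two, ENNReal.ofReal_pow (le_max_right _ _)]
    simp [ENNReal.ofReal, Real.toNNReal]
  rw [h1, lintegral_rpow_eq_lintegral_meas_lt_mul ν (f := fun x => max (f x) 0)
    (ae_of_all _ fun x => le_max_right _ _) (by fun_prop) zero_lt_two]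
  congr 1
  · simp
  refine setLIntegral_congr_fun measurableSet_Ioi fun t ht => ?_
  simp only [lt_max_iff, not_lt.2 (le_of_lt (Set.mem_Ioi.1 ht)), or_false]
  norm_num

end Moments

/-! ### Latency of forking to all servers -/

lemma upperLatency_le {r : ℕ} {μ : Measure ℝ} {l : ℝ} {p : Policy n r} {C : ℝ≥0∞}
    (h : ∀ J : ℕ, ∑ j ∈ Finset.range J, jobLatency μ l p j ≤ J * C) : upperLatency μ l p ≤ C := by
  refine limsup_le_of_le (by isBoundedDefault) (Eventually.of_forall fun k => ?_)
  rw [meanLatency]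
  refine ENNReal.div_le_of_le_mul ?_
  rw [mul_comm]
  exact h (k + 1)

/-- Smallest of the service times of a job. -/
noncomputable def minService (x : Fin n → ℝ) : ℝ := finish 0 Finset.univ x fun _ => 0

@[fun_prop] lemma measurable_minService : Measurable (minService (n := n)) :=
  measurable_finish _ _ _

section ForkAll

lemma lintegral_comp_service (μ : Measure ℝ) [IsProbabilityMeasure μ] {l : ℝ} (hl : 0 < l) (j : ℕ)
    {f : (Fin n → ℝ) → ℝ≥0∞} (hf : Measurable f) :
    ∫⁻ w, f (service j w) ∂law n μ l = ∫⁻ x, f x ∂(Measure.pi fun _ : Fin n => μ) :=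
  (measurePreserving_service μ hl j).lintegral_comp hf

lemma lintegral_comp_eval (μ : Measure ℝ) [IsProbabilityMeasure μ] (i : Fin n)
    {f : ℝ → ℝ≥0∞} (hf : Measurable f) :
    ∫⁻ x, f (x i) ∂(Measure.pi fun _ : Fin n => μ) = ∫⁻ x, f x ∂μ :=
  (measurePreserving_eval (fun _ : Fin n => μ) i).lintegral_comp hf

lemma minService_le (x : Fin n → ℝ) (i : Fin n) : minService x ≤ x i := by
  simpa [minService] using finish_le (a := 0) (x := x) (f := fun _ => 0) (Finset.mem_univ i)

/-- All servers stay in the same state, so the system is a single queue whose service times are the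
minima. -/
lemma freeAt_forkAll (j : ℕ) (w : Path n) (i k : Fin n) :
    freeAt (forkAll n) j w i = freeAt (forkAll n) j w k := by
  induction j with
  | zero => rfl
  | succ j ih =>
    have h (i : Fin n) : i ∈ (forkAll n).choice j w := Finset.mem_univ i
    rw [freeAt_succ, freeAt_succ, ih, if_pos (h i), if_pos (h k)]

lemma lintegral_tail_pow_lt_top {μ : Measure ℝ} [IsProbabilityMeasure μ]
    (h : ∫⁻ t in Set.Ioi 0, ENNReal.ofReal (t * tail μ t ^ n) ≠ ∞) :
    ∫⁻ t in Set.Ioi 0, ENNReal.ofReal (tail μ t ^ n) ≠ ∞ := by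
  refine ne_top_of_le_ne_top (b := ∫⁻ t in Set.Ioi (0 : ℝ),
    ((Set.Ioc (0 : ℝ) 1).indicator (fun _ => 1) t + ENNReal.ofReal (t * tail μ t ^ n))) ?_ ?_
  · rw [lintegral_add_right _ (by fun_prop)]
    refine ENNReal.add_ne_top.2 ⟨?_, h⟩
    refine ne_top_of_le_ne_top ?_ (setLIntegral_le_lintegral _ _)
    rw [lintegral_indicator measurableSet_Ioc]; simp
  · refine setLIntegral_mono' measurableSet_Ioi fun t ht => ?_
    have h0 : 0 ≤ tail μ t ^ n := pow_nonneg (tail_nonneg μ t) n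
    rcases le_total t 1 with h1 | h1
    · rw [Set.indicator_of_mem (show t ∈ Set.Ioc (0 : ℝ) 1 from ⟨ht, h1⟩)]
      exact le_add_right (ENNReal.ofReal_le_one.2 (pow_le_one₀ (tail_nonneg μ t) (tail_le_one μ t)))
    · refine le_add_left (ENNReal.ofReal_le_ofReal ?_)
      exact le_mul_of_one_le_left h0 h1

variable [NeZero n]

lemma exists_minService_eq (x : Fin n → ℝ) : ∃ i, minService x = x i := by
  obtain ⟨i, -, h⟩ := exists_finish_eq (a := 0) (x := x) (f := fun _ => 0)
    (Finset.univ_nonempty (α := Fin n))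
  exact ⟨i, by simpa [minService] using h⟩

lemma finish_const (a c : ℝ) (x : Fin n → ℝ) :
    finish a Finset.univ x (fun _ => c) = max a c + minService x := by
  obtain ⟨i, hi⟩ := exists_minService_eq x
  obtain ⟨k, -, hk⟩ := exists_finish_eq (a := a) (x := x) (f := fun _ => c)
    (Finset.univ_nonempty (α := Fin n))
  refine le_antisymm ?_ ?_
  · rw [hi]; exact finish_le (f := fun _ => c) (Finset.mem_univ i)
  · rw [hk]; linarith [minService_le x k]

lemma measure_lt_minService (μ : Measure ℝ) [IsProbabilityMeasure μ] (t : ℝ) :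
    (Measure.pi fun _ : Fin n => μ) {x | t < minService x} = ENNReal.ofReal (tail μ t ^ n) := by
  simpa [minService] using measure_lt_finish μ (a := 0) (Finset.univ_nonempty (α := Fin n))
    (fun _ => 0) t

lemma lintegral_minService (μ : Measure ℝ) [IsProbabilityMeasure μ] :
    ∫⁻ x, ENNReal.ofReal (minService x) ∂(Measure.pi fun _ : Fin n => μ)
      = ∫⁻ t in Set.Ioi 0, ENNReal.ofReal (tail μ t ^ n) := by
  rw [lintegral_ofReal_eq _ measurable_minService]
  simp only [measure_lt_minService]

lemma lintegral_minService_sq (μ : Measure ℝ) [IsProbabilityMeasure μ] :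
    ∫⁻ x, ENNReal.ofReal (minService x) ^ 2 ∂(Measure.pi fun _ : Fin n => μ)
      = 2 * ∫⁻ t in Set.Ioi 0, ENNReal.ofReal (t * tail μ t ^ n) := by
  rw [lintegral_ofReal_sq_eq _ measurable_minService]
  congr 1
  refine setLIntegral_congr_fun measurableSet_Ioi fun t ht => ?_
  simp only [measure_lt_minService]
  rw [← ENNReal.ofReal_mul (pow_nonneg (tail_nonneg μ t) n), mul_comm]

lemma finishAt_forkAll (j : ℕ) (w : Path n) (i : Fin n) : finishAt (forkAll n) j w
    = max (arrival j w) (freeAt (forkAll n) j w i) + minService (service j w) := by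
  have : freeAt (forkAll n) j w = fun _ => freeAt (forkAll n) j w i :=
    funext fun k => freeAt_forkAll j w k i
  rw [finishAt, this, ← finish_const]; rfl

lemma responseAt_forkAll (j : ℕ) (w : Path n) (i : Fin n) : finishAt (forkAll n) j w - arrival j w
    = waitAt (forkAll n) j i w + minService (service j w) := by
  rw [finishAt_forkAll j w i, waitAt]
  grind

lemma workAt_forkAll (j : ℕ) (w : Path n) (i : Fin n) :
    workAt (forkAll n) j i w = max (minService (service j w)) 0 := by
  rw [workAt, if_pos (by simp [forkAll]), finishAt_forkAll j w i]
  congr 1; ring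

variable {μ : Measure ℝ} [IsProbabilityMeasure μ] {l : ℝ}

/-- Mean response time of job `j` when jobs are forked to all servers. -/
lemma jobLatency_forkAll (hl : 0 < l) (j : ℕ) (i : Fin n) (hpos : ∀ᵐ x ∂μ, 0 < x) :
    jobLatency μ l (forkAll n) j = (∫⁻ w, ENNReal.ofReal (waitAt (forkAll n) j i w) ∂law n μ l)
      + ∫⁻ t in Set.Ioi 0, ENNReal.ofReal (tail μ t ^ n) := by
  rw [jobLatency_eq, ← lintegral_minService,
    ← lintegral_comp_service μ hl j (measurable_minService.ennreal_ofReal),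
    ← lintegral_add_left (by fun_prop)]
  refine lintegral_congr_ae ?_
  filter_upwards [ae_service_pos μ hl hpos] with w hw
  rw [responseAt_forkAll j w i, ENNReal.ofReal_add (waitAt_nonneg _ _ _ _)]
  obtain ⟨k, hk⟩ := exists_minService_eq (service j w)
  rw [hk]; exact (hw j k).le

theorem upperLatency_forkAll_le (hl : 0 < l) (hpos : ∀ᵐ x ∂μ, 0 < x)
    (h : ∫⁻ t in Set.Ioi 0, ENNReal.ofReal (t * tail μ t ^ n) ≠ ∞)
    (hlm : l * (∫⁻ t in Set.Ioi 0, ENNReal.ofReal (tail μ t ^ n)).toReal < 1) :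
    upperLatency μ l (forkAll n) ≤ (∫⁻ t in Set.Ioi 0, ENNReal.ofReal (tail μ t ^ n))
      + ENNReal.ofReal (l * (2 * (∫⁻ t in Set.Ioi 0, ENNReal.ofReal (t * tail μ t ^ n)).toReal) /
        (2 * (1 - l * (∫⁻ t in Set.Ioi 0, ENNReal.ofReal (tail μ t ^ n)).toReal))) := by
  set m := (∫⁻ t in Set.Ioi 0, ENNReal.ofReal (tail μ t ^ n)).toReal with hm
  have hm' := lintegral_tail_pow_lt_top h
  refine upperLatency_le fun J => ?_
  have i : Fin n := 0
  have hZm : ∀ j, Measurable fun w : Path n => minService (service j w) := by fun_prop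
  have key := sum_lintegral_lindley_le μ hl (W := fun j => waitAt (forkAll n) j i)
    (Z := fun j w => minService (service j w)) (fun j => by fun_prop) hZm
    (fun j w => waitAt_nonneg _ _ _ _) (fun j => ?_) ?_ (fun j => ?_)
    (fun j g w => waitAt_setGap _ (by omega) _ _ _)
    (fun j g w => by simp only [service_setGap]) (z₁ := m)
    (z₂ := 2 * (∫⁻ t in Set.Ioi 0, ENNReal.ofReal (t * tail μ t ^ n)).toReal)
    ENNReal.toReal_nonneg (by positivity) (fun j => ?_) (fun j => ?_) hlm J
  · simp only [jobLatency_forkAll hl _ i hpos]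
    rw [Finset.sum_add_distrib, mul_add, add_comm]
    refine add_le_add ?_ key
    simp
  · filter_upwards [ae_service_pos μ hl hpos] with w hw
    obtain ⟨k, hk⟩ := exists_minService_eq (service j w)
    rw [hk]; exact (hw j k).le
  · filter_upwards [ae_gap_pos μ hl] with w hw using waitAt_zero _ _ hw
  · filter_upwards [ae_gap_pos μ hl, ae_service_pos μ hl hpos] with w hw hs
    have h0 : 0 ≤ minService (service j w) := by
      obtain ⟨k, hk⟩ := exists_minService_eq (service j w)
      rw [hk]; exact (hs j k).le
    rw [waitAt_succ _ _ _ hw, workAt_forkAll, max_eq_left h0]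
  · rw [lintegral_setService μ hl j (by fun_prop)]
    simp only [waitAt_setService _ le_rfl, service_setService_self]
    rw [← lintegral_mul_const _ (by fun_prop)]
    refine lintegral_mono fun w => ?_
    rw [lintegral_const_mul _ (by fun_prop), lintegral_minService, hm, ENNReal.ofReal_toReal hm']
  · rw [lintegral_comp_service μ hl j (f := fun x => ENNReal.ofReal (minService x) ^ 2)
      (by fun_prop), lintegral_minService_sq, ENNReal.ofReal_mul zero_le_two,
      ENNReal.ofReal_toReal h]
    simp

end ForkAll

/-! ### Latency of uniform random single-server dispatching -/

section UniformSingle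

variable {μ : Measure ℝ} [IsProbabilityMeasure μ] {l : ℝ}

lemma finishAt_single (p : Policy n 1) (j : ℕ) (w : Path n) {i : Fin n} (hi : i ∈ p.choice j w) :
    finishAt p j w = max (arrival j w) (freeAt p j w i) + service j w i := by
  obtain ⟨k, hk⟩ := Finset.card_eq_one.1 (p.card_choice j w)
  obtain ⟨k', hk', he⟩ := exists_finish_eq (a := arrival j w) (x := service j w)
    (f := freeAt p j w) ⟨i, hi⟩
  rw [finishAt, he]
  rw [hk, Finset.mem_singleton] at hi hk'
  rw [hi, hk']

lemma workAt_single (p : Policy n 1) (j : ℕ) (w : Path n) (i : Fin n) :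
    workAt p j i w = if i ∈ p.choice j w then max (service j w i) 0 else 0 := by
  rw [workAt]
  split_ifs with hi
  · rw [finishAt_single p j w hi]; congr 1; ring
  · rfl

lemma responseAt_single_le (p : Policy n 1) (j : ℕ) (w : Path n) :
    ENNReal.ofReal (finishAt p j w - arrival j w)
      ≤ ∑ i, (ENNReal.ofReal (waitAt p j i w) + ENNReal.ofReal (service j w i)) := by
  obtain ⟨i, hi⟩ := p.choice_nonempty le_rfl j w
  refine le_trans ?_ (Finset.single_le_sum
    (f := fun i => ENNReal.ofReal (waitAt p j i w) + ENNReal.ofReal (service j w i))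
    (fun _ _ => zero_le) (Finset.mem_univ i))
  refine le_trans (ENNReal.ofReal_le_ofReal ?_) ENNReal.ofReal_add_le
  rw [finishAt_single p j w hi, waitAt]
  grind

variable [NeZero n]

lemma volume_ofNat_floor_le (i : Fin n) :
    (volume : Measure unitInterval) {u | Fin.ofNat n ⌊(n : ℝ) * (u : ℝ)⌋₊ = i}
      ≤ ENNReal.ofReal (1 / n) := by
  have hn : (0 : ℝ) < n := by exact_mod_cast Nat.pos_of_ne_zero (NeZero.ne n)
  -- The seed `1` gives floor `n`, which `Fin.ofNat` wraps around to `0`; this null set is split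
  -- off.
  have hsub : {u : unitInterval | Fin.ofNat n ⌊(n : ℝ) * (u : ℝ)⌋₊ = i}
      ⊆ (Subtype.val ⁻¹' Set.Ico ((i : ℝ) / n) ((i + 1) / n) : Set unitInterval) ∪ {1} := by
    intro u hu
    rcases eq_or_ne u 1 with h1 | h1
    · right; exact h1
    left
    have hu1 : (u : ℝ) < 1 := lt_of_le_of_ne u.2.2 fun h => h1 (Subtype.ext h)
    have hfl : ⌊(n : ℝ) * (u : ℝ)⌋₊ < n := by
      rw [Nat.floor_lt (mul_nonneg hn.le u.2.1)]
      nlinarith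
    have hi : ⌊(n : ℝ) * (u : ℝ)⌋₊ = (i : ℕ) := by
      have := congrArg Fin.val (show Fin.ofNat n ⌊(n : ℝ) * (u : ℝ)⌋₊ = i from hu)
      rwa [Fin.val_ofNat, Nat.mod_eq_of_lt hfl] at this
    rw [Nat.floor_eq_iff (mul_nonneg hn.le u.2.1)] at hi
    constructor
    · rw [div_le_iff₀ hn]; linarith [hi.1]
    · rw [lt_div_iff₀ hn]; linarith [hi.2]
  refine (measure_mono hsub).trans ((measure_union_le _ _).trans ?_)
  have h2 : (volume : Measure unitInterval) (Subtype.val ⁻¹' Set.Ico ((i : ℝ) / n) ((i + 1) / n))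
      ≤ volume (Set.Ico ((i : ℝ) / n) ((i + 1) / n)) := by
    rw [Measure.Subtype.volume_def, (MeasurableEmbedding.subtype_coe measurableSet_Icc).comap_apply]
    exact measure_mono (Set.image_preimage_subset _ _)
  have h3 : (volume : Measure unitInterval) {1} = 0 := by simp
  rw [h3, add_zero]
  refine h2.trans ?_
  rw [Real.volume_Ico]
  refine ENNReal.ofReal_le_ofReal (le_of_eq ?_)
  ring

/-- Each server is a Lindley queue fed by every job, with work zero unless it is chosen, so of mean
at most `m / n`. The response time is bounded by the sum of waiting and service times over all
servers. -/
theorem upperLatency_uniformSingle_lt_top (hl : 0 < l)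
    (h : ∫⁻ x, ENNReal.ofReal x ^ 2 ∂μ ≠ ∞) (h1 : ∫⁻ x, ENNReal.ofReal x ∂μ ≠ ∞)
    (hlm : l * (∫⁻ x, ENNReal.ofReal x ∂μ).toReal < n) :
    upperLatency μ l (uniformSingle n) < ∞ := by
  have := isProbabilityMeasure_law (n := n) μ l hl
  have hn : (0 : ℝ) < n := by exact_mod_cast Nat.pos_of_ne_zero (NeZero.ne n)
  set m := (∫⁻ x, ENNReal.ofReal x ∂μ).toReal with hm
  set p := uniformSingle n with hp
  set C := ENNReal.ofReal (l * (∫⁻ x, ENNReal.ofReal x ^ 2 ∂μ).toReal / (2 * (1 - l * (m / n))))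
  have hW : ∀ (i : Fin n) (J : ℕ),
      ∑ j ∈ Finset.range J, ∫⁻ w, ENNReal.ofReal (waitAt p j i w) ∂law n μ l ≤ J * C := by
    intro i J
    refine sum_lintegral_lindley_le μ hl (W := fun j => waitAt p j i)
      (Z := fun j => workAt p j i) (fun j => by fun_prop) (fun j => by fun_prop)
      (fun j w => waitAt_nonneg _ _ _ _) (fun j => ae_of_all _ (workAt_nonneg _ _ _)) ?_
      (fun j => ?_) (fun j g w => waitAt_setGap _ (by omega) _ _ _) (fun j g w => ?_)
      (by positivity) ENNReal.toReal_nonneg (fun j => ?_) (fun j => ?_) ?_ J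
    · filter_upwards [ae_gap_pos μ hl] with w hw using waitAt_zero _ _ hw
    · filter_upwards [ae_gap_pos μ hl] with w hw
      exact (waitAt_succ _ _ _ hw).le
    · simp only [workAt_single, p.choice_setGap (Nat.lt_succ_self j), service_setGap]
    -- The waiting time found by job `j` does not depend on its seed or its service times, so the
    -- expectation of the product factorizes.
    · rw [lintegral_setMark μ hl j (by fun_prop)]
      rw [← lintegral_mul_const _ (by fun_prop)]
      refine lintegral_mono fun w => ?_
      simp only [waitAt_setMark _ le_rfl]
      have hB : MeasurableSet {u : unitInterval | Fin.ofNat n ⌊(n : ℝ) * (u : ℝ)⌋₊ = i} := by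
        have h2 : Measurable fun u : unitInterval => ⌊(n : ℝ) * (u : ℝ)⌋₊ := by fun_prop
        exact h2 (MeasurableSet.of_discrete (s := {k : ℕ | Fin.ofNat n k = i}))
      have e : ∀ y : (Fin n → ℝ) × unitInterval, ENNReal.ofReal (workAt p j i (setMark j y w))
          = ENNReal.ofReal (y.1 i) * {u : unitInterval | Fin.ofNat n ⌊(n : ℝ) * (u : ℝ)⌋₊ = i}.indicator
            (fun _ => 1) y.2 := by
        intro y
        have hc : p.choice j (setMark j y w) = {Fin.ofNat n ⌊(n : ℝ) * (y.2 : ℝ)⌋₊} := by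
          simp only [hp, uniformSingle, seed_setMark_self]
        simp only [workAt_single, hc, service_setMark_self, Finset.mem_singleton]
        by_cases hi : Fin.ofNat n ⌊(n : ℝ) * (y.2 : ℝ)⌋₊ = i
        · rw [if_pos hi.symm, Set.indicator_of_mem (by exact hi), mul_one]
          simp [ENNReal.ofReal, Real.toNNReal]
        · rw [if_neg (Ne.symm hi), Set.indicator_of_notMem (by exact hi)]
          simp
      simp only [e]
      rw [lintegral_const_mul _ (by fun_prop (disch := exact hB))]
      refine mul_le_mul_right ?_ _
      rw [lintegral_prod_mul (f := fun x : Fin n → ℝ => ENNReal.ofReal (x i))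
        (show Measurable _ by fun_prop).aemeasurable (measurable_const.indicator hB).aemeasurable, lintegral_indicator_const hB, one_mul,
        lintegral_comp_eval μ i (f := fun x => ENNReal.ofReal x) (by fun_prop),
        div_eq_mul_one_div, ENNReal.ofReal_mul ENNReal.toReal_nonneg, ENNReal.ofReal_toReal h1]
      exact mul_le_mul_right (volume_ofNat_floor_le i) _
    · have e : ∀ w, ENNReal.ofReal (workAt p j i w) ^ 2 ≤ ENNReal.ofReal (service j w i) ^ 2 := by
        intro w
        rw [workAt_single]
        split_ifs
        · simp [ENNReal.ofReal, Real.toNNReal]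
        · simp
      refine (lintegral_mono e).trans ?_
      rw [lintegral_comp_service μ hl j (f := fun x => ENNReal.ofReal (x i) ^ 2) (by fun_prop),
        lintegral_comp_eval μ i (f := fun x => ENNReal.ofReal x ^ 2) (by fun_prop),
        ENNReal.ofReal_toReal h]
    · rw [mul_div_assoc', div_lt_one hn]; exact hlm
  have hfin : (n : ℝ≥0∞) * (C + ENNReal.ofReal m) < ∞ :=
    ENNReal.mul_lt_top (by simp) (ENNReal.add_lt_top.2 ⟨ENNReal.ofReal_lt_top,
      ENNReal.ofReal_lt_top⟩)
  refine lt_of_le_of_lt (upperLatency_le fun J => ?_) hfin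
  have e : ∀ j, jobLatency μ l p j ≤ ∑ i, (∫⁻ w, ENNReal.ofReal (waitAt p j i w) ∂law n μ l
      + ENNReal.ofReal m) := by
    intro j
    rw [jobLatency_eq]
    refine (lintegral_mono fun w => responseAt_single_le p j w).trans (le_of_eq ?_)
    rw [lintegral_finsetSum _ fun i _ => by fun_prop]
    refine Finset.sum_congr rfl fun i _ => ?_
    rw [lintegral_add_left (by fun_prop),
      lintegral_comp_service μ hl j (f := fun x => ENNReal.ofReal (x i)) (by fun_prop),
      lintegral_comp_eval μ i (f := fun x => ENNReal.ofReal x) (by fun_prop),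
      ENNReal.ofReal_toReal h1]
  refine (Finset.sum_le_sum fun j _ => e j).trans ?_
  rw [Finset.sum_comm]
  refine (Finset.sum_le_sum (g := fun _ => J * (C + ENNReal.ofReal m)) fun i _ => ?_).trans ?_
  · rw [Finset.sum_add_distrib, mul_add]
    refine add_le_add (hW i J) ?_
    simp
  · rw [Finset.sum_const, Finset.card_univ, Fintype.card_fin, nsmul_eq_mul]
    apply le_of_eq; ring

end UniformSingle

/-! ### Low traffic -/

section LowTraffic

lemma le_lowerLatency {r : ℕ} {μ : Measure ℝ} {l : ℝ} {p : Policy n r} {C : ℝ≥0∞} (h : ∀ j, C ≤ jobLatency μ l p j) :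
    C ≤ lowerLatency μ l p := by
  refine le_liminf_of_le (by isBoundedDefault) (Eventually.of_forall fun k => ?_)
  rw [meanLatency, ENNReal.le_div_iff_mul_le (by simp) (by simp)]
  refine le_trans (le_of_eq ?_) (Finset.sum_le_sum fun j _ => h j)
  simp [mul_comm]

variable {r : ℕ} {μ : Measure ℝ} [IsProbabilityMeasure μ] {l : ℝ}

/-- Waiting can only delay the copies, so the response time dominates the minimum of `r` service
times. -/
lemma le_jobLatency (hl : 0 < l) (hr : 1 ≤ r) (p : Policy n r) (j : ℕ) :
    ∫⁻ t in Set.Ioi 0, ENNReal.ofReal (tail μ t ^ r) ≤ jobLatency μ l p j := by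
  have := isProbabilityMeasure_law (n := n) μ l hl
  rw [jobLatency_eq, lintegral_setService μ hl j (by fun_prop)]
  have h0 : ∫⁻ t in Set.Ioi 0, ENNReal.ofReal (tail μ t ^ r)
      = ∫⁻ _, (∫⁻ t in Set.Ioi 0, ENNReal.ofReal (tail μ t ^ r)) ∂law n μ l := by simp
  rw [h0]
  refine lintegral_mono fun w => ?_
  simp only [finishAt_setService_self, arrival_setService]
  rw [lintegral_ofReal_eq (Measure.pi fun _ : Fin n => μ) (f := fun x =>
    finish (arrival j w) (p.choice j w) x (freeAt p j w) - arrival j w) (by fun_prop)]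
  refine lintegral_mono fun t => ?_
  have e : {x : Fin n → ℝ | t < finish (arrival j w) (p.choice j w) x (freeAt p j w) - arrival j w}
      = {x | arrival j w + t < finish (arrival j w) (p.choice j w) x (freeAt p j w)} := by
    ext x; simp only [Set.mem_ofPred_eq, lt_sub_iff_add_lt']
  rw [e, measure_lt_finish μ (p.choice_nonempty hr j w)]
  have hprod : tail μ t ^ r = ∏ _i ∈ p.choice j w, tail μ t := by
    rw [Finset.prod_const, p.card_choice]
  rw [hprod]
  refine ENNReal.ofReal_le_ofReal (Finset.prod_le_prod (fun i _ => tail_nonneg μ _) fun i _ => ?_)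
  refine tail_antitone μ ?_
  linarith [le_max_left (arrival j w) (freeAt p j w i)]

lemma lintegral_tail_pow_antitone (μ : Measure ℝ) [IsProbabilityMeasure μ] :
    Antitone fun k : ℕ => ∫⁻ t in Set.Ioi 0, ENNReal.ofReal (tail μ t ^ k) := fun _ _ h =>
  lintegral_mono fun t => ENNReal.ofReal_le_ofReal
    (pow_le_pow_of_le_one (tail_nonneg μ t) (tail_le_one μ t) h)

lemma exists_eq_dirac_of_tail (hpos : ∀ᵐ x ∂μ, 0 < x)
    (h : ∀ t, 0 ≤ t → tail μ t = 0 ∨ tail μ t = 1) : ∃ d, μ = Measure.dirac d := by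
  have h' : ∀ t, tail μ t = 0 ∨ tail μ t = 1 := fun t => by
    rcases le_total 0 t with ht | ht
    · exact h t ht
    · exact Or.inr (tail_of_nonpos hpos ht)
  set S := {t | tail μ t = 1} with hS
  have hne : S.Nonempty := ⟨0, tail_of_nonpos hpos le_rfl⟩
  obtain ⟨b, hb⟩ := ((tendsto_tail_atTop μ).eventually
    (gt_mem_nhds (show (0 : ℝ) < 1 by norm_num))).exists
  have hbdd : BddAbove S := ⟨b, fun t ht => by
    by_contra hlt
    have h1 := tail_antitone μ (not_le.1 hlt).le
    rw [ht] at h1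
    linarith⟩
  have hlow : ∀ t, t < sSup S → tail μ t = 1 := fun t ht => by
    obtain ⟨u, hu, htu⟩ := exists_lt_of_lt_csSup hne ht
    have h1 := tail_antitone μ htu.le
    rw [hu] at h1
    exact le_antisymm (tail_le_one μ t) h1
  have hhigh : ∀ t, sSup S < t → tail μ t = 0 := fun t ht =>
    (h' t).resolve_right fun h1 => absurd (le_csSup hbdd h1) (not_le.2 ht)
  have hmid : tail μ (sSup S) = 0 := by
    have h1 := (tail_continuousWithinAt μ (sSup S)).tendsto.mono_left
      (nhdsWithin_mono _ Set.Ioi_subset_Ici_self)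
    refine tendsto_nhds_unique h1 (tendsto_const_nhds.congr' ?_)
    filter_upwards [self_mem_nhdsWithin] with t ht using (hhigh t ht).symm
  refine ⟨sSup S, Measure.eq_of_cdf _ _ ?_⟩
  ext x
  have h1 := tail_eq_one_sub_cdf μ x
  have h2 : (Measure.dirac (sSup S)).real (Set.Iic x) = if sSup S ≤ x then 1 else 0 := by
    rw [measureReal_def, Measure.dirac_apply' _ measurableSet_Iic]
    split_ifs with hx <;> simp [hx]
  rw [cdf_eq_real (Measure.dirac (sSup S)), h2]
  split_ifs with hx
  · rcases hx.lt_or_eq with hx | hx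
    · rw [hhigh x hx] at h1; linarith
    · rw [← hx, hmid] at h1; rw [← hx]; linarith
  · rw [hlow x (not_le.1 hx)] at h1; linarith

/-- Equality would make the tail take only the values `0` and `1`, which characterizes a constant
service time. -/
lemma lintegral_tail_pow_succ_lt (hpos : ∀ᵐ x ∂μ, 0 < x) (hne : ∀ d : ℝ, μ ≠ Measure.dirac d)
    {k : ℕ} (hfin : ∫⁻ t in Set.Ioi 0, ENNReal.ofReal (tail μ t ^ (k + 1)) ≠ ∞) :
    ∫⁻ t in Set.Ioi 0, ENNReal.ofReal (tail μ t ^ (k + 1))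
      < ∫⁻ t in Set.Ioi 0, ENNReal.ofReal (tail μ t ^ k) := by
  refine lt_of_le_of_ne (lintegral_tail_pow_antitone μ (Nat.le_succ k)) fun heq => ?_
  have hle : ∀ t, tail μ t ^ (k + 1) ≤ tail μ t ^ k := fun t =>
    pow_le_pow_of_le_one (tail_nonneg μ t) (tail_le_one μ t) (Nat.le_succ k)
  have hae := ae_eq_of_ae_le_of_lintegral_le (ae_of_all _ fun t =>
    ENNReal.ofReal_le_ofReal (hle t)) hfin (by fun_prop) heq.ge
  have hc : ∀ m : ℕ, ∀ x, ContinuousWithinAt (fun t => tail μ t ^ m) (Set.Ici x) x := fun m x =>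
    (tail_continuousWithinAt μ x).pow m
  have hae' : ∀ᵐ x ∂volume.restrict (Set.Ioi (0 : ℝ)), tail μ x ^ (k + 1) = tail μ x ^ k := by
    filter_upwards [hae] with t ht
    rwa [ENNReal.ofReal_eq_ofReal_iff (pow_nonneg (tail_nonneg μ t) _)
      (pow_nonneg (tail_nonneg μ t) _)] at ht
  obtain ⟨d, hd⟩ := exists_eq_dirac_of_tail hpos fun t ht => by
    have h1 := eq_of_ae_eq_of_rightContinuous (hc (k + 1)) (hc k) hae' ht
    rcases eq_or_ne (tail μ t) 0 with h0 | h0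
    · exact Or.inl h0
    · rw [pow_succ] at h1
      exact Or.inr (mul_eq_left₀ (pow_ne_zero k h0) |>.1 h1)
  exact hne d hd

lemma exists_upperLatency_forkAll_le [NeZero n] (hpos : ∀ᵐ x ∂μ, 0 < x)
    (h : ∫⁻ t in Set.Ioi 0, ENNReal.ofReal (t * tail μ t ^ n) ≠ ∞) {ε : ℝ} (hε : 0 < ε) :
    ∃ l₀ : ℝ, 0 < l₀ ∧ ∀ l : ℝ, 0 < l → l < l₀ → upperLatency μ l (forkAll n)
      ≤ (∫⁻ t in Set.Ioi 0, ENNReal.ofReal (tail μ t ^ n)) + ENNReal.ofReal ε := by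
  set m := (∫⁻ t in Set.Ioi 0, ENNReal.ofReal (tail μ t ^ n)).toReal with hm
  set z := (∫⁻ t in Set.Ioi 0, ENNReal.ofReal (t * tail μ t ^ n)).toReal with hz
  have hm0 : 0 ≤ m := ENNReal.toReal_nonneg
  have hz0 : 0 ≤ z := ENNReal.toReal_nonneg
  -- The first bound gives `l m < 1 / 2`, so the denominator `2 (1 - l m)` exceeds `1`; the second
  -- gives `2 l z < ε`.
  refine ⟨min (1 / (2 * (m + 1))) (ε / (2 * (z + 1))), by positivity, fun l hl hlt => ?_⟩
  have h1 := (lt_div_iff₀ (by positivity)).1 (hlt.trans_le (min_le_left _ _))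
  have h2 := (lt_div_iff₀ (by positivity)).1 (hlt.trans_le (min_le_right _ _))
  have hlm : l * m < 1 / 2 := by nlinarith
  refine (upperLatency_forkAll_le hl hpos h (by rw [← hm]; linarith)).trans ?_
  refine add_le_add le_rfl (ENNReal.ofReal_le_ofReal ?_)
  rw [← hm, ← hz, div_le_iff₀ (by linarith)]
  nlinarith

theorem low_traffic [NeZero n] (hpos : ∀ᵐ x ∂μ, 0 < x) {ε : ℝ} (hε : 0 < ε) :
    ∃ l₀ : ℝ, 0 < l₀ ∧ ∀ l : ℝ, 0 < l → l < l₀ → ∀ r : ℕ, 1 ≤ r → r < n → ∀ p : Policy n r,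
      upperLatency μ l (forkAll n) ≤ lowerLatency μ l p + ENNReal.ofReal ε := by
  have hn : 1 ≤ n := Nat.one_le_iff_ne_zero.2 (NeZero.ne n)
  by_cases h : ∫⁻ t in Set.Ioi 0, ENNReal.ofReal (t * tail μ t ^ n) = ∞
  · refine ⟨1, one_pos, fun l hl _ r hr _ p => ?_⟩
    rw [lowerLatency_eq_top_of_heavy_tail hpos hn hl h p hr]; simp
  · obtain ⟨l₀, hl₀, H⟩ := exists_upperLatency_forkAll_le hpos h hε
    refine ⟨l₀, hl₀, fun l hl hlt r hr hrn p => (H l hl hlt).trans (add_le_add ?_ le_rfl)⟩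
    exact (lintegral_tail_pow_antitone μ hrn.le).trans (le_lowerLatency fun j =>
      le_jobLatency hl hr p j)

theorem low_traffic_of_ne_dirac [NeZero n] (hpos : ∀ᵐ x ∂μ, 0 < x)
    (hne : ∀ d : ℝ, μ ≠ Measure.dirac d) :
    ∃ l₀ : ℝ, 0 < l₀ ∧ ∀ l : ℝ, 0 < l → l < l₀ → ∀ r : ℕ, 1 ≤ r → r < n → ∀ p : Policy n r,
      upperLatency μ l (forkAll n) ≤ lowerLatency μ l p := by
  rcases Nat.lt_or_ge 1 n with hn | hn
  · by_cases h : ∫⁻ t in Set.Ioi 0, ENNReal.ofReal (t * tail μ t ^ n) = ∞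
    · refine ⟨1, one_pos, fun l hl _ r hr _ p => ?_⟩
      rw [lowerLatency_eq_top_of_heavy_tail hpos hn.le hl h p hr]; exact le_top
    · obtain ⟨k, rfl⟩ : ∃ k, n = k + 1 := ⟨n - 1, by omega⟩
      have hfin := lintegral_tail_pow_lt_top h
      have hlt := lintegral_tail_pow_succ_lt hpos hne hfin
      -- The gap between the mean minima of `n - 1` and of `n` service times serves as the error
      -- allowance, uniformly in `r < n`.
      obtain ⟨c, hc0, hc⟩ : ∃ c : ℝ, 0 < c ∧
          (∫⁻ t in Set.Ioi 0, ENNReal.ofReal (tail μ t ^ (k + 1))) + ENNReal.ofReal c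
            ≤ ∫⁻ t in Set.Ioi 0, ENNReal.ofReal (tail μ t ^ k) := by
        obtain ⟨c, hc, hc'⟩ := ENNReal.lt_iff_exists_add_pos_lt.1 hlt
        exact ⟨c, by exact_mod_cast hc, by simpa using hc'.le⟩
      obtain ⟨l₀, hl₀, H⟩ := exists_upperLatency_forkAll_le hpos h hc0
      refine ⟨l₀, hl₀, fun l hl hlt r hr hrn p => (H l hl hlt).trans (hc.trans ?_)⟩
      exact (lintegral_tail_pow_antitone μ (show r ≤ k by omega)).trans (le_lowerLatency fun j =>
        le_jobLatency hl hr p j)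
  · exact ⟨1, one_pos, fun l _ _ r hr hrn => by omega⟩

end LowTraffic

/-! ### High traffic -/

section HighTraffic

variable {μ : Measure ℝ} [IsProbabilityMeasure μ]

lemma le_capacity {r : ℕ} {μ : Measure ℝ} {p : Policy n r} {l : ℝ} (hl : 0 < l)
    (h : upperLatency μ l p < ∞) : ENNReal.ofReal l ≤ capacity μ p :=
  le_iSup₂_of_le l hl (le_iSup_of_le h le_rfl)

lemma lintegral_tail_ne_zero (hpos : ∀ᵐ x ∂μ, 0 < x) (k : ℕ) :
    ∫⁻ u in Set.Ioi 0, ENNReal.ofReal (tail μ u ^ k) ≠ 0 := by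
  obtain ⟨x, hx, hx'⟩ := exists_tail_pos hpos
  refine ((?_ : (0 : ℝ≥0∞) < ENNReal.ofReal (x * tail μ x ^ k)).trans_le ?_).ne'
  · exact ENNReal.ofReal_pos.2 (by positivity)
  · calc ENNReal.ofReal (x * tail μ x ^ k)
        = ∫⁻ _ in Set.Ioc 0 x, ENNReal.ofReal (tail μ x ^ k) := by
          rw [setLIntegral_const, Real.volume_Ioc, sub_zero, ENNReal.ofReal_mul hx.le, mul_comm]
      _ ≤ ∫⁻ u in Set.Ioc 0 x, ENNReal.ofReal (tail μ u ^ k) :=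
          setLIntegral_mono' measurableSet_Ioc fun u hu => ENNReal.ofReal_le_ofReal
            (pow_le_pow_left₀ (tail_nonneg μ x) (tail_antitone μ hu.2) k)
      _ ≤ _ := lintegral_mono_set Set.Ioc_subset_Ioi_self

/-- Beyond the rate `n / m` the instability criterion applies to `r = 1` with `δ = 0`, so the
capacity is at most `n / m`. -/
lemma lt_of_lt_capacity_uniformSingle [NeZero n] (hpos : ∀ᵐ x ∂μ, 0 < x)
    (hfin : ∫⁻ u in Set.Ioi 0, ENNReal.ofReal (tail μ u) ≠ ∞) {l : ℝ}
    (h : ENNReal.ofReal l < capacity μ (uniformSingle n)) :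
    l * (∫⁻ u in Set.Ioi 0, ENNReal.ofReal (tail μ u)).toReal < n := by
  set m := (∫⁻ u in Set.Ioi 0, ENNReal.ofReal (tail μ u)).toReal with hm
  have hm0 : 0 < m := ENNReal.toReal_pos (by simpa using lintegral_tail_ne_zero hpos 1) hfin
  simp only [capacity, lt_iSup_iff] at h
  obtain ⟨l', hl', hup, hlt⟩ := h
  have hll := (ENNReal.ofReal_lt_ofReal_iff hl').1 hlt
  refine lt_of_lt_of_le (mul_lt_mul_of_pos_right hll hm0) ?_
  by_contra hcon
  rw [not_le] at hcon
  obtain ⟨v, hv1, hv2⟩ := exists_between (show (n : ℝ) / l' < m by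
    rw [div_lt_iff₀ hl']; linarith)
  have hv0 : 0 ≤ v := le_trans (by positivity) hv1.le
  obtain ⟨K, hK, H⟩ := exists_truncation_single (n := n) hpos hfin hv0 hv2
  have := lowerLatency_eq_top_of_consumption (r := 1) μ hl' le_rfl zero_le_one hK
    (by rw [div_lt_iff₀ hl'] at hv1; linarith) H (uniformSingle n)
  have hle : lowerLatency μ l' (uniformSingle n) ≤ upperLatency μ l' (uniformSingle n) :=
    liminf_le_limsup
  rw [this, top_le_iff] at hle
  exact hup.ne hle

theorem LogConcaveTail.high_traffic [NeZero n] (h : LogConcaveTail μ) (hpos : ∀ᵐ x ∂μ, 0 < x)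
    (hne : ∀ s : ℝ, 0 < s → μ ≠ expMeasure s) :
    ∃ l₀ : ℝ≥0∞, l₀ < capacity μ (uniformSingle n) ∧ ∀ l : ℝ, 0 < l → l₀ < ENNReal.ofReal l →
      ∀ r : ℕ, 1 < r → r ≤ n → ∀ p : Policy n r,
        (∀ q : Policy n 1, upperLatency μ l q ≤ lowerLatency μ l p) ∧
        (ENNReal.ofReal l < capacity μ (uniformSingle n) →
          upperLatency μ l (uniformSingle n) < lowerLatency μ l p) := by
  have hn : (1 : ℝ) ≤ n := by exact_mod_cast Nat.one_le_iff_ne_zero.2 (NeZero.ne n)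
  have hsq := h.lintegral_sq_lt_top hpos
  have hEX : ∫⁻ x, ENNReal.ofReal x ∂μ ≠ ∞ := (lintegral_lt_top_of_sq hsq).ne
  have hfin : ∫⁻ u in Set.Ioi 0, ENNReal.ofReal (tail μ u) ≠ ∞ := by
    rwa [← lintegral_ofReal_eq_tail]
  have hm00 : ∫⁻ u in Set.Ioi 0, ENNReal.ofReal (tail μ u) ≠ 0 := by
    simpa using lintegral_tail_ne_zero hpos 1
  obtain ⟨δ, hδ0, hδ1, H⟩ := h.exists_consumption_bound hpos (n := n) hne hfin hm00
  set m := (∫⁻ u in Set.Ioi 0, ENNReal.ofReal (tail μ u)).toReal with hm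
  have hm0 : 0 < m := ENNReal.toReal_pos hm00 hfin
  -- Above `(n - δ) / m` every policy with `r ≥ 2` has infinite latency, while uniform random
  -- dispatching is stable up to `n / m`.
  refine ⟨ENNReal.ofReal ((n - δ) / m), ?_, fun l hl hlt r hr hrn p => ?_⟩
  · obtain ⟨l, hl1, hl2⟩ := exists_between (show (n - δ) / m < n / m by gcongr; linarith)
    have hl0 : 0 < l := lt_of_le_of_lt (div_nonneg (by linarith) hm0.le) hl1
    refine lt_of_lt_of_le ((ENNReal.ofReal_lt_ofReal_iff hl0).2 hl1) (le_capacity hl0 ?_)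
    refine upperLatency_uniformSingle_lt_top hl0 hsq.ne hEX ?_
    rw [lintegral_ofReal_eq_tail, ← hm]
    exact (lt_div_iff₀ hm0).1 hl2
  · have hlow : lowerLatency μ l p = ∞ := by
      have h1 := (ENNReal.ofReal_lt_ofReal_iff hl).1 hlt
      have h2 : (n - δ) / l < m := by
        rw [div_lt_iff₀ hm0] at h1
        rw [div_lt_iff₀ hl]; linarith
      obtain ⟨v, hv1, hv2⟩ := exists_between h2
      have hv0 : 0 ≤ v := le_trans (div_nonneg (by linarith) hl.le) hv1.le
      obtain ⟨K, hK, HK⟩ := H v hv0 hv2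
      exact lowerLatency_eq_top_of_consumption μ hl hδ0.le hδ1 hK
        (by rw [div_lt_iff₀ hl] at hv1; linarith) (fun a m R f hR => HK a m R f (hR ▸ hr)) p
    rw [hlow]
    refine ⟨fun q => le_top, fun hcap => ?_⟩
    refine upperLatency_uniformSingle_lt_top hl hsq.ne hEX ?_
    rw [lintegral_ofReal_eq_tail]
    exact lt_of_lt_capacity_uniformSingle hpos hfin hcap

theorem LogConvexTail.high_traffic [NeZero n] (h : LogConvexTail μ) (hpos : ∀ᵐ x ∂μ, 0 < x)
    (hne : ∀ s : ℝ, 0 < s → μ ≠ expMeasure s) :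
    ∃ l₀ : ℝ≥0∞, (l₀ < capacity μ (forkAll n) ∨ l₀ = 0) ∧
      ∀ l : ℝ, 0 < l → l₀ < ENNReal.ofReal l → ∀ r : ℕ, 1 ≤ r → r < n → ∀ p : Policy n r,
        upperLatency μ l (forkAll n) ≤ lowerLatency μ l p := by
  rcases Nat.lt_or_ge 1 n with hn | hn
  swap
  · exact ⟨0, Or.inr rfl, fun l _ _ r hr hrn => by omega⟩
  -- With infinite second moment of the minimum all latencies are infinite, which is why the
  -- threshold `0` is admitted.
  by_cases hY : ∫⁻ t in Set.Ioi 0, ENNReal.ofReal (t * tail μ t ^ n) = ∞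
  · refine ⟨0, Or.inr rfl, fun l hl _ r hr hrn p => ?_⟩
    rw [lowerLatency_eq_top_of_heavy_tail hpos hn.le hl hY p hr]
    exact le_top
  have hfin := lintegral_tail_pow_lt_top hY
  have hn0 : (0 : ℝ) < n := by positivity
  set m := (∫⁻ t in Set.Ioi 0, ENNReal.ofReal (tail μ t ^ n)).toReal with hm
  have hm0 : 0 < m := ENNReal.toReal_pos (lintegral_tail_ne_zero hpos n) hfin
  have hscale : ∫⁻ u in Set.Ioi 0, ENNReal.ofReal (tail μ (u / n) ^ n) = ENNReal.ofReal (n * m) := by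
    rw [setLIntegral_comp_div (f := fun u => ENNReal.ofReal (tail μ u ^ n)) (by fun_prop) hn0,
      ENNReal.ofReal_mul hn0.le, hm, ENNReal.ofReal_toReal hfin]
  have hlt : ENNReal.ofReal (n * m)
      < ∫⁻ u in Set.Ioi 0, ENNReal.ofReal (tail μ (u / (n - 1 : ℕ)) ^ (n - 1)) := by
    rw [← hscale]
    have := h.lintegral_lt hpos hne (m := n - 1) (by omega)
    rw [Nat.sub_add_cancel hn.le] at this
    exact this (by rw [hscale]; exact ENNReal.ofReal_ne_top)
  obtain ⟨v, hv1, hv2⟩ := ENNReal.lt_iff_exists_nnreal_btwn.1 hlt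
  rw [← ENNReal.ofReal_coe_nnreal] at hv1 hv2
  have hv0 : (0 : ℝ) < v := by
    by_contra hcon
    rw [ENNReal.ofReal_of_nonpos (not_lt.1 hcon)] at hv1
    exact not_lt_zero hv1
  rw [ENNReal.ofReal_lt_ofReal_iff hv0] at hv1
  obtain ⟨K, hK, H⟩ := h.exists_consumption_bound (n := n) hpos (m := n - 1) hv2
  -- `v` lies strictly between the mean consumptions of `n` and of `n - 1` copies started together.
  -- Policies with `r < n` are unstable beyond `n / v`, and forking to all servers is stable up to
  -- `1 / m > n / v`.
  refine ⟨ENNReal.ofReal (n / v), Or.inl ?_, fun l hl hll r hr hrn p => ?_⟩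
  · obtain ⟨l, hl1, hl2⟩ := exists_between (show n / (v : ℝ) < 1 / m by
      rw [div_lt_div_iff₀ hv0 hm0]; linarith)
    have hl0 : 0 < l := lt_of_le_of_lt (by positivity) hl1
    refine lt_of_lt_of_le ((ENNReal.ofReal_lt_ofReal_iff hl0).2 hl1) (le_capacity hl0 ?_)
    refine (upperLatency_forkAll_le hl0 hpos hY ((lt_div_iff₀ hm0).1 hl2)).trans_lt ?_
    exact ENNReal.add_lt_top.2 ⟨hfin.lt_top, ENNReal.ofReal_lt_top⟩
  · have hl1 := (ENNReal.ofReal_lt_ofReal_iff hl).1 hll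
    rw [div_lt_iff₀ hv0] at hl1
    rw [lowerLatency_eq_top_of_consumption μ hl le_rfl zero_le_one hK (by linarith)
      (fun a m R f hR => H a m R f (by omega) (by omega)) p]
    exact le_top

end HighTraffic

/-! ### Exponential service times -/

section ExponentialJob

lemma eq_of_tail {μ ν : Measure ℝ} [IsProbabilityMeasure μ] [IsProbabilityMeasure ν]
    (h : ∀ x, tail μ x = tail ν x) : μ = ν := by
  refine Measure.eq_of_cdf _ _ ?_
  ext x
  have h1 := tail_eq_one_sub_cdf μ x
  have h2 := tail_eq_one_sub_cdf ν x
  linarith [h x]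

lemma hasDerivWithinAt_max_sq (c t : ℝ) :
    HasDerivWithinAt (fun t => max t c ^ 2 / 2) (if c ≤ t then t else 0) (Set.Ioi t) t := by
  split_ifs with h
  · have h1 : HasDerivAt (fun t : ℝ => t ^ 2 / 2) t t := by
      have := (hasDerivAt_pow 2 t).div_const 2
      convert! this using 1
      norm_num
    refine h1.hasDerivWithinAt.congr (fun u hu => ?_) ?_
    · rw [max_eq_left (h.trans (le_of_lt hu))]
    · rw [max_eq_left h]
  · refine HasDerivAt.hasDerivWithinAt ((hasDerivAt_const t (c ^ 2 / 2)).congr_of_eventuallyEq ?_)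
    filter_upwards [gt_mem_nhds (not_le.1 h)] with u hu
    rw [max_eq_right hu.le]

lemma hasDerivWithinAt_max_sub (c t : ℝ) :
    HasDerivWithinAt (fun t => max (t - c) 0) (if c ≤ t then 1 else 0) (Set.Ioi t) t := by
  split_ifs with h
  · have h1 : HasDerivAt (fun t : ℝ => t - c) 1 t := (hasDerivAt_id t).sub_const c
    refine h1.hasDerivWithinAt.congr (fun u hu => ?_) ?_
    · rw [max_eq_left (by linarith [Set.mem_Ioi.1 hu])]
    · rw [max_eq_left (by linarith)]
  · refine HasDerivAt.hasDerivWithinAt ((hasDerivAt_const t (0 : ℝ)).congr_of_eventuallyEq ?_)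
    filter_upwards [gt_mem_nhds (not_le.1 h)] with u hu
    rw [max_eq_right (by linarith)]

lemma monotone_ite_le {c : ℝ} (hc : 0 ≤ c) : Monotone fun t => if c ≤ t then t else 0 := by
  intro x y hxy
  simp only
  split_ifs <;> linarith

variable {ι : Type*} (R : Finset ι) {W : ι → ℝ}

lemma intervalIntegrable_sum_ite (hW : ∀ i, 0 ≤ W i) (a b : ℝ) :
    IntervalIntegrable (fun t => ∑ i ∈ R, if W i ≤ t then t else 0) volume a b := by
  have := IntervalIntegrable.sum (μ := volume) (a := a) (b := b) R
    (f := fun i t => if W i ≤ t then t else 0) fun i _ =>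
      (monotone_ite_le (hW i)).intervalIntegrable
  simpa only [Finset.sum_fn] using this

lemma integral_sum_ite (hW : ∀ i, 0 ≤ W i) (T : ℝ) :
    ∫ t in (0 : ℝ)..T, ∑ i ∈ R, (if W i ≤ t then t else 0)
      = ∑ i ∈ R, (max T (W i) ^ 2 - W i ^ 2) / 2 := by
  have h := intervalIntegral.integral_eq_sub_of_hasDeriv_right
    (f := fun t => ∑ i ∈ R, max t (W i) ^ 2 / 2) (f' := fun t => ∑ i ∈ R, if W i ≤ t then t else 0)
    (a := 0) (b := T) (by fun_prop) (fun t _ => HasDerivWithinAt.fun_sum fun i _ =>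
      hasDerivWithinAt_max_sq (W i) t) (intervalIntegrable_sum_ite R hW 0 T)
  rw [h, ← Finset.sum_sub_distrib]
  refine Finset.sum_congr rfl fun i _ => ?_
  rw [max_eq_right (hW i)]; ring

/-- Integration by parts: with `G` the exponential, the right derivative of `t * G t` is `G t` minus
`s` times the integrand on the left. The boundary term is nonnegative, whence the direction of the
inequality. -/
lemma lintegral_mul_exp_le (hW : ∀ i, 0 ≤ W i) {s : ℝ} (hs : 0 < s) :
    ENNReal.ofReal s * ∫⁻ t in Set.Ioi 0, ENNReal.ofReal (Real.exp (-(s * ∑ i ∈ R, max (t - W i) 0)))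
        * ENNReal.ofReal (∑ i ∈ R, if W i ≤ t then t else 0)
      ≤ ∫⁻ t in Set.Ioi 0, ENNReal.ofReal (Real.exp (-(s * ∑ i ∈ R, max (t - W i) 0))) := by
  set G : ℝ → ℝ := fun t => Real.exp (-(s * ∑ i ∈ R, max (t - W i) 0)) with hG
  set g : ℝ → ℝ := fun t => ∑ i ∈ R, if W i ≤ t then t else 0 with hg
  have hGc : Continuous G := by fun_prop
  have hgm : Measurable g := by
    refine Finset.measurable_sum _ fun i _ => (monotone_ite_le (hW i)).measurable
  have hg0 : ∀ t, 0 ≤ g t := fun t => Finset.sum_nonneg fun i _ => by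
    split_ifs with h
    · exact (hW i).trans h
    · exact le_rfl
  have hG0 : ∀ t, 0 ≤ G t := fun t => (Real.exp_pos _).le
  have hGg : Measurable fun t => ENNReal.ofReal (G t) * ENNReal.ofReal (g t) :=
    hGc.measurable.ennreal_ofReal.mul hgm.ennreal_ofReal
  change ENNReal.ofReal s * ∫⁻ t in Set.Ioi 0, ENNReal.ofReal (G t) * ENNReal.ofReal (g t)
    ≤ ∫⁻ t in Set.Ioi 0, ENNReal.ofReal (G t)
  rw [← lintegral_const_mul _ hGg]
  have hU : Set.Ioi (0 : ℝ) = ⋃ b : ℕ, Set.Ioc (0 : ℝ) b := by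
    ext t
    simp only [Set.mem_Ioi, Set.mem_iUnion, Set.mem_Ioc, exists_and_left]
    exact ⟨fun h => ⟨h, exists_nat_ge t⟩, fun h => h.1⟩
  have hdir : Directed (· ⊆ ·) fun b : ℕ => Set.Ioc (0 : ℝ) b :=
    Monotone.directed_le fun b c hbc => Set.Ioc_subset_Ioc_right (by exact_mod_cast hbc)
  conv_lhs => rw [hU]
  rw [setLIntegral_iUnion_of_directed _ hdir]
  refine iSup_le fun b => le_trans ?_ (lintegral_mono_set (Set.Ioc_subset_Ioi_self :
    Set.Ioc (0 : ℝ) b ⊆ Set.Ioi 0))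
  have hb : (0 : ℝ) ≤ b := by positivity
  have hi1 : IntervalIntegrable (fun t => s * (g t * G t)) volume 0 b :=
    ((intervalIntegrable_sum_ite R hW 0 b).mul_continuousOn hGc.continuousOn).const_mul s
  have hi2 : IntervalIntegrable G volume 0 b := hGc.intervalIntegrable _ _
  have key : ∫ t in (0 : ℝ)..b, (G t - s * (g t * G t)) = b * G b - 0 * G 0 := by
    refine intervalIntegral.integral_eq_sub_of_hasDeriv_right (f := fun t => t * G t)
      (by fun_prop) (fun t _ => ?_) (hi2.sub hi1)
    have h1 : HasDerivWithinAt (fun t => ∑ i ∈ R, max (t - W i) 0)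
        (∑ i ∈ R, if W i ≤ t then 1 else 0) (Set.Ioi t) t :=
      HasDerivWithinAt.fun_sum fun i _ => hasDerivWithinAt_max_sub (W i) t
    have h2 := (hasDerivWithinAt_id t (Set.Ioi t)).mul ((h1.const_mul s).neg.exp)
    convert! h2 using 1
    simp only [hG, hg, id, one_mul, Pi.neg_apply]
    have : (∑ i ∈ R, if W i ≤ t then t else 0) = t * ∑ i ∈ R, if W i ≤ t then (1 : ℝ) else 0 := by
      rw [Finset.mul_sum]
      exact Finset.sum_congr rfl fun i _ => by split_ifs <;> simp
    rw [this]; ring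
  rw [intervalIntegral.integral_sub hi2 hi1] at key
  have hle : ∫ t in (0 : ℝ)..b, s * (g t * G t) ≤ ∫ t in (0 : ℝ)..b, G t := by
    have : 0 ≤ (b : ℝ) * G b := mul_nonneg hb (hG0 b)
    linarith
  rw [intervalIntegral.integral_of_le hb, intervalIntegral.integral_of_le hb] at hle
  have e1 : ∫⁻ t in Set.Ioc 0 (b : ℝ), ENNReal.ofReal s * (ENNReal.ofReal (G t) * ENNReal.ofReal (g t))
      = ENNReal.ofReal (∫ t in Set.Ioc 0 (b : ℝ), s * (g t * G t)) := by
    rw [ofReal_integral_eq_lintegral_ofReal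
      ((intervalIntegrable_iff_integrableOn_Ioc_of_le hb).1 hi1)
      (ae_of_all _ fun t => mul_nonneg hs.le (mul_nonneg (hg0 t) (hG0 t)))]
    refine lintegral_congr fun t => ?_
    rw [ENNReal.ofReal_mul hs.le, ENNReal.ofReal_mul (hg0 t), mul_comm (ENNReal.ofReal (G t))]
  rw [e1, ← ofReal_integral_eq_lintegral_ofReal
    ((intervalIntegrable_iff_integrableOn_Ioc_of_le hb).1 hi2) (ae_of_all _ fun t => hG0 t)]
  exact ENNReal.ofReal_le_ofReal hle

end ExponentialJob

/-! ### Response time and consumption of one job with exponential service times -/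

section ExponentialConsumption

variable {s : ℝ}

lemma prod_tail_expMeasure (hs : 0 < s) (R : Finset (Fin n)) (x : Fin n → ℝ) :
    ∏ i ∈ R, tail (expMeasure s) (x i) = Real.exp (-(s * ∑ i ∈ R, max (x i) 0)) := by
  have := isProbabilityMeasure_expMeasure hs
  rw [Finset.mul_sum, ← Finset.sum_neg_distrib, Real.exp_sum]
  refine Finset.prod_congr rfl fun i _ => ?_
  rw [← tail_max_zero (ae_pos_expMeasure hs), tail_expMeasure hs (le_max_right _ _)]

/-- Lower bound for the mean response time of a job by the growth of the squared workloads. -/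
lemma lintegral_sq_le_lintegral_finish (hs : 0 < s) (a : ℝ) {R : Finset (Fin n)} (hR : R.Nonempty)
    (f : Fin n → ℝ) :
    ENNReal.ofReal s * ∫⁻ x, ENNReal.ofReal (∑ i ∈ R,
        (max (finish a R x f - a) (max a (f i) - a) ^ 2 - (max a (f i) - a) ^ 2) / 2)
          ∂(Measure.pi fun _ : Fin n => expMeasure s)
      ≤ ∫⁻ x, ENNReal.ofReal (finish a R x f - a) ∂(Measure.pi fun _ : Fin n => expMeasure s) := by
  have := isProbabilityMeasure_expMeasure hs
  set W : Fin n → ℝ := fun i => max a (f i) - a with hWdef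
  have hW : ∀ i, 0 ≤ W i := fun i => sub_nonneg.2 (le_max_left _ _)
  set P := Measure.pi fun _ : Fin n => expMeasure s with hP
  have hlaw : ∀ t, P {x | t < finish a R x f - a}
      = ENNReal.ofReal (Real.exp (-(s * ∑ i ∈ R, max (t - W i) 0))) := by
    intro t
    have e : {x : Fin n → ℝ | t < finish a R x f - a} = {x | a + t < finish a R x f} := by
      ext x; simp only [Set.mem_ofPred_eq, lt_sub_iff_add_lt']
    rw [e, measure_lt_finish _ hR, prod_tail_expMeasure hs]
    congr 5
    ext i
    simp only [hWdef]
    congr 1; ring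
  -- The growth of the squares is written as an integral up to the response time, so that the
  -- layer-cake formula brings in the tail of the response time.
  have e1 : ∀ x, ENNReal.ofReal (∑ i ∈ R, (max (finish a R x f - a) (W i) ^ 2 - W i ^ 2) / 2)
      = ENNReal.ofReal (∫ t in (0 : ℝ)..max (finish a R x f - a) 0,
        ∑ i ∈ R, if W i ≤ t then t else 0) := by
    intro x
    rw [integral_sum_ite R hW]
    congr 1
    refine Finset.sum_congr rfl fun i _ => ?_
    rw [max_assoc, max_eq_right (hW i)]
  rw [lintegral_congr e1]
  have h := lintegral_comp_eq_lintegral_meas_lt_mul P (f := fun x => max (finish a R x f - a) 0)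
    (g := fun t => ∑ i ∈ R, if W i ≤ t then t else 0)
    (ae_of_all _ fun x => le_max_right _ _) (by fun_prop)
    (fun t _ => intervalIntegrable_sum_ite R hW 0 t)
    (ae_of_all _ fun t => Finset.sum_nonneg fun i _ => by
      split_ifs with h
      · exact (hW i).trans h
      · exact le_rfl)
  rw [h, lintegral_ofReal_eq P (f := fun x => finish a R x f - a) (by fun_prop)]
  have e2 : ∀ t ∈ Set.Ioi (0 : ℝ), P {x | t < max (finish a R x f - a) 0}
        * ENNReal.ofReal (∑ i ∈ R, if W i ≤ t then t else 0)
      = ENNReal.ofReal (Real.exp (-(s * ∑ i ∈ R, max (t - W i) 0)))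
        * ENNReal.ofReal (∑ i ∈ R, if W i ≤ t then t else 0) := by
    intro t ht
    simp only [lt_max_iff, not_lt.2 (le_of_lt (Set.mem_Ioi.1 ht)), or_false, hlaw]
  rw [setLIntegral_congr_fun measurableSet_Ioi e2]
  simp only [hlaw]
  exact lintegral_mul_exp_le R hW hs

/-- The time that the servers spend on a job is exponential, whatever the state of the system. -/
lemma map_consumption_expMeasure [NeZero n] (hs : 0 < s) (a : ℝ) {R : Finset (Fin n)}
    (hR : R.Nonempty) (f : Fin n → ℝ) :
    (Measure.pi fun _ : Fin n => expMeasure s).map (fun x => consumption a R x f / n)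
      = (Measure.pi fun _ : Fin n => expMeasure s).map minService := by
  have := isProbabilityMeasure_expMeasure hs
  have hn : (0 : ℝ) < n := by exact_mod_cast Nat.pos_of_ne_zero (NeZero.ne n)
  have hpos := ae_pos_expMeasure hs
  have hm1 : Measurable fun x : Fin n → ℝ => consumption a R x f / n := by fun_prop
  have := Measure.isProbabilityMeasure_map (μ := Measure.pi fun _ : Fin n => expMeasure s)
    hm1.aemeasurable
  have := Measure.isProbabilityMeasure_map (μ := Measure.pi fun _ : Fin n => expMeasure s)
    (measurable_minService (n := n)).aemeasurable
  refine eq_of_tail fun u => ?_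
  rw [tail, tail, measureReal_def, measureReal_def, Measure.map_apply hm1 measurableSet_Ioi,
    Measure.map_apply measurable_minService measurableSet_Ioi]
  congr 1
  have e2 : (Measure.pi fun _ : Fin n => expMeasure s) (minService ⁻¹' Set.Ioi u)
      = ENNReal.ofReal (tail (expMeasure s) u ^ n) := measure_lt_minService _ u
  rw [e2]
  have e1 : (fun x : Fin n → ℝ => consumption a R x f / n) ⁻¹' Set.Ioi u
      = {x | n * u < consumption a R x f} := by
    ext x
    simp only [Set.mem_preimage, Set.mem_Ioi, Set.mem_ofPred_eq, lt_div_iff₀ hn, mul_comm]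
  rw [e1]
  rcases lt_or_ge u 0 with hu | hu
  · have : {x : Fin n → ℝ | n * u < consumption a R x f} = Set.univ := by
      ext x
      simp only [Set.mem_ofPred_eq, Set.mem_univ, iff_true]
      exact (mul_neg_of_pos_of_neg hn hu).trans_le consumption_nonneg
    rw [this, measure_univ, tail_of_nonpos hpos hu.le]; simp
  · obtain ⟨t, ht, htu⟩ := exists_total_elapsed hR (fun i => max a (f i))
      (mul_nonneg hn.le hu)
    -- The product of exponential tails depends only on the total elapsed time `n * u`, and neither
    -- on the state nor on the number of copies.
    rw [measure_lt_consumption hpos f ht htu, prod_tail_expMeasure hs, tail_expMeasure hs hu,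
      ← Real.exp_nat_mul]
    congr 2
    simp only [max_eq_left (le_max_right _ (0 : ℝ)), htu]
    ring

lemma lintegral_consumption_eq [NeZero n] (hs : 0 < s) (a : ℝ) {R : Finset (Fin n)}
    (hR : R.Nonempty) (f : Fin n → ℝ) {Φ : ℝ → ℝ≥0∞} (hΦ : Measurable Φ) :
    ∫⁻ x, Φ (consumption a R x f / n) ∂(Measure.pi fun _ : Fin n => expMeasure s)
      = ∫⁻ x, Φ (minService x) ∂(Measure.pi fun _ : Fin n => expMeasure s) := by
  rw [← lintegral_map hΦ (by fun_prop), map_consumption_expMeasure hs a hR f,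
    lintegral_map hΦ measurable_minService]

lemma lintegral_minService_expMeasure [NeZero n] (hs : 0 < s) :
    ∫⁻ x, ENNReal.ofReal (minService x) ∂(Measure.pi fun _ : Fin n => expMeasure s)
      = ENNReal.ofReal (1 / (s * n)) := by
  have := isProbabilityMeasure_expMeasure hs
  have hn : (0 : ℝ) < n := by exact_mod_cast Nat.pos_of_ne_zero (NeZero.ne n)
  have e : ∀ t ∈ Set.Ioi (0 : ℝ), ENNReal.ofReal (tail (expMeasure s) t ^ n)
      = ENNReal.ofReal (Real.exp (-(s * n) * t)) := by
    intro t ht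
    rw [tail_expMeasure hs (le_of_lt ht), ← Real.exp_nat_mul]
    congr 2; ring
  have hneg : -(s * n) < 0 := by linarith [mul_pos hs hn]
  rw [lintegral_minService, setLIntegral_congr_fun measurableSet_Ioi e,
    ← ofReal_integral_eq_lintegral_ofReal (integrableOn_exp_mul_Ioi hneg 0)
    (ae_of_all _ fun x => (Real.exp_pos _).le), integral_exp_mul_Ioi hneg]
  congr 1
  simp [neg_div_neg_eq]

lemma lintegral_minService_sq_expMeasure [NeZero n] (hs : 0 < s) :
    ∫⁻ x, ENNReal.ofReal (minService x) ^ 2 ∂(Measure.pi fun _ : Fin n => expMeasure s)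
      = 2 * ENNReal.ofReal ((1 / (s * n)) ^ 2) := by
  have := isProbabilityMeasure_expMeasure hs
  have hn : (0 : ℝ) < n := by exact_mod_cast Nat.pos_of_ne_zero (NeZero.ne n)
  have hsn : 0 < s * n := mul_pos hs hn
  have e : ∀ t ∈ Set.Ioi (0 : ℝ), ENNReal.ofReal (t * tail (expMeasure s) t ^ n)
      = ENNReal.ofReal (t ^ ((2 : ℝ) - 1) * Real.exp (-((s * n) * t))) := by
    intro t ht
    rw [tail_expMeasure hs (le_of_lt ht), ← Real.exp_nat_mul]
    norm_num
    congr 3; ring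
  rw [lintegral_minService_sq, setLIntegral_congr_fun measurableSet_Ioi e,
    ← ofReal_integral_eq_lintegral_ofReal, Real.integral_rpow_mul_exp_neg_mul_Ioi zero_lt_two hsn]
  · congr 2
    have : Real.Gamma 2 = 1 := Real.Gamma_two
    rw [this, mul_one, Real.rpow_two]
  · have := integrableOn_rpow_mul_exp_neg_mul_rpow (p := 1) (s := 1) (b := s * n)
      (by norm_num) one_pos hsn
    refine this.congr_fun (fun t _ => ?_) measurableSet_Ioi
    norm_num
  · refine (ae_restrict_iff' measurableSet_Ioi).2 (ae_of_all _ fun t ht => ?_)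
    have : (0 : ℝ) < t := ht
    positivity

end ExponentialConsumption

/-! ### Comparison of workloads with a Lindley recursion -/

section Comparison

/-- Waiting times in a queue with interarrival times `g` and service times `z`. -/
noncomputable def lindley (g z : ℕ → ℝ) : ℕ → ℝ
  | 0 => 0
  | k + 1 => max (lindley g z k + z k - g (k + 1)) 0

lemma lindley_nonneg (g z : ℕ → ℝ) (k : ℕ) : 0 ≤ lindley g z k := by
  cases k with
  | zero => exact le_rfl
  | succ k => exact le_max_right _ _

lemma lindley_congr {g z z' : ℕ → ℝ} {k : ℕ} (h : ∀ j < k, z j = z' j) :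
    lindley g z k = lindley g z' k := by
  induction k with
  | zero => rfl
  | succ k ih => rw [lindley, lindley, ih fun j hj => h j (by omega), h k (by omega)]

/-- Starting with one job fewer can only shorten the waiting times. -/
lemma lindley_shift_le (g z : ℕ → ℝ) (k : ℕ) :
    lindley (fun k => g (k + 1)) (fun k => z (k + 1)) k ≤ lindley g z (k + 1) := by
  induction k with
  | zero => exact lindley_nonneg _ _ _
  | succ k ih =>
    rw [lindley, lindley]
    exact max_le_max (by linarith) le_rfl

lemma measurable_lindley {α : Type*} [MeasurableSpace α] {g z : ℕ → α → ℝ}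
    (hg : ∀ k, Measurable (g k)) (hz : ∀ k, Measurable (z k)) (k : ℕ) :
    Measurable fun x => lindley (fun j => g j x) (fun j => z j x) k := by
  induction k with
  | zero => exact measurable_const
  | succ k ih => exact ((ih.add (hz k)).sub (hg (k + 1))).max measurable_const

/-- Tangent inequality at `a` for the convex function `b ↦ b ^ 2 / 2 - (b - g)⁺ ^ 2 / 2`, whose
derivative is `min b g`. -/
lemma sq_sub_sq_ge (g a b : ℝ) :
    a ^ 2 / 2 - max (a - g) 0 ^ 2 / 2 + min a g * (b - a) ≤ b ^ 2 / 2 - max (b - g) 0 ^ 2 / 2 := by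
  rcases le_total a g with h1 | h1 <;> rcases le_total b g with h2 | h2
  · rw [max_eq_right (by linarith), max_eq_right (by linarith), min_eq_left h1]
    nlinarith [sq_nonneg (a - b)]
  · rw [max_eq_right (by linarith), max_eq_left (by linarith), min_eq_left h1]
    nlinarith [mul_nonneg (sub_nonneg.2 h1) (sub_nonneg.2 h2)]
  · rw [max_eq_left (by linarith), max_eq_right (by linarith), min_eq_right h1]
    nlinarith [sq_nonneg (b - g)]
  · rw [max_eq_left (by linarith), max_eq_left (by linarith), min_eq_right h1]
    nlinarith

/-- Work at the servers, compared with a single queue that receives the average work. -/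
lemma sum_sq_le_of_lindley [NeZero n] {g : ℕ → ℝ} (hg : ∀ k, 0 ≤ g k) {W P : ℕ → Fin n → ℝ}
    (hP : ∀ k i, 0 ≤ P k i) (h0 : ∀ i, W 0 i = 0)
    (hW : ∀ k i, W (k + 1) i = max (W k i + P k i - g (k + 1)) 0) {y : ℕ → ℝ}
    (hy : ∀ k, (n : ℝ) * y k = ∑ i, P k i) (J : ℕ) :
    (n : ℝ) * ∑ k ∈ Finset.range J, (lindley g y k * y k + y k ^ 2 / 2)
      ≤ ∑ k ∈ Finset.range J, ∑ i, ((W k i + P k i) ^ 2 - W k i ^ 2) / 2 := by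
  have hn : (0 : ℝ) < n := by exact_mod_cast Nat.pos_of_ne_zero (NeZero.ne n)
  have hy0 : ∀ k, 0 ≤ y k := fun k => by
    have : 0 ≤ (n : ℝ) * y k := by rw [hy]; exact Finset.sum_nonneg fun i _ => hP k i
    exact nonneg_of_mul_nonneg_right this hn
  -- An idle server wastes capacity while others still work, so the total workload is at least that
  -- of the balanced system.
  have hmean : ∀ J, (n : ℝ) * lindley g y J ≤ ∑ i, W J i := by
    intro J
    induction J with
    | zero => simp [lindley, h0]
    | succ J ih =>
      have h1 : (n : ℝ) * (lindley g y J + y J - g (J + 1)) ≤ ∑ i, W (J + 1) i := by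
        calc (n : ℝ) * (lindley g y J + y J - g (J + 1))
            ≤ (∑ i, W J i) + (∑ i, P J i) - n * g (J + 1) := by rw [← hy]; linarith
          _ = ∑ i, (W J i + P J i - g (J + 1)) := by
              rw [Finset.sum_sub_distrib, Finset.sum_add_distrib]; simp
          _ ≤ ∑ i, W (J + 1) i := Finset.sum_le_sum fun i _ => by
              rw [hW]; exact le_max_left _ _
      have h2 : 0 ≤ ∑ i, W (J + 1) i := Finset.sum_nonneg fun i _ => by
        rw [hW]; exact le_max_right _ _
      rw [lindley]
      rcases max_choice (lindley g y J + y J - g (J + 1)) 0 with h | h <;> rw [h]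
      · exact h1
      · simpa using h2
  -- Subtracting the final squares telescopes both sides into values of the convex function of
  -- `sq_sub_sq_ge`. Its slope at the balanced workload is nonnegative, so `hmean` suffices.
  have key : (n : ℝ) * (∑ k ∈ Finset.range J, (lindley g y k * y k + y k ^ 2 / 2)
      - lindley g y J ^ 2 / 2)
      ≤ ∑ k ∈ Finset.range J, ∑ i, ((W k i + P k i) ^ 2 - W k i ^ 2) / 2 - ∑ i, W J i ^ 2 / 2 := by
    induction J with
    | zero => simp [lindley, h0]
    | succ J ih =>
      rw [Finset.sum_range_succ, Finset.sum_range_succ]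
      set v := lindley g y J + y J with hv
      have hv0 : 0 ≤ v := add_nonneg (lindley_nonneg _ _ _) (hy0 J)
      have h1 : ∑ i, (v ^ 2 / 2 - max (v - g (J + 1)) 0 ^ 2 / 2
          + min v (g (J + 1)) * (W J i + P J i - v))
          ≤ ∑ i, ((W J i + P J i) ^ 2 / 2 - W (J + 1) i ^ 2 / 2) :=
        Finset.sum_le_sum fun i _ => by
          rw [hW]; exact sq_sub_sq_ge _ _ _
      rw [Finset.sum_add_distrib, ← Finset.mul_sum, Finset.sum_sub_distrib (f := fun i =>
        W J i + P J i), Finset.sum_add_distrib, ← hy] at h1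
      simp only [Finset.sum_const, Finset.card_univ, Fintype.card_fin, nsmul_eq_mul] at h1
      have h2 : 0 ≤ min v (g (J + 1)) * (∑ i, W J i + n * y J - n * v) :=
        mul_nonneg (le_min hv0 (hg _)) (by rw [hv]; linarith [hmean J])
      have h3 : lindley g y (J + 1) = max (v - g (J + 1)) 0 := rfl
      have h4 : ∑ i, ((W J i + P J i) ^ 2 / 2 - W (J + 1) i ^ 2 / 2)
          = ∑ i, ((W J i + P J i) ^ 2 - W J i ^ 2) / 2 + ∑ i, W J i ^ 2 / 2
            - ∑ i, W (J + 1) i ^ 2 / 2 := by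
        rw [← Finset.sum_add_distrib, ← Finset.sum_sub_distrib]
        exact Finset.sum_congr rfl fun i _ => by ring
      rw [h3]
      have h5 : lindley g y J * y J + y J ^ 2 / 2 = v ^ 2 / 2 - lindley g y J ^ 2 / 2 := by
        rw [hv]; ring
      rw [h5]
      linarith
  have hsq : (n : ℝ) * (lindley g y J ^ 2 / 2) ≤ ∑ i, W J i ^ 2 / 2 := by
    have h1 : ∑ i, (lindley g y J ^ 2 / 2 + lindley g y J * (W J i - lindley g y J))
        ≤ ∑ i, W J i ^ 2 / 2 := Finset.sum_le_sum fun i _ => by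
      nlinarith [sq_nonneg (W J i - lindley g y J)]
    rw [Finset.sum_add_distrib, ← Finset.mul_sum, Finset.sum_sub_distrib] at h1
    simp only [Finset.sum_const, Finset.card_univ, Fintype.card_fin, nsmul_eq_mul] at h1
    nlinarith [mul_nonneg (lindley_nonneg g y J) (sub_nonneg.2 (hmean J))]
  linarith

end Comparison

/-! ### Optimality of forking to all servers for exponential service times -/

section ExponentialOptimality

variable {r : ℕ} {s l : ℝ}

lemma consumptionAt_eq (p : Policy n r) (j : ℕ) (w : Path n) :
    consumptionAt p j w = ∑ i, workAt p j i w := by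
  simp only [consumptionAt, consumption, workAt]
  rw [← Finset.sum_filter]
  simp only [Finset.filter_mem_eq_inter, Finset.univ_inter]
  rfl

/-- The other servers contribute nothing; at a chosen one, waiting plus work is the larger of the
waiting and the response time. -/
lemma sum_sq_workAt (p : Policy n r) (j : ℕ) (w : Path n) :
    ∑ i, ((waitAt p j i w + workAt p j i w) ^ 2 - waitAt p j i w ^ 2) / 2
      = ∑ i ∈ p.choice j w, (max (finishAt p j w - arrival j w)
        (max (arrival j w) (freeAt p j w i) - arrival j w) ^ 2
          - (max (arrival j w) (freeAt p j w i) - arrival j w) ^ 2) / 2 := by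
  symm
  refine Finset.sum_subset_zero_on_sdiff (Finset.subset_univ _) (fun i hi => ?_) fun i hi => ?_
  · rw [workAt, if_neg (Finset.mem_sdiff.1 hi).2]; ring
  · rw [workAt, if_pos hi, waitAt]
    have h1 : max (freeAt p j w i - arrival j w) 0
        = max (arrival j w) (freeAt p j w i) - arrival j w := by grind
    have h2 : max (finishAt p j w - arrival j w)
          (max (arrival j w) (freeAt p j w i) - arrival j w)
        = max (arrival j w) (freeAt p j w i) - arrival j w
          + max (finishAt p j w - max (arrival j w) (freeAt p j w i)) 0 := by grind
    rw [h1, h2]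

lemma lintegral_sq_le_jobLatency (hs : 0 < s) (hl : 0 < l) (hr : 1 ≤ r) (p : Policy n r) (j : ℕ) :
    ENNReal.ofReal s * ∫⁻ w, ENNReal.ofReal (∑ i, ((waitAt p j i w + workAt p j i w) ^ 2
        - waitAt p j i w ^ 2) / 2) ∂law n (expMeasure s) l
      ≤ jobLatency (expMeasure s) l p j := by
  have := isProbabilityMeasure_expMeasure hs
  have hm : Measurable fun w => ENNReal.ofReal (∑ i, ((waitAt p j i w + workAt p j i w) ^ 2
        - waitAt p j i w ^ 2) / 2) := by fun_prop
  have hm' : Measurable fun w => ∫⁻ x, ENNReal.ofReal (∑ i, ((waitAt p j i (setService j x w)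
      + workAt p j i (setService j x w)) ^ 2 - waitAt p j i (setService j x w) ^ 2) / 2)
        ∂(Measure.pi fun _ : Fin n => expMeasure s) :=
    (hm.comp (measurable_setService_pair j)).lintegral_prod_right'
  have e := lintegral_setService (expMeasure s) hl j
    (f := fun w : Path n => ENNReal.ofReal (finishAt p j w - arrival j w)) (by fun_prop)
  rw [jobLatency_eq, e, lintegral_setService _ hl j hm, ← lintegral_const_mul _ hm']
  refine lintegral_mono fun w => ?_
  simp only [sum_sq_workAt, finishAt_setService_self, arrival_setService,
    p.choice_setService le_rfl, freeAt_setService p le_rfl]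
  exact lintegral_sq_le_lintegral_finish hs _ (p.choice_nonempty hr j w) _

/-- Average time that a server spends on job `j`. -/
noncomputable def loadAt (p : Policy n r) (j : ℕ) (w : Path n) : ℝ := consumptionAt p j w / n

@[fun_prop] lemma measurable_loadAt (p : Policy n r) (j : ℕ) : Measurable (loadAt p j) := by
  unfold loadAt; fun_prop

lemma loadAt_nonneg (p : Policy n r) (j : ℕ) (w : Path n) : 0 ≤ loadAt p j w :=
  div_nonneg (consumptionAt_nonneg p j w) (by positivity)

lemma loadAt_setService_of_lt (p : Policy n r) {j k : ℕ} (h : j < k) (x : Fin n → ℝ)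
    (w : Path n) : loadAt p j (setService k x w) = loadAt p j w := by
  rw [loadAt, loadAt, consumptionAt_setService_of_lt p h]

lemma measurePreserving_shift (μ : Measure ℝ) [IsProbabilityMeasure μ] (hl : 0 < l) :
    MeasurePreserving (fun (w : Path n) (k : ℕ) => w (k + 1)) (law n μ l) (law n μ l) := by
  have := isProbabilityMeasure_stepLaw (n := n) μ l hl
  have hm : Measurable fun (w : Path n) (k : ℕ) => w (k + 1) := by fun_prop
  refine ⟨hm, ?_⟩
  conv_rhs => rw [law_eq]
  refine Measure.eq_infinitePi (fun _ => stepLaw n μ l) fun S t ht => ?_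
  rw [Measure.map_apply hm (MeasurableSet.pi S.countable_toSet fun i _ => ht i)]
  have hset : (fun (w : Path n) (k : ℕ) => w (k + 1)) ⁻¹' (Set.pi S t)
      = Set.pi (S.map ⟨Nat.succ, Nat.succ_injective⟩) fun k => t (k - 1) := by
    ext w
    simp [Set.mem_pi]
  rw [hset, law_eq, Measure.infinitePi_pi _ (fun i _ => ht (i - 1)), Finset.prod_map]
  simp

lemma meanLatency_mono {μ : Measure ℝ} {p : Policy n r} (h : Monotone (jobLatency μ l p)) :
    Monotone (meanLatency μ l p) := by
  refine monotone_nat_of_le_succ fun k => ?_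
  rw [meanLatency, meanLatency, ENNReal.le_div_iff_mul_le (by simp) (by simp), mul_comm,
    ← mul_div_assoc]
  refine ENNReal.div_le_of_le_mul ?_
  rw [Finset.sum_range_succ _ (k + 1), add_mul, Nat.cast_succ (k + 1), add_mul, one_mul,
    mul_comm ((k + 1 : ℕ) : ℝ≥0∞)]
  refine add_le_add le_rfl ?_
  refine (Finset.sum_le_card_nsmul _ _ (jobLatency μ l p (k + 1)) fun j hj =>
    h (Finset.mem_range.1 hj).le).trans ?_
  rw [Finset.card_range, nsmul_eq_mul, mul_comm]

variable [NeZero n]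

/-- Whatever the past, the load of a job has the law of the minimum of `n` service times. Exchanging
loads for minima job by job shows that the balanced queue has the same mean waiting times under
every policy. -/
lemma lintegral_lindley_loadAt (hs : 0 < s) (hl : 0 < l) (hr : 1 ≤ r) (p : Policy n r) (k : ℕ) :
    ∫⁻ w, ENNReal.ofReal (lindley (fun j => gap j w) (fun j => loadAt p j w) k)
        ∂law n (expMeasure s) l
      = ∫⁻ w, ENNReal.ofReal (lindley (fun j => gap j w) (fun j => minService (service j w)) k)
        ∂law n (expMeasure s) l := by
  have := isProbabilityMeasure_expMeasure hs
  -- Hybrid sequence with true loads before `m` and minima from `m` on. Job `m` is the last true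
  -- load in `Z (m + 1)`, so its service times influence no later entry and can be integrated out.
  set Z : ℕ → ℕ → Path n → ℝ := fun m j w =>
    if j < m then loadAt p j w else minService (service j w) with hZ
  have hZm : ∀ m j, Measurable (Z m j) := by
    intro m j
    simp only [hZ]
    split_ifs <;> fun_prop
  have hstep : ∀ m, ∫⁻ w, ENNReal.ofReal (lindley (fun j => gap j w) (fun j => Z m j w) k)
        ∂law n (expMeasure s) l
      = ∫⁻ w, ENNReal.ofReal (lindley (fun j => gap j w) (fun j => minService (service j w)) k)
        ∂law n (expMeasure s) l := by
    intro m
    induction m with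
    | zero => simp [hZ]
    | succ m ih =>
      rw [← ih, lintegral_setService _ hl m
        (measurable_lindley (fun j => measurable_gap j) (hZm (m + 1)) k).ennreal_ofReal,
        lintegral_setService _ hl m
        (measurable_lindley (fun j => measurable_gap j) (hZm m) k).ennreal_ofReal]
      refine lintegral_congr fun w => ?_
      set Φ : ℝ → ℝ≥0∞ := fun v => ENNReal.ofReal (lindley (fun j => gap j w)
        (fun j => if j < m then loadAt p j w else if j = m then v
          else minService (service j w)) k) with hΦ
      have hΦm : Measurable Φ := by
        refine (measurable_lindley (g := fun j _ => gap j w) (fun j => measurable_const)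
          (fun j => ?_) k).ennreal_ofReal
        split_ifs <;> fun_prop
      have e1 : ∀ x, ENNReal.ofReal (lindley (fun j => gap j (setService m x w))
          (fun j => Z (m + 1) j (setService m x w)) k)
          = Φ (consumption (arrival m w) (p.choice m w) x (freeAt p m w) / n) := by
        intro x
        simp only [hΦ, gap_setService]
        congr 2
        ext j
        simp only [hZ]
        rcases lt_trichotomy j m with hj | hj | hj
        · rw [if_pos (by omega), if_pos hj, loadAt_setService_of_lt p hj]
        · subst hj
          rw [if_pos (by omega), if_neg (by omega), if_pos rfl, loadAt,
            consumptionAt_setService_self]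
        · rw [if_neg (by omega), if_neg (by omega), if_neg (by omega),
            service_setService_of_ne (by omega)]
      have e2 : ∀ x, ENNReal.ofReal (lindley (fun j => gap j (setService m x w))
          (fun j => Z m j (setService m x w)) k) = Φ (minService x) := by
        intro x
        simp only [hΦ, gap_setService]
        congr 2
        ext j
        simp only [hZ]
        rcases lt_trichotomy j m with hj | hj | hj
        · rw [if_pos hj, if_pos hj, loadAt_setService_of_lt p hj]
        · subst hj
          rw [if_neg (by omega), if_neg (by omega), if_pos rfl, service_setService_self]
        · rw [if_neg (by omega), if_neg (by omega), if_neg (by omega),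
            service_setService_of_ne (by omega)]
      simp only [e1, e2]
      exact lintegral_consumption_eq hs _ (p.choice_nonempty hr m w) _ hΦm
  rw [← hstep k]
  refine lintegral_congr fun w => ?_
  congr 1
  exact lindley_congr fun j hj => by simp only [hZ, if_pos hj]

variable {μ : Measure ℝ} [IsProbabilityMeasure μ]

lemma waitAt_forkAll_eq_lindley {w : Path n} (hw : ∀ k, 0 < gap k w)
    (hs : ∀ k i, 0 < service k w i) (j : ℕ) (i : Fin n) : waitAt (forkAll n) j i w
      = lindley (fun j => gap j w) (fun j => minService (service j w)) j := by
  induction j with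
  | zero => exact waitAt_zero _ _ hw
  | succ j ih =>
    have h0 : 0 ≤ minService (service j w) := by
      obtain ⟨k, hk⟩ := exists_minService_eq (service j w)
      rw [hk]; exact (hs j k).le
    rw [waitAt_succ _ _ _ hw, workAt_forkAll, max_eq_left h0, ih, lindley]

lemma jobLatency_forkAll_eq_lindley (hl : 0 < l) (hpos : ∀ᵐ x ∂μ, 0 < x) (j : ℕ) :
    jobLatency μ l (forkAll n) j
      = (∫⁻ w, ENNReal.ofReal (lindley (fun j => gap j w) (fun j => minService (service j w)) j)
          ∂law n μ l) + ∫⁻ x, ENNReal.ofReal (minService x) ∂(Measure.pi fun _ : Fin n => μ) := by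
  rw [jobLatency_forkAll hl j 0 hpos, lintegral_minService]
  congr 1
  refine lintegral_congr_ae ?_
  filter_upwards [ae_gap_pos μ hl, ae_service_pos μ hl hpos] with w hw hs
  rw [waitAt_forkAll_eq_lindley hw hs]

/-- Loynes' argument: by stationarity of the primitives, job `j` has the waiting law of job `j + 1`
in the system without job `0`. Monotonicity makes the averages converge, so limsup and liminf agree
for forking to all servers. -/
lemma jobLatency_forkAll_mono (hl : 0 < l) (hpos : ∀ᵐ x ∂μ, 0 < x) :
    Monotone (jobLatency μ l (forkAll n)) := by
  refine monotone_nat_of_le_succ fun j => ?_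
  rw [jobLatency_forkAll_eq_lindley hl hpos, jobLatency_forkAll_eq_lindley hl hpos]
  refine add_le_add ?_ le_rfl
  have hm : Measurable fun w : Path n => ENNReal.ofReal
      (lindley (fun j => gap j w) (fun j => minService (service j w)) j) :=
    (measurable_lindley (fun j => measurable_gap j) (fun j => by fun_prop) j).ennreal_ofReal
  rw [← (measurePreserving_shift μ hl).lintegral_comp hm]
  refine lintegral_mono fun w => ENNReal.ofReal_le_ofReal ?_
  exact lindley_shift_le (fun j => gap j w) (fun j => minService (service j w)) j

lemma sum_jobLatency_forkAll_le (hs : 0 < s) (hl : 0 < l) (hr : 1 ≤ r) (p : Policy n r) (J : ℕ) :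
    ∑ j ∈ Finset.range J, jobLatency (expMeasure s) l (forkAll n) j
      ≤ ∑ j ∈ Finset.range J, jobLatency (expMeasure s) l p j := by
  have := isProbabilityMeasure_expMeasure hs
  have hn : (0 : ℝ) < n := by exact_mod_cast Nat.pos_of_ne_zero (NeZero.ne n)
  have hpos := ae_pos_expMeasure hs
  have hsn : 0 < s * n := mul_pos hs hn
  set L : ℕ → Path n → ℝ := fun k w => lindley (fun j => gap j w) (fun j => loadAt p j w) k with hL
  have hLm : ∀ k, Measurable (L k) := fun k =>
    measurable_lindley (fun j => measurable_gap j) (fun j => measurable_loadAt p j) k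
  have hL0 : ∀ k w, 0 ≤ L k w := fun k w => lindley_nonneg _ _ _
  have hLs : ∀ k x w, L k (setService k x w) = L k w := fun k x w => by
    simp only [hL, gap_setService]
    exact lindley_congr fun j hj => loadAt_setService_of_lt p hj x w
  have hload : ∀ k x w, loadAt p k (setService k x w)
      = consumption (arrival k w) (p.choice k w) x (freeAt p k w) / n := fun k x w => by
    rw [loadAt, consumptionAt_setService_self]
  have h1 : ∀ k, ∫⁻ w, ENNReal.ofReal (L k w) * ENNReal.ofReal (loadAt p k w)
        ∂law n (expMeasure s) l
      = (∫⁻ w, ENNReal.ofReal (L k w) ∂law n (expMeasure s) l) * ENNReal.ofReal (1 / (s * n)) := by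
    intro k
    rw [lintegral_setService _ hl k (by fun_prop), ← lintegral_mul_const _ (by fun_prop)]
    refine lintegral_congr fun w => ?_
    simp only [hLs, hload]
    rw [lintegral_const_mul _ (by fun_prop), lintegral_consumption_eq hs _
      (p.choice_nonempty hr k w) _ (Φ := ENNReal.ofReal) ENNReal.measurable_ofReal,
      lintegral_minService_expMeasure hs]
  have h2 : ∀ k, ∫⁻ w, ENNReal.ofReal (loadAt p k w) ^ 2 ∂law n (expMeasure s) l
      = 2 * ENNReal.ofReal ((1 / (s * n)) ^ 2) := by
    intro k
    have := isProbabilityMeasure_law (n := n) (expMeasure s) l hl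
    rw [lintegral_setService _ hl k (by fun_prop)]
    simp only [hload]
    rw [lintegral_congr fun w => lintegral_consumption_eq hs _ (p.choice_nonempty hr k w) _
      (Φ := fun v => ENNReal.ofReal v ^ 2) (by fun_prop), lintegral_minService_sq_expMeasure hs]
    simp
  -- The load has mean `1 / (s n)` and second moment `2 / (s n) ^ 2`, and `L k` does not depend on
  -- the service times of job `k`. So the growth of the balanced squares reproduces mean waiting
  -- plus mean service exactly.
  have h3 : ∀ k, jobLatency (expMeasure s) l (forkAll n) k
      = ENNReal.ofReal s * ∫⁻ w, ENNReal.ofReal (n * (L k w * loadAt p k w + loadAt p k w ^ 2 / 2))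
        ∂law n (expMeasure s) l := by
    intro k
    have e : ∀ w, ENNReal.ofReal (n * (L k w * loadAt p k w + loadAt p k w ^ 2 / 2))
        = ENNReal.ofReal n * (ENNReal.ofReal (L k w) * ENNReal.ofReal (loadAt p k w))
          + ENNReal.ofReal (n / 2) * ENNReal.ofReal (loadAt p k w) ^ 2 := by
      intro w
      have hl0 := loadAt_nonneg p k w
      rw [← ENNReal.ofReal_mul (hL0 k w), ← ENNReal.ofReal_mul hn.le, ← ENNReal.ofReal_pow hl0,
        ← ENNReal.ofReal_mul (by positivity), ← ENNReal.ofReal_add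
        (mul_nonneg hn.le (mul_nonneg (hL0 k w) hl0)) (by positivity)]
      congr 1; ring
    simp only [e]
    rw [lintegral_add_left (by fun_prop), lintegral_const_mul _ (by fun_prop),
      lintegral_const_mul _ (by fun_prop), h1, h2, jobLatency_forkAll_eq_lindley hl hpos,
      ← lintegral_lindley_loadAt hs hl hr p k, lintegral_minService_expMeasure hs]
    change (∫⁻ w, ENNReal.ofReal (L k w) ∂law n (expMeasure s) l) + _ = _
    rw [mul_add]
    congr 1
    · rw [mul_comm (∫⁻ w, ENNReal.ofReal (L k w) ∂law n (expMeasure s) l), ← mul_assoc, ← mul_assoc,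
        ← ENNReal.ofReal_mul hs.le, ← ENNReal.ofReal_mul hsn.le, mul_one_div_cancel hsn.ne']
      simp
    · have h2' : (2 : ℝ≥0∞) = ENNReal.ofReal 2 := by simp
      rw [h2', ← ENNReal.ofReal_mul zero_le_two, ← ENNReal.ofReal_mul (by positivity),
        ← ENNReal.ofReal_mul hs.le]
      congr 1
      field_simp
  simp only [h3]
  rw [← Finset.mul_sum, ← lintegral_finsetSum _ fun k _ => by fun_prop]
  refine le_trans ?_ (Finset.sum_le_sum fun k _ => lintegral_sq_le_jobLatency hs hl hr p k)
  rw [← Finset.mul_sum, ← lintegral_finsetSum _ fun k _ => by fun_prop]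
  refine mul_le_mul_right (lintegral_mono_ae ?_) _
  filter_upwards [ae_gap_pos (expMeasure s) hl] with w hw
  rw [← ENNReal.ofReal_sum_of_nonneg, ← ENNReal.ofReal_sum_of_nonneg]
  · refine ENNReal.ofReal_le_ofReal ?_
    rw [← Finset.mul_sum]
    refine sum_sq_le_of_lindley (g := fun j => gap j w) (fun k => (hw k).le)
      (W := fun k i => waitAt p k i w) (P := fun k i => workAt p k i w)
      (fun k i => workAt_nonneg _ _ _ _) (fun i => waitAt_zero _ _ hw)
      (fun k i => waitAt_succ _ _ _ hw) (y := fun k => loadAt p k w) (fun k => ?_) J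
    rw [loadAt, ← consumptionAt_eq, mul_div_cancel₀ _ hn.ne']
  · intro k _
    refine Finset.sum_nonneg fun i _ => ?_
    have h3 := waitAt_nonneg p k i w
    have h4 := workAt_nonneg p k i w
    nlinarith [mul_nonneg h3 h4]
  · intro k _
    have h3 := hL0 k w
    have h4 := loadAt_nonneg p k w
    positivity

/-- For exponential service times, forking to all servers is optimal at every arrival rate. -/
theorem upperLatency_forkAll_le_of_expMeasure (hs : 0 < s) (hl : 0 < l) (hr : 1 ≤ r)
    (p : Policy n r) :
    upperLatency (expMeasure s) l (forkAll n) ≤ lowerLatency (expMeasure s) l p := by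
  have := isProbabilityMeasure_expMeasure hs
  have hlim := tendsto_atTop_iSup
    (meanLatency_mono (jobLatency_forkAll_mono (n := n) hl (ae_pos_expMeasure hs)))
  rw [upperLatency, hlim.limsup_eq, ← hlim.liminf_eq]
  refine liminf_le_liminf (Eventually.of_forall fun k => ?_)
  exact ENNReal.div_le_div_right (sum_jobLatency_forkAll_le hs hl hr p (k + 1)) _

end ExponentialOptimality

end ForkJoin

theorem mainTheorem11 (n : ℕ) [NeZero n] (μ : Measure ℝ) [IsProbabilityMeasure μ]
    (hpos : ∀ᵐ x ∂μ, 0 < x) :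
    -- low traffic, every service law: in the limit of a vanishing arrival rate
    (∀ ε : ℝ, 0 < ε → ∃ l₀ : ℝ, 0 < l₀ ∧ ∀ l : ℝ, 0 < l → l < l₀ →
      ∀ r : ℕ, 1 ≤ r → r < n → ∀ p : ForkJoin.Policy n r,
        ForkJoin.upperLatency μ l (ForkJoin.forkAll n)
          ≤ ForkJoin.lowerLatency μ l p + ENNReal.ofReal ε) ∧
    -- low traffic, random service times: at every sufficiently small arrival rate
    ((∀ d : ℝ, μ ≠ Measure.dirac d) → ∃ l₀ : ℝ, 0 < l₀ ∧ ∀ l : ℝ, 0 < l → l < l₀ →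
      ∀ r : ℕ, 1 ≤ r → r < n → ∀ p : ForkJoin.Policy n r,
        ForkJoin.upperLatency μ l (ForkJoin.forkAll n) ≤ ForkJoin.lowerLatency μ l p) ∧
    -- high traffic, log-concave tail
    (ForkJoin.LogConcaveTail μ → (∀ s : ℝ, 0 < s → μ ≠ expMeasure s) →
      ∃ l₀ : ℝ≥0∞, l₀ < ForkJoin.capacity μ (ForkJoin.uniformSingle n) ∧
        ∀ l : ℝ, 0 < l → l₀ < ENNReal.ofReal l →
          ∀ r : ℕ, 1 < r → r ≤ n → ∀ p : ForkJoin.Policy n r,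
            (∀ q : ForkJoin.Policy n 1,
              ForkJoin.upperLatency μ l q ≤ ForkJoin.lowerLatency μ l p) ∧
            (ENNReal.ofReal l < ForkJoin.capacity μ (ForkJoin.uniformSingle n) →
              ForkJoin.upperLatency μ l (ForkJoin.uniformSingle n)
                < ForkJoin.lowerLatency μ l p)) ∧
    -- high traffic, log-convex tail
    (ForkJoin.LogConvexTail μ →
      ∃ l₀ : ℝ≥0∞, (l₀ < ForkJoin.capacity μ (ForkJoin.forkAll n) ∨ l₀ = 0) ∧
        ∀ l : ℝ, 0 < l → l₀ < ENNReal.ofReal l →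
          ∀ r : ℕ, 1 ≤ r → r < n → ∀ p : ForkJoin.Policy n r,
            ForkJoin.upperLatency μ l (ForkJoin.forkAll n)
              ≤ ForkJoin.lowerLatency μ l p) := by
  refine ⟨fun ε hε => ForkJoin.low_traffic hpos hε, ForkJoin.low_traffic_of_ne_dirac hpos,
    fun h hne => h.high_traffic hpos hne, fun h => ?_⟩
  -- For the exponential law the strict inequality behind the instability argument is an equality;
  -- the direct comparison holds at every rate, so the threshold is `0`.
  by_cases hexp : ∃ s : ℝ, 0 < s ∧ μ = expMeasure s
  · obtain ⟨s, hs, rfl⟩ := hexp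
    exact ⟨0, Or.inr rfl, fun l hl _ r hr _ p =>
      ForkJoin.upperLatency_forkAll_le_of_expMeasure hs hl hr p⟩
  · exact h.high_traffic hpos fun s hs he => hexp ⟨s, hs, he⟩
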